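/- **Setting.** Let $d\in\{2,3\}$ and let $\Omega\subset\mathbb R^d$ be a bounded polyhedral open set with $\Omega=\operatorname{int}\overline\Omega$. Let $\mathcal T_h$ be a conforming triangulation of $\Omega$ into $d$-simplices $\triangle$ of diameter $h_\triangle$, let $h=\max_\triangle h_\triangle$, and let $\mathbf p_1,\dots,\mathbf p_N$ be its vertices. Assume that $\mathcal T_h$ is Delaunay (no vertex lies inside the circumscribed ball of an element). Let $B_i=\{x:|x-\mathbf p_i|\le|x-\mathbf p_k|\ \forall k\}$ be the Voronoi cell of $\mathbf p_i$. The *boxes* are the cells of the interior vertices ($\mathbf p_i\in\Omega$), and they are assumed to lie in $\overline\Omega$. For $i\neq j$ put $F_{ij}=B_i\cap B_j$, $d_{ij}=|\mathbf p_i-\mathbf p_j|$, $\mathbf n_{ij}=(\mathbf p_j-\mathbf p_i)/d_{ij}$, and let $w_{ij}$ be the distance of $\mathbf p_j$ from the hyperplane containing $F_{ij}$, divided by $d_{ij}$. Write $G_i$ for the set of all $j\ne i$ (boundary vertices included) with $|F_{ij}|>0$, where $|F_{ij}|$ is the $(d-1)$-dimensional area, and $\mathcal F_h$ for the set of faces $F_{ij}$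 with $|F_{ij}|>0$ that are shared by two boxes, each face being counted once. *Mesh regularity with constant $\kappa>0$:* every $\triangle$ contains a ball of radius $h_\triangle/\kappa$; $h\le\kappa h_\triangle$ for all $\triangle$; for every box $B_i$ there is a $\triangle$ meeting $B_i$ with $\kappa^{-1}h_\triangle^d\le|B_i|\le\kappa h_\triangle^d$; for every $F_{ij}\in\mathcal F_h$ there is a $\triangle$ meeting $B_i$ with $\kappa^{-1}h_\triangle\le d_{ij}\le\kappa h_\triangle$ and $\kappa^{-1}h_\triangle^{d-1}\le|F_{ij}|\le\kappa h_\triangle^{d-1}$. $\mathcal V_h$ is the space of continuous functions on $\overline\Omega$ that are affine on each $\triangle$. For $q_h\in\mathcal V_h$, $\Pi_hq_h$ is the function with the constant value $q_h(\mathbf p_i)$ on each cell $B_i$, and $[\![\Pi_hq_h]\!]_{ij}=q_h(\mathbf p_i)-q_h(\mathbf p_j)$. For $q_h\in\mathcal V_h$ and $F_{ij}\in\mathcal F_h$, $\partial q_h/\partial\mathbf n_{ij}$ on $F_{ij}$ denotes the (constant) derivative of $q_h$ in direction $\mathbf n_{ij}$ along the edge $[\mathbf p_i,\mathbf p_j]$,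 extended as a constant to $F_{ij}$. Define $$|q_h|_{\triangle,*}^2=\sum_{F_{ij}\in\mathcal F_h}h_\triangle^3\,d_{ij}\int_{F_{ij}}\Big|\frac{\partial q_h}{\partial\mathbf n_{ij}}\Big|^2ds,\qquad |\nabla p|_{h,1}^2=\sum_{\triangle\in\mathcal T_h}\int_\triangle|D^2p|^2dx,$$ where in the first sum $h_\triangle$ is the diameter of an element, chosen arbitrarily for each face, that meets $B_i\cup B_j$. Let $\nu>0$ be the viscosity and let $\mathrm D_i=\sum_{j\in G_i}\nu|F_{ij}|/d_{ij}$. The auxiliary Rhie-Chow form is $$s_B(p,\Pi_hq_h)=\sum_{F_{ij}\in\mathcal F_h}\int_{F_{ij}}\Big(w_{ij}\mathrm D_i^{-1}\!\int_{B_i}\!\nabla p\,dx+(1-w_{ij})\mathrm D_j^{-1}\!\int_{B_j}\!\nabla p\,dx\Big)\cdot\mathbf n_{ij}[\![\Pi_hq_h]\!]_{ij}ds-\sum_{F_{ij}\in\mathcal F_h}\int_{F_{ij}}\Big(w_{ij}|B_i|\mathrm D_i^{-1}+(1-w_{ij})|B_j|\mathrm D_j^{-1}\Big)\frac{\partial p}{\partial\mathbf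 n_{ij}}[\![\Pi_hq_h]\!]_{ij}ds,$$ where for $p\in H^2_{loc}(\Omega)$ the normal derivative on $F_{ij}$ is taken from the trace of $\nabla p$. With the Gauss-Green gradient $|B_i|\nabla_{h,i}p_h=\sum_{j\in G_i}|F_{ij}|\,\mathbf n_{ij}\big(w_{ij}p_h(\mathbf p_i)+(1-w_{ij})p_h(\mathbf p_j)\big)$, the Rhie-Chow form $\tilde s_B(p_h,\Pi_hq_h)$ of $p_h\in\mathcal V_h$ is given by the same expression with $\int_{B_i}\nabla p\,dx$ replaced by $|B_i|\nabla_{h,i}p_h$ (and likewise for $j$) and with $\partial p/\partial\mathbf n_{ij}$ replaced by $(p_h(\mathbf p_j)-p_h(\mathbf p_i))/d_{ij}$. **Claim.** There is a constant $C>0$ that depends only on $d$, $\nu$ and $\kappa$ such that, for all $\Omega$ and $\mathcal T_h$ as above: 1. for all $p\in L^2(\Omega)\cap H^2_{loc}(\Omega)$ with $|\nabla p|_{h,1}<\infty$ and all $q_h\in\mathcal V_h$, $\ |s_B(p,\Pi_hq_h)|\le C\,h^{3/2}\,|\nabla p|_{h,1}\,|q_h|_{\triangle,*}$; 2. for all $p_h,q_h\in\mathcal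 V_h$, $\ |s_B(p_h,\Pi_hq_h)|\le C\,h^{1/2}\,|p_h|_{H^1(\Omega)}\,|q_h|_{\triangle,*}$; 3. for all $p_h,q_h\in\mathcal V_h$, $\ |\tilde s_B(p_h,\Pi_hq_h)|\le C\,h^{1/2}\,|p_h|_{H^1(\Omega)}\,|q_h|_{\triangle,*}$. -/

import Mathlib

open MeasureTheory Filter Topology
open scoped ENNReal RealInnerProductSpace ContDiff

noncomputable section

namespace RhieChow

/-- Points of `ℝ^d` with the Euclidean distance. -/
abbrev Pt (d : ℕ) := EuclideanSpace ℝ (Fin d)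

/-! ### Weak derivatives and traces -/

section Sobolev

variable {d : ℕ} {F : Type*} [NormedAddCommGroup F] [NormedSpace ℝ F]

/-- `f ∈ L²_loc(Ω)`. -/
def MemL2Loc (Ω : Set (Pt d)) (f : Pt d → F) : Prop :=
  ∀ K : Set (Pt d), IsCompact K → K ⊆ Ω → MemLp f 2 (volume.restrict K)

/-- `Df` is the distributional derivative of `f` on the open set `Ω`. -/
def IsWeakFDeriv (Ω : Set (Pt d)) (f : Pt d → F) (Df : Pt d → Pt d →L[ℝ] F) : Prop :=
  ∀ φ : Pt d → ℝ, ContDiff ℝ ∞ φ → HasCompactSupport φ → tsupport φ ⊆ Ω → ∀ v : Pt d,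
    ∫ x in Ω, fderiv ℝ φ x v • f x = - ∫ x in Ω, φ x • Df x v

/-- For `f ∈ H¹_loc(Ω)` with weak derivative `Df` and a `(d-1)`-dimensional piece `S` of a
hyperplane: `t` is the trace of `f` on `S ∩ Ω`, i.e. the limit in `L²_loc` of the restrictions
to `S` of smooth functions that approximate `f` in `H¹_loc(Ω)`. -/
def IsTrace (Ω S : Set (Pt d)) (f : Pt d → F) (Df : Pt d → Pt d →L[ℝ] F) (t : Pt d → F) :
    Prop :=
  ∃ φ : ℕ → Pt d → F, (∀ k, ContDiff ℝ ∞ (φ k)) ∧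
    ∀ K : Set (Pt d), IsCompact K → K ⊆ Ω →
      Tendsto (fun k => eLpNorm (φ k - f) 2 (volume.restrict K)) atTop (𝓝 0) ∧
      Tendsto (fun k => eLpNorm (fderiv ℝ (φ k) - Df) 2 (volume.restrict K)) atTop (𝓝 0) ∧
      MemLp t 2 (μHE[d - 1].restrict (S ∩ K)) ∧
      Tendsto (fun k => eLpNorm (φ k - t) 2 (μHE[d - 1].restrict (S ∩ K))) atTop (𝓝 0)

/-- `p ∈ L²(Ω) ∩ H²_loc(Ω)`, with weak gradient `g` and weak Hessian `H` (the weak derivative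
of `g`). -/
structure IsH2Loc (Ω : Set (Pt d)) (p : Pt d → ℝ) (g : Pt d → Pt d)
    (H : Pt d → Pt d →L[ℝ] Pt d) : Prop where
  memLp : MemLp p 2 (volume.restrict Ω)
  grad_memL2Loc : MemL2Loc Ω g
  hess_memL2Loc : MemL2Loc Ω H
  isWeakGrad : IsWeakFDeriv Ω p (fun x => innerSL ℝ (g x))
  isWeakHess : IsWeakFDeriv Ω g H

end Sobolev

/-! ### The primal mesh -/

/-- A conforming simplicial triangulation of `Ω`: finitely many vertices `p_i`, and elements,
each given by the indices of its `d + 1` vertices. -/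
structure Triangulation (d : ℕ) (Ω : Set (Pt d)) where
  /-- the number of vertices -/
  N : ℕ
  /-- the vertices -/
  vert : Fin N → Pt d
  /-- the elements -/
  elems : Finset (Finset (Fin N))
  vert_injective : Function.Injective vert
  vert_used : ∀ i, ∃ T ∈ elems, i ∈ T
  card_elem : ∀ T ∈ elems, T.card = d + 1
  affineIndependent : ∀ T ∈ elems, AffineIndependent ℝ (fun k : T => vert k)
  conforming : ∀ S ∈ elems, ∀ T ∈ elems,
    convexHull ℝ (vert '' S) ∩ convexHull ℝ (vert '' T) ⊆ convexHull ℝ (vert '' (S ∩ T : Set (Fin N)))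
  cover : ⋃ T ∈ elems, convexHull ℝ (vert '' T) = closure Ω

namespace Triangulation

variable {d : ℕ} {Ω : Set (Pt d)} (M : Triangulation d Ω)

/-- The closed simplex with vertex indices `T`. -/
def simplex (T : Finset (Fin M.N)) : Set (Pt d) := convexHull ℝ (M.vert '' T)

/-- The diameter of an element. -/
def diam (T : Finset (Fin M.N)) : ℝ := Metric.diam (M.simplex T)

/-- The mesh size `h`, the largest diameter of an element. -/
def meshSize : ℝ := ⨆ T : M.elems, M.diam T.1

/-- No vertex lies in the open ball bounded by the circumscribed sphere of an element. -/
def IsDelaunay : Prop :=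
  ∀ T ∈ M.elems, ∀ (c : Pt d) (r : ℝ), (∀ k ∈ T, dist (M.vert k) c = r) →
    ∀ m, r ≤ dist (M.vert m) c

/-- `p_h ∈ V_h`: continuous on the closure of `Ω` and affine on each element. -/
def IsP1 (p : Pt d → ℝ) : Prop :=
  ContinuousOn p (closure Ω) ∧
    ∀ T ∈ M.elems, ∃ A : Pt d →ᵃ[ℝ] ℝ, Set.EqOn p A (M.simplex T)

/-! ### The dual mesh -/

open Classical in
/-- The indices of the interior vertices; these index the boxes. -/
def interiorVerts : Finset (Fin M.N) := Finset.univ.filter (fun i => M.vert i ∈ Ω)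

/-- The (closed) Voronoi cell of the vertex `p_i`. For an interior vertex it is the box `B_i`. -/
def cell (i : Fin M.N) : Set (Pt d) :=
  {x | ∀ k, dist x (M.vert i) ≤ dist x (M.vert k)}

/-- The volume `|B_i|`. -/
def cellVol (i : Fin M.N) : ℝ := volume.real (M.cell i)

/-- The set `F_ij` shared by two cells. -/
def face (i j : Fin M.N) : Set (Pt d) := M.cell i ∩ M.cell j

/-- The area `|F_ij|`. -/
def faceArea (i j : Fin M.N) : ℝ := (μHE[d - 1] : Measure (Pt d)).real (M.face i j)

/-- The distance `d_ij`. -/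
def dij (i j : Fin M.N) : ℝ := dist (M.vert i) (M.vert j)

/-- The unit normal `n_ij` of `F_ij` that points out of `B_i`. -/
def normal (i j : Fin M.N) : Pt d := (M.dij i j)⁻¹ • (M.vert j - M.vert i)

/-- The interpolation weight `w_ij`: the distance of `p_j` from the hyperplane that contains
`F_ij`, divided by `d_ij`. -/
def weight (i j : Fin M.N) : ℝ :=
  Metric.infDist (M.vert j) (AffineSubspace.perpBisector (M.vert i) (M.vert j) : Set (Pt d))
    / M.dij i j

open Classical in
/-- The neighbours of the cell of `p_i`: those cells that have a face (of positive area)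
in common with it. -/
def neighbours (i : Fin M.N) : Finset (Fin M.N) :=
  Finset.univ.filter (fun j => j ≠ i ∧ 0 < (μHE[d - 1] : Measure (Pt d)) (M.face i j))

open Classical in
/-- The set `𝓕_h` of the faces shared by two boxes. Each face `F_ij` is listed once, with
`i < j`; all summands below are invariant under exchanging `i` and `j`. -/
def faces : Finset (Fin M.N × Fin M.N) :=
  Finset.univ.filter (fun e => e.1 ∈ M.interiorVerts ∧ e.2 ∈ M.interiorVerts ∧
    e.1 < e.2 ∧ e.2 ∈ M.neighbours e.1)

/-- The boxes of the interior vertices lie in the closure of `Ω`. -/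
def BoxesInside : Prop := ∀ i ∈ M.interiorVerts, M.cell i ⊆ closure Ω

/-- Mesh regularity with constant `κ`: shape regularity and quasi-uniformity of the elements,
and comparability of the dual quantities with powers of the diameter of a nearby element. -/
structure IsRegular (κ : ℝ) : Prop where
  shape : ∀ T ∈ M.elems, ∃ c, Metric.closedBall c (M.diam T / κ) ⊆ M.simplex T
  quasiUniform : ∀ T ∈ M.elems, M.meshSize ≤ κ * M.diam T
  box : ∀ i ∈ M.interiorVerts, ∃ T ∈ M.elems, (M.simplex T ∩ M.cell i).Nonempty ∧
    κ⁻¹ * M.diam T ^ d ≤ M.cellVol i ∧ M.cellVol i ≤ κ * M.diam T ^ d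
  face : ∀ e ∈ M.faces, ∃ T ∈ M.elems, (M.simplex T ∩ M.cell e.1).Nonempty ∧
    (κ⁻¹ * M.diam T ≤ M.dij e.1 e.2 ∧ M.dij e.1 e.2 ≤ κ * M.diam T) ∧
    (κ⁻¹ * M.diam T ^ (d - 1) ≤ M.faceArea e.1 e.2 ∧
      M.faceArea e.1 e.2 ≤ κ * M.diam T ^ (d - 1))

/-! ### Discrete functions -/

/-- The lumping map: the values of `Π_h q_h` on the cells. -/
def lump (q : Pt d → ℝ) (i : Fin M.N) : ℝ := q (M.vert i)

/-- The normal derivative on `F_ij` of a function of `V_h`: its derivative in direction `n_ij`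
along the edge from `p_i` to `p_j`, extended as a constant to `F_ij`. -/
def edgeDeriv (q : Pt d → ℝ) (i j : Fin M.N) : Pt d → ℝ :=
  fun _ => lineDeriv ℝ q (midpoint ℝ (M.vert i) (M.vert j)) (M.normal i j)

/-! ### Seminorms -/

/-- The broken seminorm `|∇p|_{h,1}`, where `H` is the Hessian of `p`. -/
def brokenSeminorm (H : Pt d → Pt d →L[ℝ] Pt d) : ℝ :=
  √(∑ T ∈ M.elems, ∫ x in M.simplex T, ∑ k : Fin d, ‖H x (EuclideanSpace.single k 1)‖ ^ 2)

/-- The seminorm `|q_h|_{△,*}` of `q_h ∈ V_h`; `τ i j` is the element whose diameter is used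
as `h_△` at the face `F_ij`. -/
def starSeminorm (τ : Fin M.N → Fin M.N → Finset (Fin M.N)) (q : Pt d → ℝ) : ℝ :=
  √(∑ e ∈ M.faces, M.diam (τ e.1 e.2) ^ 3 * M.dij e.1 e.2 *
    ∫ x in M.face e.1 e.2, |M.edgeDeriv q e.1 e.2 x| ^ 2 ∂μHE[d - 1])

/-- At each face `F_ij`, `τ` chooses an element that meets `B_i ∪ B_j`. -/
def IsLocalChoice (τ : Fin M.N → Fin M.N → Finset (Fin M.N)) : Prop :=
  ∀ e ∈ M.faces, τ e.1 e.2 ∈ M.elems ∧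
    (M.simplex (τ e.1 e.2) ∩ (M.cell e.1 ∪ M.cell e.2)).Nonempty

/-! ### The Rhie-Chow forms -/

/-- The diagonal coefficient `D_i` of the matrix of the velocity form with viscosity `ν`. -/
def diagCoeff (ν : ℝ) (i : Fin M.N) : ℝ :=
  ∑ j ∈ M.neighbours i, ν * (M.faceArea i j / M.dij i j)

/-- The first part of the auxiliary form, for a function with gradient `g`. The argument `z`
gives the values of a function of `W_h` on the boxes. -/
def auxForm₁ (ν : ℝ) (g : Pt d → Pt d) (z : Fin M.N → ℝ) : ℝ :=
  ∑ e ∈ M.faces, ∫ _x in M.face e.1 e.2,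
    ⟪(M.weight e.1 e.2 * (M.diagCoeff ν e.1)⁻¹) • (∫ y in M.cell e.1, g y)
      + ((1 - M.weight e.1 e.2) * (M.diagCoeff ν e.2)⁻¹) • (∫ y in M.cell e.2, g y),
      M.normal e.1 e.2⟫ * (z e.1 - z e.2) ∂μHE[d - 1]

/-- The second part of the auxiliary form, for a function whose normal derivative in direction
`n_ij` on `F_ij` is `dn i j`. -/
def auxForm₂ (ν : ℝ) (dn : Fin M.N → Fin M.N → Pt d → ℝ) (z : Fin M.N → ℝ) : ℝ :=
  ∑ e ∈ M.faces, ∫ x in M.face e.1 e.2,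
    (M.weight e.1 e.2 * M.cellVol e.1 * (M.diagCoeff ν e.1)⁻¹
      + (1 - M.weight e.1 e.2) * M.cellVol e.2 * (M.diagCoeff ν e.2)⁻¹)
      * dn e.1 e.2 x * (z e.1 - z e.2) ∂μHE[d - 1]

/-- `s_B(p, z)` for `p ∈ H²_loc`, where `g` is the gradient of `p` in `Ω` and `t` its trace on
the faces. -/
def sB (ν : ℝ) (g t : Pt d → Pt d) (z : Fin M.N → ℝ) : ℝ :=
  M.auxForm₁ ν g z - M.auxForm₂ ν (fun i j x => ⟪t x, M.normal i j⟫) z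

/-- `s_B(p_h, z)` for `p_h ∈ V_h`. -/
def sBDiscrete (ν : ℝ) (p : Pt d → ℝ) (z : Fin M.N → ℝ) : ℝ :=
  M.auxForm₁ ν (gradient p) z - M.auxForm₂ ν (M.edgeDeriv p) z

/-- The Gauss-Green gradient `∇_{h,i} p_h` on the box `B_i`. -/
def gaussGreen (p : Pt d → ℝ) (i : Fin M.N) : Pt d :=
  (M.cellVol i)⁻¹ • ∑ j ∈ M.neighbours i,
    (M.faceArea i j * (M.weight i j * M.lump p i + (1 - M.weight i j) * M.lump p j)) •
      M.normal i j

/-- The Rhie-Chow form `s̃_B(p_h, z)`. -/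
def sTilde (ν : ℝ) (p : Pt d → ℝ) (z : Fin M.N → ℝ) : ℝ :=
  (∑ e ∈ M.faces, ∫ _x in M.face e.1 e.2,
    ⟪(M.weight e.1 e.2 * (M.diagCoeff ν e.1)⁻¹ * M.cellVol e.1) • M.gaussGreen p e.1
      + ((1 - M.weight e.1 e.2) * (M.diagCoeff ν e.2)⁻¹ * M.cellVol e.2) • M.gaussGreen p e.2,
      M.normal e.1 e.2⟫ * (z e.1 - z e.2) ∂μHE[d - 1])
  - ∑ e ∈ M.faces, ∫ _x in M.face e.1 e.2,
    (M.weight e.1 e.2 * M.cellVol e.1 * (M.diagCoeff ν e.1)⁻¹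
      + (1 - M.weight e.1 e.2) * M.cellVol e.2 * (M.diagCoeff ν e.2)⁻¹)
      * ((M.lump p e.2 - M.lump p e.1) / M.dij e.1 e.2) * (z e.1 - z e.2) ∂μHE[d - 1]

end Triangulation

/-- The seminorm `|p|_{H¹}` of a piecewise differentiable continuous function. -/
def h1Seminorm {d : ℕ} (Ω : Set (Pt d)) (p : Pt d → ℝ) : ℝ :=
  √(∫ x in Ω, ‖gradient p x‖ ^ 2)

end RhieChow

end

/-! A face of the Voronoi mesh lies in the bisecting hyperplane of its two vertices, so all weights
are 1/2, and each form splits into half-contributions of the two boxes at a face F. In each of them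
`D_i⁻¹` multiplies the defect between the integral of a gradient over the box and `|B_i|` times a
gradient on the face.

For p in H²_loc this defect is at most the double integral of `|t(x) - g(y)|` over x in F and y in
the box, t being the trace of the gradient g. The cone over F with apex `p_i` carries the proof
(`lintegral_trace_sub_le`): t(x) is compared with g at a point of the ray from the apex to x, that
value is compared with g(y) by a Poincaré inequality on the convex box, and the intermediate point
is averaged over the outer half of the ray, where cone and cylinder measures are comparable. The
estimates are made in L¹ for smooth functions and carried over to g and t by approximation. Boxes
may touch the boundary of Ω, where nothing is known to converge, so they are exhausted from inside
by compact sets.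

For discrete p no cancellation is used: both parts of each form are bounded separately by local
energies. The integral over a box yields to Cauchy-Schwarz. For the difference quotients the
Delaunay property is essential: vertices whose cells share a face of positive area are joined by a
mesh edge (`exists_elem_of_mem_neighbours`), so a difference of vertex values is controlled by the
gradient on one element. The Gauss-Green gradient becomes a sum of such differences because the
area-weighted normals of a box add up to zero (`sum_faceArea_smul_normal`).

Everything is collected in `abs_sum_faces_le`. A face contributes at most `h^k h^(d/2) (m_i + m_j)
|q_i - q_j|`, with k = 2 for the trace form and k = 1 for the discrete forms. Cauchy-Schwarz over
the faces, the bounded number of neighbours, and `h^(d+1) ∑ |q_i - q_j|² ≤ C |q|²` in the star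
seminorm produce the factor `h^(k - 1/2)`. -/

noncomputable section

namespace RhieChow

section

variable {d : ℕ}

/-! ### Integration over cones -/

/-- The cone with apex `a` over the subset `F` of the hyperplane through `a + v` normal to `v`,
without its apex. -/
def coneOver (a v : Pt d) (F : Set (Pt d)) : Set (Pt d) :=
  {y | ⟪y - a, v⟫ / ‖v‖ ^ 2 ∈ Set.Ioc (0 : ℝ) 1 ∧
    a + (⟪y - a, v⟫ / ‖v‖ ^ 2)⁻¹ • (y - a) ∈ F}

theorem measurableSet_coneOver (a v : Pt d) {F : Set (Pt d)} (hF : MeasurableSet F) :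
    MeasurableSet (coneOver a v F) := by
  have h1 : Measurable (fun y : Pt d => ⟪y - a, v⟫ / ‖v‖ ^ 2) := by fun_prop
  have h2 : Measurable (fun y : Pt d => a + (⟪y - a, v⟫ / ‖v‖ ^ 2)⁻¹ • (y - a)) := by fun_prop
  exact (h1 measurableSet_Ioc).inter (h2 hF)

theorem homothety_mem_coneOver {a v x : Pt d} {F : Set (Pt d)} (hv : v ≠ 0) (hx : x ∈ F)
    (hFv : ⟪x - a, v⟫ = ‖v‖ ^ 2) {r : ℝ} (hr : r ∈ Set.Ioc (0 : ℝ) 1) :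
    AffineMap.homothety a r x ∈ coneOver a v F := by
  have hv' : ‖v‖ ^ 2 ≠ 0 := by positivity
  have h : ⟪AffineMap.homothety a r x - a, v⟫ / ‖v‖ ^ 2 = r := by
    simp [AffineMap.homothety_apply, inner_smul_left, hFv]
    field_simp
  refine ⟨by rwa [h], ?_⟩
  rw [h]
  simp [AffineMap.homothety_apply, smul_smul, inv_mul_cancel₀ hr.1.ne', hx]

/-- Fubini in the direction `v`: the slice of the cone at relative height `r` is the image of `F`
under the homothety of ratio `r`, which scales (d-1)-dimensional measure by `r ^ (d - 1)`. The test
set `E` is kept so that the formula determines the whole measure on the cone, not only its mass. -/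
theorem volume_coneOver_inter {a v : Pt d} (hv : v ≠ 0) {F E : Set (Pt d)}
    (hF : MeasurableSet F) (hFv : ∀ x ∈ F, ⟪x - a, v⟫ = ‖v‖ ^ 2) (hE : MeasurableSet E) :
    volume (coneOver a v F ∩ E) = ‖v‖ₑ * ∫⁻ r in Set.Ioc (0 : ℝ) 1,
      ENNReal.ofReal r ^ (d - 1) * μHE[d - 1] (F ∩ AffineMap.homothety a r ⁻¹' E) := by
  have hv' : ‖v‖ ^ 2 ≠ 0 := by positivity
  have key := EuclideanGeometry.euclideanHausdorffMeasure_eq_lintegral a hv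
    ((measurableSet_coneOver a v hF).inter hE)
  rw [finrank_euclideanSpace_fin, EuclideanSpace.euclideanHausdorffMeasure_eq_volume] at key
  rw [key, ← lintegral_indicator measurableSet_Ioc]
  congr 2
  ext r
  have hslice : ∀ y : Pt d, y ∈ AffineSubspace.mk' (r • v +ᵥ a) (ℝ ∙ v)ᗮ ↔
      ⟪y - a, v⟫ / ‖v‖ ^ 2 = r := by
    intro y
    rw [AffineSubspace.mem_mk', Submodule.mem_orthogonal_singleton_iff_inner_left, vadd_eq_add,
      vsub_eq_sub, div_eq_iff hv', show y - (r • v + a) = (y - a) - r • v by abel, inner_sub_left,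
      inner_smul_left, real_inner_self_eq_norm_sq]
    simp [sub_eq_zero]
  by_cases hr : r ∈ Set.Ioc (0 : ℝ) 1
  · rw [Set.indicator_of_mem hr]
    have himg : coneOver a v F ∩ E ∩ (AffineSubspace.mk' (r • v +ᵥ a) (ℝ ∙ v)ᗮ : Set (Pt d)) =
        AffineMap.homothety a r '' (F ∩ AffineMap.homothety a r ⁻¹' E) := by
      ext y
      constructor
      · rintro ⟨⟨⟨_, h2⟩, h3⟩, h4⟩
        rw [SetLike.mem_coe, hslice] at h4
        rw [h4] at h2
        have : AffineMap.homothety a r (a + r⁻¹ • (y - a)) = y := by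
          simp [AffineMap.homothety_apply, smul_smul, mul_inv_cancel₀ hr.1.ne']
        exact ⟨_, ⟨h2, by rwa [Set.mem_preimage, this]⟩, this⟩
      · rintro ⟨x, ⟨hx, hxE⟩, rfl⟩
        refine ⟨⟨homothety_mem_coneOver hv hx (hFv x hx) hr, hxE⟩, ?_⟩
        rw [SetLike.mem_coe, hslice]
        simp [AffineMap.homothety_apply, inner_smul_left, hFv x hx]
        field_simp
    rw [himg, euclideanHausdorffMeasure_homothety_image _ _ hr.1.ne', ENNReal.smul_def,
      smul_eq_mul]
    congr 1
    rw [ENNReal.coe_pow, ← enorm_eq_nnnorm, Real.enorm_of_nonneg hr.1.le]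
  · rw [Set.indicator_of_notMem hr]
    convert measure_empty (μ := (μHE[d - 1] : Measure (Pt d)))
    rw [Set.eq_empty_iff_forall_notMem]
    rintro y ⟨⟨⟨h1, _⟩, _⟩, h4⟩
    rw [SetLike.mem_coe, hslice] at h4
    rw [h4] at h1
    exact hr h1

/-- The factor by which the volume of a cone is smaller than that of the cylinder. -/
def coneFactor (d : ℕ) : ℝ≥0∞ := ∫⁻ r in Set.Ioc (0 : ℝ) 1, ENNReal.ofReal r ^ (d - 1)

/-- Only finiteness and positivity of the factor are needed; its value 1/d never enters. -/
theorem coneFactor_ne_top (d : ℕ) : coneFactor d ≠ ⊤ := by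
  refine ne_top_of_le_ne_top (b := ∫⁻ _r in Set.Ioc (0 : ℝ) 1, 1) (by simp) ?_
  refine setLIntegral_mono measurable_const fun r hr => ?_
  exact pow_le_one₀ zero_le (by simpa using hr.2)

theorem coneFactor_ne_zero (d : ℕ) : coneFactor d ≠ 0 := by
  rw [coneFactor, Ne, lintegral_eq_zero_iff (by fun_prop)]
  intro h
  have h' := (ae_restrict_iff' measurableSet_Ioc).1 h
  have : volume (Set.Ioc (0 : ℝ) 1) = 0 := by
    refine measure_mono_null ?_ h'
    intro r hr hr'
    have := hr' hr
    rw [Pi.zero_apply] at this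
    exact pow_ne_zero (d - 1) (by simpa using hr.1 : ENNReal.ofReal r ≠ 0) this
  simp at this

theorem volume_coneOver {a v : Pt d} (hv : v ≠ 0) {F : Set (Pt d)}
    (hF : MeasurableSet F) (hFv : ∀ x ∈ F, ⟪x - a, v⟫ = ‖v‖ ^ 2) :
    volume (coneOver a v F) = ‖v‖ₑ * coneFactor d * μHE[d - 1] F := by
  have := volume_coneOver_inter hv hF hFv MeasurableSet.univ
  simp only [Set.inter_univ, Set.preimage_univ] at this
  rw [this, lintegral_mul_const _ (by fun_prop), coneFactor, mul_assoc]

/-- The formula for sets says that Lebesgue measure on the cone is, up to `‖v‖ₑ`, the image of `r ^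
(d - 1) dr` times the area on `F` under `(r, x) ↦ homothety a r x`. The area is assumed finite so
that the product measure obeys Tonelli. -/
theorem lintegral_coneOver {a v : Pt d} (hv : v ≠ 0) {F : Set (Pt d)}
    (hF : MeasurableSet F) (hFv : ∀ x ∈ F, ⟪x - a, v⟫ = ‖v‖ ^ 2) (hfin : μHE[d - 1] F ≠ ⊤)
    {f : Pt d → ℝ≥0∞} (hf : Measurable f) :
    ∫⁻ y in coneOver a v F, f y = ‖v‖ₑ * ∫⁻ r in Set.Ioc (0 : ℝ) 1,
      ENNReal.ofReal r ^ (d - 1) * ∫⁻ x in F, f (AffineMap.homothety a r x) ∂μHE[d - 1] := by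
  have : IsFiniteMeasure (μHE[d - 1].restrict F : Measure (Pt d)) :=
    ⟨by simpa [lt_top_iff_ne_top] using hfin⟩
  have hw : Measurable (fun r : ℝ => ENNReal.ofReal r ^ (d - 1)) := by fun_prop
  have hc : Measurable (fun z : ℝ × Pt d => AffineMap.homothety a z.1 z.2) := by
    simp only [AffineMap.homothety_apply]
    fun_prop
  have hmeas : volume.restrict (coneOver a v F) = ‖v‖ₑ •
      (((volume.restrict (Set.Ioc (0 : ℝ) 1)).withDensity
        (fun r => ENNReal.ofReal r ^ (d - 1))).prod (μHE[d - 1].restrict F)).map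
        (fun z : ℝ × Pt d => AffineMap.homothety a z.1 z.2) := by
    ext E hE
    rw [Measure.restrict_apply hE, Set.inter_comm, volume_coneOver_inter hv hF hFv hE,
      Measure.smul_apply, smul_eq_mul, Measure.map_apply hc hE, Measure.prod_apply (hc hE),
      lintegral_withDensity_eq_lintegral_mul _ hw (measurable_measure_prodMk_left (hc hE))]
    congr 1
    refine lintegral_congr fun r => ?_
    simp only [Pi.mul_apply]
    congr 1
    rw [Measure.restrict_apply (measurable_prodMk_left (hc hE)), Set.inter_comm]
    rfl
  have hg : Measurable (fun z : ℝ × Pt d => f (AffineMap.homothety a z.1 z.2)) := hf.comp hc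
  rw [hmeas, lintegral_smul_measure, smul_eq_mul, lintegral_map hf hc,
    lintegral_prod _ hg.aemeasurable,
    lintegral_withDensity_eq_lintegral_mul _ hw hg.lintegral_prod_right']
  rfl

/-- The part of a cone near its base is comparable with a cylinder. -/
theorem lintegral_homothety_le {a v : Pt d} (hv : v ≠ 0) {F B : Set (Pt d)}
    (hF : MeasurableSet F) (hFv : ∀ x ∈ F, ⟪x - a, v⟫ = ‖v‖ ^ 2) (hfin : μHE[d - 1] F ≠ ⊤)
    (hB : MeasurableSet B)
    (hFB : ∀ x ∈ F, ∀ r ∈ Set.Ioc (1 / 2 : ℝ) 1, AffineMap.homothety a r x ∈ B)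
    {f : Pt d → ℝ≥0∞} (hf : Measurable f) :
    ‖v‖ₑ * ∫⁻ r in Set.Ioc (1 / 2 : ℝ) 1, ∫⁻ x in F, f (AffineMap.homothety a r x) ∂μHE[d - 1]
      ≤ 2 ^ (d - 1) * ∫⁻ y in B, f y := by
  have key := lintegral_coneOver hv hF hFv hfin (hf.indicator hB)
  have h1 : ∫⁻ y in coneOver a v F, B.indicator f y ≤ ∫⁻ y in B, f y := by
    rw [← lintegral_indicator hB]
    exact setLIntegral_le_lintegral _ _
  refine le_trans ?_ (mul_le_mul_right h1 _)
  rw [key, mul_left_comm]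
  refine mul_le_mul_right ?_ _
  rw [← lintegral_const_mul' _ _ (by simp)]
  calc ∫⁻ r in Set.Ioc (1 / 2 : ℝ) 1, ∫⁻ x in F, f (AffineMap.homothety a r x) ∂μHE[d - 1]
      ≤ ∫⁻ r in Set.Ioc (1 / 2 : ℝ) 1, 2 ^ (d - 1) * (ENNReal.ofReal r ^ (d - 1) *
        ∫⁻ x in F, B.indicator f (AffineMap.homothety a r x) ∂μHE[d - 1]) := by
        refine setLIntegral_mono' measurableSet_Ioc fun r hr => ?_
        rw [← mul_assoc, ← mul_pow]
        -- Above height 1/2 the density `r ^ (d - 1)` is at least `2 ^ (-(d - 1))`, which is where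
        -- the constant comes from.
        have h2 : (1 : ℝ≥0∞) ≤ (2 * ENNReal.ofReal r) ^ (d - 1) := by
          refine one_le_pow₀ ?_
          rw [← ENNReal.ofReal_ofNat, ← ENNReal.ofReal_mul (by norm_num), ENNReal.one_le_ofReal]
          linarith [hr.1]
        refine le_trans ?_ (le_mul_of_one_le_left' h2)
        refine setLIntegral_mono' hF fun x hx => ?_
        rw [Set.indicator_of_mem (hFB x hx r hr)]
    _ ≤ _ := lintegral_mono_set (Set.Ioc_subset_Ioc_left (by norm_num))

/-! ### Poincaré and trace inequalities -/

theorem continuous_homothety_uncurry :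
    Continuous (fun z : (Pt d × ℝ) × Pt d => AffineMap.homothety z.1.1 z.1.2 z.2) := by
  simp only [AffineMap.homothety_apply, vsub_eq_sub, vadd_eq_add]
  fun_prop

theorem enorm_sub_homothety_le {φ : Pt d → Pt d} (hφ : ContDiff ℝ ∞ φ) (a x : Pt d) {α β : ℝ}
    (hαβ : α ≤ β) :
    ‖φ (AffineMap.homothety a β x) - φ (AffineMap.homothety a α x)‖ₑ ≤
      ∫⁻ s in Set.Ioc α β, ‖fderiv ℝ φ (AffineMap.homothety a s x)‖ₑ * ‖x - a‖ₑ := by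
  have hderiv : ∀ s : ℝ, HasDerivAt (fun s : ℝ => φ (AffineMap.homothety a s x))
      (fderiv ℝ φ (AffineMap.homothety a s x) (x - a)) s := by
    intro s
    have h1 : HasDerivAt (fun s : ℝ => AffineMap.homothety a s x) (x - a) s := by
      simp only [AffineMap.homothety_apply, vsub_eq_sub, vadd_eq_add]
      simpa using ((hasDerivAt_id s).smul_const (x - a)).add_const a
    exact ((hφ.differentiable (by simp)).differentiableAt.hasFDerivAt).comp_hasDerivAt s h1
  have hcont : Continuous
      (fun s : ℝ => fderiv ℝ φ (AffineMap.homothety a s x) (x - a)) := by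
    have h2 : Continuous (fun s : ℝ => AffineMap.homothety a s x) :=
      continuous_homothety_uncurry.comp (by fun_prop : Continuous fun s : ℝ => ((a, s), x))
    exact ((hφ.continuous_fderiv (by simp)).comp h2).clm_apply continuous_const
  rw [← intervalIntegral.integral_eq_sub_of_hasDerivAt (fun s _ => hderiv s)
    (hcont.intervalIntegrable _ _), intervalIntegral.integral_of_le hαβ]
  refine (enorm_integral_le_lintegral_enorm _).trans (lintegral_mono fun s => ?_)
  exact ContinuousLinearMap.le_opENorm _ _

/-- The change of variables costs `s ^ (-d)`, which is at most `2 ^ d` because `s` stays away from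
zero. -/
theorem lintegral_homothety_volume_le {K : Set (Pt d)} (hK : MeasurableSet K) {x : Pt d} {s : ℝ}
    (hs : 1 / 2 < s) (hKs : ∀ y ∈ K, AffineMap.homothety x s y ∈ K) {f : Pt d → ℝ≥0∞}
    (hf : Measurable f) :
    ∫⁻ y in K, f (AffineMap.homothety x s y) ≤ 2 ^ d * ∫⁻ y in K, f y := by
  have hs0 : 0 < s := by linarith
  have hc : Measurable (fun y : Pt d => AffineMap.homothety x s y) :=
    (continuous_homothety_uncurry.comp
      (by fun_prop : Continuous fun y : Pt d => ((x, s), y))).measurable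
  have hmap : (volume : Measure (Pt d)).map (fun y => AffineMap.homothety x s y) ≤
      (2 : ℝ≥0∞) ^ d • volume := by
    refine Measure.le_iff.2 fun E hE => ?_
    have hpre : (fun y : Pt d => AffineMap.homothety x s y) ⁻¹' E =
        AffineMap.homothety x s⁻¹ '' E := by
      ext y
      constructor
      · intro hy
        exact ⟨_, hy, by simp [AffineMap.homothety_apply, smul_smul, inv_mul_cancel₀ hs0.ne']⟩
      · rintro ⟨z, hz, rfl⟩
        simpa [AffineMap.homothety_apply, smul_smul, mul_inv_cancel₀ hs0.ne'] using hz
    rw [Measure.map_apply hc hE, hpre, Measure.addHaar_image_homothety, Measure.smul_apply,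
      smul_eq_mul, finrank_euclideanSpace_fin]
    refine mul_le_mul_left ?_ _
    rw [abs_of_pos (by positivity), ← ENNReal.ofReal_ofNat, ← ENNReal.ofReal_pow (by norm_num)]
    refine ENNReal.ofReal_le_ofReal (pow_le_pow_left₀ (by positivity) ?_ _)
    rw [inv_le_comm₀ hs0 (by norm_num)]
    linarith
  calc ∫⁻ y in K, f (AffineMap.homothety x s y)
      ≤ ∫⁻ y in K, K.indicator f (AffineMap.homothety x s y) := by
        refine setLIntegral_mono' hK fun y hy => ?_
        rw [Set.indicator_of_mem (hKs y hy)]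
    _ ≤ ∫⁻ y, K.indicator f (AffineMap.homothety x s y) := setLIntegral_le_lintegral _ _
    _ = ∫⁻ y, K.indicator f y ∂(volume.map (fun y => AffineMap.homothety x s y)) :=
        (lintegral_map (hf.indicator hK) hc).symm
    _ ≤ ∫⁻ y, K.indicator f y ∂((2 : ℝ≥0∞) ^ d • volume) := lintegral_mono' hmap le_rfl
    _ = 2 ^ d * ∫⁻ y in K, f y := by
        rw [lintegral_smul_measure, lintegral_indicator hK, smul_eq_mul]

/-- The Poincaré inequality in L¹, with double differences instead of a mean value. The segment from
`x` to `y` is cut at its midpoint. On the half next to `y` the substitution `y ↦ homothety x s y`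
has ratio at least 1/2 and is harmless; on the other half it would degenerate, so the roles of `x`
and `y` are exchanged there. -/
theorem lintegral_lintegral_sub_le_of_contDiff {K : Set (Pt d)} (hK : MeasurableSet K)
    (hconv : Convex ℝ K) {D : ℝ≥0∞} (hD : ∀ x ∈ K, ∀ y ∈ K, ‖x - y‖ₑ ≤ D) {φ : Pt d → Pt d}
    (hφ : ContDiff ℝ ∞ φ) :
    ∫⁻ x in K, ∫⁻ y in K, ‖φ x - φ y‖ₑ ≤
      2 ^ d * D * volume K * ∫⁻ x in K, ‖fderiv ℝ φ x‖ₑ := by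
  set G : Pt d → ℝ≥0∞ := fun x => ‖fderiv ℝ φ x‖ₑ with hG
  have hGc : Continuous G := (hφ.continuous_fderiv (by simp)).enorm
  have hφc := hφ.continuous
  set A : Pt d → Pt d → ℝ≥0∞ := fun x y => ‖φ y - φ (AffineMap.homothety x (1 / 2 : ℝ) y)‖ₑ
    with hA
  have hAm : Measurable (Function.uncurry A) := by
    have : Continuous (fun z : Pt d × Pt d => AffineMap.homothety z.1 (1 / 2 : ℝ) z.2) :=
      continuous_homothety_uncurry.comp
        (by fun_prop : Continuous fun z : Pt d × Pt d => ((z.1, (1 / 2 : ℝ)), z.2))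
    exact ((hφc.comp continuous_snd).sub (hφc.comp this)).enorm.measurable
  have hle : ∀ x y, ‖φ x - φ y‖ₑ ≤ A x y + A y x := by
    intro x y
    have hmid : AffineMap.homothety x (1 / 2 : ℝ) y = AffineMap.homothety y (1 / 2 : ℝ) x := by
      simp only [AffineMap.homothety_apply, vsub_eq_sub, vadd_eq_add]
      module
    have : φ x - φ y = -(φ y - φ (AffineMap.homothety x (1 / 2 : ℝ) y)) +
        (φ x - φ (AffineMap.homothety y (1 / 2 : ℝ) x)) := by rw [hmid]; abel
    rw [this, hA]
    exact (enorm_add_le _ _).trans (by rw [enorm_neg])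
  have hAint : ∫⁻ x in K, ∫⁻ y in K, A x y ≤
      volume K * (D * (2⁻¹ * (2 ^ d * ∫⁻ x in K, G x))) := by
    rw [mul_comm, ← setLIntegral_const]
    refine setLIntegral_mono measurable_const fun x hx => ?_
    calc ∫⁻ y in K, A x y
        ≤ ∫⁻ y in K, D * ∫⁻ s in Set.Ioc (1 / 2 : ℝ) 1, G (AffineMap.homothety x s y) := by
          refine setLIntegral_mono' hK fun y hy => ?_
          have := enorm_sub_homothety_le hφ x y (α := 1 / 2) (β := 1) (by norm_num)
          rw [AffineMap.homothety_one, AffineMap.id_apply] at this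
          refine this.trans ?_
          have hm : Measurable (fun s : ℝ => ‖fderiv ℝ φ (AffineMap.homothety x s y)‖ₑ) :=
            (hGc.comp (continuous_homothety_uncurry.comp
              (by fun_prop : Continuous fun s : ℝ => ((x, s), y)))).measurable
          rw [lintegral_mul_const _ hm, mul_comm]
          exact mul_le_mul_left (hD y hy x hx) _
      _ = D * ∫⁻ s in Set.Ioc (1 / 2 : ℝ) 1, ∫⁻ y in K, G (AffineMap.homothety x s y) := by
          have hm : Measurable (fun z : Pt d × ℝ => G (AffineMap.homothety x z.2 z.1)) :=
            (hGc.comp (continuous_homothety_uncurry.comp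
              (by fun_prop : Continuous fun z : Pt d × ℝ => ((x, z.2), z.1)))).measurable
          rw [lintegral_const_mul _ hm.lintegral_prod_right',
            lintegral_lintegral_swap hm.aemeasurable]
      _ ≤ D * ∫⁻ s in Set.Ioc (1 / 2 : ℝ) 1, 2 ^ d * ∫⁻ y in K, G y := by
          refine mul_le_mul_right ?_ _
          refine setLIntegral_mono measurable_const fun s hs => ?_
          refine lintegral_homothety_volume_le hK hs.1 (fun y hy => ?_) hGc.measurable
          have := hconv hx hy (by linarith [hs.2] : 0 ≤ 1 - s) (by linarith [hs.1]) (by ring)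
          convert this using 1
          simp only [AffineMap.homothety_apply, vsub_eq_sub, vadd_eq_add]
          module
      _ = _ := by
          rw [setLIntegral_const, Real.volume_Ioc, mul_comm (2 ^ d * _)]
          congr 2
          rw [show (1 : ℝ) - 1 / 2 = 2⁻¹ by norm_num, ENNReal.ofReal_inv_of_pos (by norm_num)]
          simp
  calc ∫⁻ x in K, ∫⁻ y in K, ‖φ x - φ y‖ₑ
      ≤ ∫⁻ x in K, ∫⁻ y in K, (A x y + A y x) := by
        gcongr with x y
        exact hle x y
    _ = (∫⁻ x in K, ∫⁻ y in K, A x y) + ∫⁻ x in K, ∫⁻ y in K, A y x := by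
        have hAm' : Measurable fun x => ∫⁻ y in K, A x y := hAm.lintegral_prod_right
        rw [← lintegral_add_left hAm']
        refine lintegral_congr fun x => ?_
        exact lintegral_add_left (hAm.comp measurable_prodMk_left) _
    _ = 2 * ∫⁻ x in K, ∫⁻ y in K, A x y := by
        rw [lintegral_lintegral_swap (f := fun x y => A y x)
          (hAm.comp measurable_swap).aemeasurable, two_mul]
    _ ≤ 2 * (volume K * (D * (2⁻¹ * (2 ^ d * ∫⁻ x in K, G x)))) := by gcongr
    _ = 2 * 2⁻¹ * (2 ^ d * D * volume K * ∫⁻ x in K, G x) := by ring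
    _ = _ := by rw [ENNReal.mul_inv_cancel (by norm_num) (by norm_num), one_mul]

/-- The difference is bounded by the integral of the derivative along the outer half of the ray
through `x`. Integrating over `x` turns these line integrals into an integral over the outer part of
the cone. -/
theorem lintegral_sub_homothety_le_of_contDiff {a v : Pt d} (hv : v ≠ 0) {F B : Set (Pt d)}
    (hF : MeasurableSet F) (hFv : ∀ x ∈ F, ⟪x - a, v⟫ = ‖v‖ ^ 2) (hfin : μHE[d - 1] F ≠ ⊤)
    (hB : MeasurableSet B)
    (hFB : ∀ x ∈ F, ∀ r ∈ Set.Ioc (1 / 2 : ℝ) 1, AffineMap.homothety a r x ∈ B)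
    {D : ℝ≥0∞} (hD : ∀ x ∈ F, ‖x - a‖ₑ ≤ D) {φ : Pt d → Pt d} (hφ : ContDiff ℝ ∞ φ) :
    ‖v‖ₑ * ∫⁻ r in Set.Ioc (1 / 2 : ℝ) 1, ∫⁻ x in F,
      ‖φ x - φ (AffineMap.homothety a r x)‖ₑ ∂μHE[d - 1] ≤
      2 ^ (d - 1) * D * ∫⁻ x in B, ‖fderiv ℝ φ x‖ₑ := by
  have : IsFiniteMeasure (μHE[d - 1].restrict F : Measure (Pt d)) :=
    ⟨by simpa [lt_top_iff_ne_top] using hfin⟩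
  have hGc : Continuous (fun x => ‖fderiv ℝ φ x‖ₑ) := (hφ.continuous_fderiv (by simp)).enorm
  have hm : Measurable (fun z : Pt d × ℝ => ‖fderiv ℝ φ (AffineMap.homothety a z.2 z.1)‖ₑ) :=
    (hGc.comp (continuous_homothety_uncurry.comp
      (by fun_prop : Continuous fun z : Pt d × ℝ => ((a, z.2), z.1)))).measurable
  set I := ∫⁻ x in F, (∫⁻ s in Set.Ioc (1 / 2 : ℝ) 1,
    ‖fderiv ℝ φ (AffineMap.homothety a s x)‖ₑ) ∂μHE[d - 1] with hI
  have h1 : ∀ r ∈ Set.Ioc (1 / 2 : ℝ) 1, ∫⁻ x in F,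
      ‖φ x - φ (AffineMap.homothety a r x)‖ₑ ∂μHE[d - 1] ≤ D * I := by
    intro r hr
    rw [hI, ← lintegral_const_mul _ hm.lintegral_prod_right']
    refine setLIntegral_mono' hF fun x hx => ?_
    have := enorm_sub_homothety_le hφ a x hr.2
    rw [AffineMap.homothety_one, AffineMap.id_apply] at this
    refine this.trans ?_
    have hm' : Measurable (fun s : ℝ => ‖fderiv ℝ φ (AffineMap.homothety a s x)‖ₑ) :=
      (hGc.comp (continuous_homothety_uncurry.comp
        (by fun_prop : Continuous fun s : ℝ => ((a, s), x)))).measurable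
    rw [lintegral_mul_const _ hm', mul_comm]
    gcongr
    · exact hD x hx
    · exact hr.1.le
  have h2 : ∫⁻ r in Set.Ioc (1 / 2 : ℝ) 1, ∫⁻ x in F,
      ‖φ x - φ (AffineMap.homothety a r x)‖ₑ ∂μHE[d - 1] ≤ D * I := by
    calc _ ≤ ∫⁻ r in Set.Ioc (1 / 2 : ℝ) 1, D * I := setLIntegral_mono measurable_const h1
      _ ≤ D * I := by
        rw [setLIntegral_const, Real.volume_Ioc]
        refine mul_le_of_le_one_right' ?_
        rw [ENNReal.ofReal_le_one]
        norm_num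
  calc _ ≤ ‖v‖ₑ * (D * I) := by gcongr
    _ = D * (‖v‖ₑ * I) := by ring
    _ ≤ D * (2 ^ (d - 1) * ∫⁻ x in B, ‖fderiv ℝ φ x‖ₑ) := by
      rw [hI, lintegral_lintegral_swap hm.aemeasurable]
      refine mul_le_mul_right ?_ _
      exact lintegral_homothety_le hv hF hFv hfin hB hFB hGc.measurable
    _ = _ := by ring

/-! ### Passage from smooth functions to Sobolev functions and their traces -/

theorem tendsto_lintegral_enorm_of_tendsto_eLpNorm_two {α G : Type*} {m : MeasurableSpace α}
    [NormedAddCommGroup G] {μ : Measure α} [IsFiniteMeasure μ] {u : ℕ → α → G}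
    (hu : ∀ k, AEStronglyMeasurable (u k) μ)
    (h : Tendsto (fun k => eLpNorm (u k) 2 μ) atTop (𝓝 0)) :
    Tendsto (fun k => ∫⁻ x, ‖u k x‖ₑ ∂μ) atTop (𝓝 0) := by
  have hfin : μ Set.univ ^ (1 / (1 : ℝ≥0∞).toReal - 1 / (2 : ℝ≥0∞).toReal) ≠ ⊤ :=
    ENNReal.rpow_ne_top_of_nonneg (by norm_num) (measure_ne_top _ _)
  have h2 := ENNReal.Tendsto.mul_const h (Or.inr hfin)
  rw [zero_mul] at h2
  refine tendsto_of_tendsto_of_tendsto_of_le_of_le tendsto_const_nhds h2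
    (fun _ => zero_le) fun k => ?_
  rw [← eLpNorm_one_eq_lintegral_enorm]
  exact eLpNorm_le_eLpNorm_mul_rpow_measure_univ (by norm_num) (hu k)

theorem lintegral_enorm_le_add {α G : Type*} {m : MeasurableSpace α} [NormedAddCommGroup G]
    {μ : Measure α} (u : α → G) {f : α → G} (hf : StronglyMeasurable f) :
    ∫⁻ x, ‖u x‖ₑ ∂μ ≤ (∫⁻ x, ‖f x‖ₑ ∂μ) + ∫⁻ x, ‖u x - f x‖ₑ ∂μ := by
  rw [← lintegral_add_left hf.enorm]
  refine lintegral_mono fun x => ?_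
  calc ‖u x‖ₑ = ‖f x + (u x - f x)‖ₑ := by rw [add_sub_cancel]
    _ ≤ _ := enorm_add_le _ _

theorem lintegral_lintegral_sub_le_of_tendsto {K : Set (Pt d)} (hK : IsCompact K)
    (hconv : Convex ℝ K) {D : ℝ≥0∞} (hDt : D ≠ ⊤) (hD : ∀ x ∈ K, ∀ y ∈ K, ‖x - y‖ₑ ≤ D)
    {φ : ℕ → Pt d → Pt d} (hφ : ∀ k, ContDiff ℝ ∞ (φ k)) {g : Pt d → Pt d}
    {H : Pt d → Pt d →L[ℝ] Pt d} (hg : StronglyMeasurable g) (hH : StronglyMeasurable H)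
    (hφg : Tendsto (fun k => ∫⁻ x in K, ‖φ k x - g x‖ₑ) atTop (𝓝 0))
    (hφH : Tendsto (fun k => ∫⁻ x in K, ‖fderiv ℝ (φ k) x - H x‖ₑ) atTop (𝓝 0)) :
    ∫⁻ x in K, ∫⁻ y in K, ‖g x - g y‖ₑ ≤ 2 ^ d * D * volume K * ∫⁻ x in K, ‖H x‖ₑ := by
  have hKm := hK.measurableSet
  have hKt : volume K ≠ ⊤ := hK.measure_lt_top.ne
  have hφm : ∀ k, StronglyMeasurable (φ k) := fun k => (hφ k).continuous.stronglyMeasurable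
  have hφm' : ∀ k, StronglyMeasurable (fderiv ℝ (φ k)) :=
    fun k => ((hφ k).continuous_fderiv (by simp)).stronglyMeasurable
  set c := 2 ^ d * D * volume K with hc
  have hct : c ≠ ⊤ := ENNReal.mul_ne_top (ENNReal.mul_ne_top (by simp) hDt) hKt
  set ε := fun k => ∫⁻ x in K, ‖φ k x - g x‖ₑ with hε
  set δ := fun k => ∫⁻ x in K, ‖fderiv ℝ (φ k) x - H x‖ₑ with hδ
  have hm1 : ∀ k, Measurable fun x => ‖φ k x - g x‖ₑ := fun k => ((hφm k).sub hg).enorm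
  have bound : ∀ k, ∫⁻ x in K, ∫⁻ y in K, ‖g x - g y‖ₑ ≤
      ε k * volume K + (c * ((∫⁻ x in K, ‖H x‖ₑ) + δ k) + volume K * ε k) := by
    intro k
    have hm2 : Measurable fun z : Pt d × Pt d => ‖φ k z.1 - φ k z.2‖ₑ :=
      (((hφm k).comp_measurable measurable_fst).sub ((hφm k).comp_measurable measurable_snd)).enorm
    calc ∫⁻ x in K, ∫⁻ y in K, ‖g x - g y‖ₑ
        ≤ ∫⁻ x in K, ∫⁻ y in K, (‖φ k x - g x‖ₑ + (‖φ k x - φ k y‖ₑ + ‖φ k y - g y‖ₑ)) := by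
          refine lintegral_mono fun x => lintegral_mono fun y => ?_
          have : g x - g y = -(φ k x - g x) + ((φ k x - φ k y) + (φ k y - g y)) := by abel
          rw [this]
          refine (enorm_add_le _ _).trans ?_
          rw [enorm_neg]
          gcongr
          exact enorm_add_le _ _
      _ = ε k * volume K + ((∫⁻ x in K, ∫⁻ y in K, ‖φ k x - φ k y‖ₑ) + volume K * ε k) := by
          have e1 : ∀ x, ∫⁻ y in K, (‖φ k x - g x‖ₑ + (‖φ k x - φ k y‖ₑ + ‖φ k y - g y‖ₑ)) =
              ‖φ k x - g x‖ₑ * volume K + ((∫⁻ y in K, ‖φ k x - φ k y‖ₑ) + ε k) := by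
            intro x
            rw [lintegral_add_left measurable_const, lintegral_add_right _ (hm1 k),
              setLIntegral_const]
          simp_rw [e1]
          rw [lintegral_add_left ((hm1 k).mul_const _), lintegral_mul_const _ (hm1 k),
            lintegral_add_right _ measurable_const, setLIntegral_const, mul_comm (ε k) (volume K)]
      _ ≤ _ := by
          gcongr
          refine (lintegral_lintegral_sub_le_of_contDiff hKm hconv hD (hφ k)).trans ?_
          exact mul_le_mul_right (lintegral_enorm_le_add _ hH) _
  have hlim : Tendsto (fun k => ε k * volume K +
      (c * ((∫⁻ x in K, ‖H x‖ₑ) + δ k) + volume K * ε k)) atTop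
      (𝓝 (0 * volume K + (c * ((∫⁻ x in K, ‖H x‖ₑ) + 0) + volume K * 0))) := by
    refine (ENNReal.Tendsto.mul_const hφg (Or.inr hKt)).add
      ((ENNReal.Tendsto.const_mul (tendsto_const_nhds.add hφH) (Or.inr hct)).add
        (ENNReal.Tendsto.const_mul hφg (Or.inr hKt)))
  rw [zero_mul, mul_zero, zero_add, add_zero, add_zero] at hlim
  exact ge_of_tendsto' hlim bound

/-- This is where the trace enters: `φ k` tends to `t` on the face and to `g` in the body. The error
of `φ k` against `g` on the homothetic copies of `F` is again an integral over the outer cone, hence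
bounded by the L¹ error on `B`. -/
theorem lintegral_sub_homothety_le_of_tendsto {a v : Pt d} (hv : v ≠ 0) {F B : Set (Pt d)}
    (hF : MeasurableSet F) (hFv : ∀ x ∈ F, ⟪x - a, v⟫ = ‖v‖ ^ 2) (hfin : μHE[d - 1] F ≠ ⊤)
    (hB : MeasurableSet B)
    (hFB : ∀ x ∈ F, ∀ r ∈ Set.Ioc (1 / 2 : ℝ) 1, AffineMap.homothety a r x ∈ B)
    {D : ℝ≥0∞} (hDt : D ≠ ⊤) (hD : ∀ x ∈ F, ‖x - a‖ₑ ≤ D)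
    {φ : ℕ → Pt d → Pt d} (hφ : ∀ k, ContDiff ℝ ∞ (φ k)) {g t : Pt d → Pt d}
    {H : Pt d → Pt d →L[ℝ] Pt d} (hg : StronglyMeasurable g) (hH : StronglyMeasurable H)
    (ht : StronglyMeasurable t)
    (hφg : Tendsto (fun k => ∫⁻ x in B, ‖φ k x - g x‖ₑ) atTop (𝓝 0))
    (hφH : Tendsto (fun k => ∫⁻ x in B, ‖fderiv ℝ (φ k) x - H x‖ₑ) atTop (𝓝 0))
    (hφt : Tendsto (fun k => ∫⁻ x in F, ‖φ k x - t x‖ₑ ∂μHE[d - 1]) atTop (𝓝 0)) :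
    ‖v‖ₑ * ∫⁻ r in Set.Ioc (1 / 2 : ℝ) 1, ∫⁻ x in F,
      ‖t x - g (AffineMap.homothety a r x)‖ₑ ∂μHE[d - 1] ≤
      2 ^ (d - 1) * D * ∫⁻ x in B, ‖H x‖ₑ := by
  have : IsFiniteMeasure (μHE[d - 1].restrict F : Measure (Pt d)) :=
    ⟨by simpa [lt_top_iff_ne_top] using hfin⟩
  have hφm : ∀ k, StronglyMeasurable (φ k) := fun k => (hφ k).continuous.stronglyMeasurable
  have hφm' : ∀ k, StronglyMeasurable (fderiv ℝ (φ k)) :=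
    fun k => ((hφ k).continuous_fderiv (by simp)).stronglyMeasurable
  have hcm : Measurable (fun z : ℝ × Pt d => AffineMap.homothety a z.1 z.2) :=
    (continuous_homothety_uncurry.comp
      (by fun_prop : Continuous fun z : ℝ × Pt d => ((a, z.1), z.2))).measurable
  set c := 2 ^ (d - 1) * D with hc
  have hct : c ≠ ⊤ := ENNReal.mul_ne_top (by simp) hDt
  set ε := fun k => ∫⁻ x in B, ‖φ k x - g x‖ₑ with hε
  set δ := fun k => ∫⁻ x in B, ‖fderiv ℝ (φ k) x - H x‖ₑ with hδ
  set η := fun k => ∫⁻ x in F, ‖φ k x - t x‖ₑ ∂μHE[d - 1] with hη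
  have bound : ∀ k, ‖v‖ₑ * ∫⁻ r in Set.Ioc (1 / 2 : ℝ) 1, ∫⁻ x in F,
      ‖t x - g (AffineMap.homothety a r x)‖ₑ ∂μHE[d - 1] ≤
      ‖v‖ₑ * η k + (c * ((∫⁻ x in B, ‖H x‖ₑ) + δ k) + 2 ^ (d - 1) * ε k) := by
    intro k
    have hm1 : Measurable fun x => ‖φ k x - t x‖ₑ := ((hφm k).sub ht).enorm
    have hm2 : Measurable fun z : ℝ × Pt d => ‖φ k z.2 - φ k (AffineMap.homothety a z.1 z.2)‖ₑ :=
      (((hφm k).comp_measurable measurable_snd).sub ((hφm k).comp_measurable hcm)).enorm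
    have hm3 : Measurable fun x => ‖φ k x - g x‖ₑ := ((hφm k).sub hg).enorm
    have hm4 : Measurable fun z : ℝ × Pt d =>
      ‖φ k (AffineMap.homothety a z.1 z.2) - g (AffineMap.homothety a z.1 z.2)‖ₑ := hm3.comp hcm
    set P : ℝ → ℝ≥0∞ := fun r =>
      ∫⁻ x in F, ‖φ k x - φ k (AffineMap.homothety a r x)‖ₑ ∂μHE[d - 1] with hP
    set Q : ℝ → ℝ≥0∞ := fun r => ∫⁻ x in F, ‖φ k (AffineMap.homothety a r x) -
      g (AffineMap.homothety a r x)‖ₑ ∂μHE[d - 1] with hQ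
    have hPm : Measurable P := hm2.lintegral_prod_right'
    have hpt : ∀ r : ℝ, ∫⁻ x in F, ‖t x - g (AffineMap.homothety a r x)‖ₑ ∂μHE[d - 1] ≤
        η k + (P r + Q r) := by
      intro r
      have hm2' : Measurable fun x : Pt d =>
        ‖φ k x - φ k (AffineMap.homothety a r x)‖ₑ :=
        ((hφm k).sub ((hφm k).comp_measurable (hcm.comp (measurable_prodMk_left (x := r))))).enorm
      rw [← lintegral_add_left hm2', ← lintegral_add_left hm1]
      refine lintegral_mono fun x => ?_
      calc ‖t x - g (AffineMap.homothety a r x)‖ₑ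
          = ‖-(φ k x - t x) + ((φ k x - φ k (AffineMap.homothety a r x)) +
            (φ k (AffineMap.homothety a r x) - g (AffineMap.homothety a r x)))‖ₑ := by
            congr 1
            abel
        _ ≤ _ := by
            refine (enorm_add_le _ _).trans ?_
            rw [enorm_neg]
            gcongr
            exact enorm_add_le _ _
    have hle : ∫⁻ r in Set.Ioc (1 / 2 : ℝ) 1, ∫⁻ x in F,
        ‖t x - g (AffineMap.homothety a r x)‖ₑ ∂μHE[d - 1] ≤
        η k + ((∫⁻ r in Set.Ioc (1 / 2 : ℝ) 1, P r) + ∫⁻ r in Set.Ioc (1 / 2 : ℝ) 1, Q r) := by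
      refine (lintegral_mono hpt).trans ?_
      rw [lintegral_add_left measurable_const, lintegral_add_left hPm]
      gcongr
      rw [setLIntegral_const, Real.volume_Ioc]
      refine mul_le_of_le_one_right' ?_
      rw [ENNReal.ofReal_le_one]
      norm_num
    refine (mul_le_mul_right hle _).trans ?_
    rw [mul_add, mul_add]
    refine add_le_add le_rfl (add_le_add ?_ ?_)
    · refine (lintegral_sub_homothety_le_of_contDiff hv hF hFv hfin hB hFB hD (hφ k)).trans ?_
      exact mul_le_mul_right (lintegral_enorm_le_add _ hH) _
    · exact lintegral_homothety_le hv hF hFv hfin hB hFB hm3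
  have hlim : Tendsto (fun k => ‖v‖ₑ * η k +
      (c * ((∫⁻ x in B, ‖H x‖ₑ) + δ k) + 2 ^ (d - 1) * ε k)) atTop
      (𝓝 (‖v‖ₑ * 0 + (c * ((∫⁻ x in B, ‖H x‖ₑ) + 0) + 2 ^ (d - 1) * 0))) := by
    refine (ENNReal.Tendsto.const_mul hφt (Or.inr (by simp))).add
      ((ENNReal.Tendsto.const_mul (tendsto_const_nhds.add hφH) (Or.inr hct)).add
        (ENNReal.Tendsto.const_mul hφg (Or.inr (by simp))))
  rw [mul_zero, mul_zero, zero_add, add_zero, add_zero] at hlim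
  exact ge_of_tendsto' hlim bound

theorem homothety_mem_interior {B : Set (Pt d)} (hB : Convex ℝ B) {a x : Pt d}
    (ha : a ∈ interior B) (hx : x ∈ B) {r : ℝ} (hr : 0 ≤ r) (hr1 : r < 1) :
    AffineMap.homothety a r x ∈ interior B := by
  have := hB.combo_interior_self_mem_interior ha hx (sub_pos.2 hr1) hr (by ring)
  convert this using 1
  simp only [AffineMap.homothety_apply, vsub_eq_sub, vadd_eq_add]
  module

theorem homothety_mem {B : Set (Pt d)} (hB : Convex ℝ B) {a x : Pt d}
    (ha : a ∈ B) (hx : x ∈ B) {r : ℝ} (hr : 0 ≤ r) (hr1 : r ≤ 1) :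
    AffineMap.homothety a r x ∈ B := by
  have := hB ha hx (sub_nonneg.2 hr1) hr (by ring)
  convert this using 1
  simp only [AffineMap.homothety_apply, vsub_eq_sub, vadd_eq_add]
  module

/-- Convergence is available only on compact subsets of `Ω`, while `B` may touch the boundary.
Homothetic copies of `B` about the interior point `a` with ratios below 1 are compact, convex, and
exhaust the interior of `B`, so monotone convergence extends the inequality to `B`; the frontier of
a convex set is null. -/
theorem lintegral_lintegral_sub_le {Ω B : Set (Pt d)} (hB : Convex ℝ B) (hBc : IsCompact B)
    (hBΩ : interior B ⊆ Ω) {a : Pt d} (ha : a ∈ interior B)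
    {D : ℝ≥0∞} (hDt : D ≠ ⊤) (hD : ∀ x ∈ B, ∀ y ∈ B, ‖x - y‖ₑ ≤ D)
    {φ : ℕ → Pt d → Pt d} (hφ : ∀ k, ContDiff ℝ ∞ (φ k)) {g : Pt d → Pt d}
    {H : Pt d → Pt d →L[ℝ] Pt d} (hg : StronglyMeasurable g) (hH : StronglyMeasurable H)
    (hφg : ∀ K, IsCompact K → K ⊆ Ω →
      Tendsto (fun k => ∫⁻ x in K, ‖φ k x - g x‖ₑ) atTop (𝓝 0))
    (hφH : ∀ K, IsCompact K → K ⊆ Ω →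
      Tendsto (fun k => ∫⁻ x in K, ‖fderiv ℝ (φ k) x - H x‖ₑ) atTop (𝓝 0)) :
    ∫⁻ x in B, ∫⁻ y in B, ‖g x - g y‖ₑ ≤ 2 ^ d * D * volume B * ∫⁻ x in B, ‖H x‖ₑ := by
  -- The shift by 2 keeps the ratio positive at `n = 0`.
  set l : ℕ → ℝ := fun n => 1 - 1 / ((n : ℝ) + 2) with hl
  have hl0 : ∀ n, 0 < l n := by
    intro n
    have : 1 / ((n : ℝ) + 2) < 1 := by
      rw [div_lt_one (by positivity)]
      linarith [n.cast_nonneg (α := ℝ)]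
    simpa [hl] using this
  have hl1 : ∀ n, l n < 1 := by
    intro n
    have : 0 < 1 / ((n : ℝ) + 2) := by positivity
    simpa [hl] using this
  have hlmono : Monotone l := by
    intro n m hnm
    have h1 : (n : ℝ) ≤ m := by exact_mod_cast hnm
    have : 1 / ((m : ℝ) + 2) ≤ 1 / ((n : ℝ) + 2) :=
      one_div_le_one_div_of_le (by positivity) (by linarith)
    simp only [hl]
    linarith
  have hllim : Tendsto l atTop (𝓝 1) := by
    have : Tendsto (fun n : ℕ => 1 / ((n : ℝ) + 2)) atTop (𝓝 0) := by
      have h1 := tendsto_one_div_add_atTop_nhds_zero_nat (𝕜 := ℝ)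
      have h2 := h1.comp (tendsto_add_atTop_nat 1)
      refine h2.congr fun n => ?_
      simp only [Function.comp_apply, Nat.cast_add, Nat.cast_one]
      ring
    simpa [hl] using tendsto_const_nhds.sub this
  set K : ℕ → Set (Pt d) := fun n => AffineMap.homothety a (l n) '' B with hK
  have haB := interior_subset ha
  have hKint : ∀ n, K n ⊆ interior B := by
    rintro n _ ⟨x, hx, rfl⟩
    exact homothety_mem_interior hB ha hx (hl0 n).le (hl1 n)
  have hKc : ∀ n, IsCompact (K n) := fun n => hBc.image (AffineMap.homothety_continuous a (l n))
  have hKconv : ∀ n, Convex ℝ (K n) := fun n => hB.affine_image _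
  have hKmono : Monotone K := by
    rintro n m hnm _ ⟨x, hx, rfl⟩
    refine ⟨AffineMap.homothety a (l n / l m) x, homothety_mem hB haB hx
      (div_nonneg (hl0 n).le (hl0 m).le) ((div_le_one (hl0 m)).2 (hlmono hnm)), ?_⟩
    simp [AffineMap.homothety_apply, smul_smul, mul_div_cancel₀ _ (hl0 m).ne']
  have hKev : ∀ x ∈ interior B, ∀ᶠ n in atTop, x ∈ K n := by
    intro x hx
    have h1 : Tendsto (fun n => a + (l n)⁻¹ • (x - a)) atTop (𝓝 (a + (1 : ℝ)⁻¹ • (x - a))) :=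
      tendsto_const_nhds.add ((hllim.inv₀ one_ne_zero).smul_const _)
    have h2 : a + (1 : ℝ)⁻¹ • (x - a) = x := by simp
    rw [h2] at h1
    filter_upwards [h1.eventually_mem (mem_interior_iff_mem_nhds.1 hx)] with n hn
    exact ⟨_, hn, by simp [AffineMap.homothety_apply, smul_smul, mul_inv_cancel₀ (hl0 n).ne']⟩
  have hf : Measurable fun z : Pt d × Pt d => ‖g z.1 - g z.2‖ₑ :=
    ((hg.comp_measurable measurable_fst).sub (hg.comp_measurable measurable_snd)).enorm
  have hprod : ∀ A : Set (Pt d), ∫⁻ x in A, ∫⁻ y in A, ‖g x - g y‖ₑ =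
      ∫⁻ z in A ×ˢ A, ‖g z.1 - g z.2‖ₑ ∂((volume : Measure (Pt d)).prod volume) := by
    intro A
    rw [← Measure.prod_restrict, lintegral_prod _ hf.aemeasurable]
  have hae : (interior B : Set (Pt d)) =ᵐ[volume] B :=
    interior_ae_eq_of_null_frontier (hB.addHaar_frontier volume)
  have hBint : ∫⁻ x in B, ∫⁻ y in B, ‖g x - g y‖ₑ =
      ∫⁻ x in interior B, ∫⁻ y in interior B, ‖g x - g y‖ₑ := by
    rw [Measure.restrict_congr_set hae]
  rw [hBint, hprod]
  have hsub : interior B ×ˢ interior B ⊆ ⋃ n, K n ×ˢ K n := by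
    rintro ⟨x, y⟩ ⟨hx, hy⟩
    obtain ⟨n, hn⟩ := ((hKev x hx).and (hKev y hy)).exists
    exact Set.mem_iUnion.2 ⟨n, hn⟩
  refine (lintegral_mono_set hsub).trans ?_
  rw [setLIntegral_iUnion_of_directed _
    (Monotone.directed_le fun n m h => Set.prod_mono (hKmono h) (hKmono h))]
  refine iSup_le fun n => ?_
  have hKB : K n ⊆ B := (hKint n).trans interior_subset
  have hKΩ : K n ⊆ Ω := (hKint n).trans hBΩ
  rw [← hprod]
  refine (lintegral_lintegral_sub_le_of_tendsto (hKc n) (hKconv n) hDt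
    (fun x hx y hy => hD x (hKB hx) y (hKB hy)) hφ hg hH (hφg _ (hKc n) hKΩ)
    (hφH _ (hKc n) hKΩ)).trans ?_
  gcongr

/-- The face may also reach the boundary of `Ω`. It is exhausted, up to a null set, by its
intersections with closed sets `C n` that increase to `Ω`. -/
theorem lintegral_sub_homothety_le {Ω B F : Set (Pt d)} (hΩ : IsOpen Ω) (hB : Convex ℝ B)
    (hBΩ : interior B ⊆ Ω) {a v : Pt d} (ha : a ∈ interior B)
    (hv : v ≠ 0) (hF : IsCompact F) (hFB : F ⊆ B)
    (hFv : ∀ x ∈ F, ⟪x - a, v⟫ = ‖v‖ ^ 2) (hfin : μHE[d - 1] F ≠ ⊤)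
    (hFΩ : μHE[d - 1] (F \ Ω) = 0)
    {D : ℝ≥0∞} (hDt : D ≠ ⊤) (hD : ∀ x ∈ B, ∀ y ∈ B, ‖x - y‖ₑ ≤ D)
    {φ : ℕ → Pt d → Pt d} (hφ : ∀ k, ContDiff ℝ ∞ (φ k)) {g t : Pt d → Pt d}
    {H : Pt d → Pt d →L[ℝ] Pt d} (hg : StronglyMeasurable g) (hH : StronglyMeasurable H)
    (ht : StronglyMeasurable t)
    (hφg : ∀ K, IsCompact K → K ⊆ Ω →
      Tendsto (fun k => ∫⁻ x in K, ‖φ k x - g x‖ₑ) atTop (𝓝 0))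
    (hφH : ∀ K, IsCompact K → K ⊆ Ω →
      Tendsto (fun k => ∫⁻ x in K, ‖fderiv ℝ (φ k) x - H x‖ₑ) atTop (𝓝 0))
    (hφt : ∀ K, IsCompact K → K ⊆ Ω →
      Tendsto (fun k => ∫⁻ x in F ∩ K, ‖φ k x - t x‖ₑ ∂μHE[d - 1]) atTop (𝓝 0)) :
    ‖v‖ₑ * ∫⁻ r in Set.Ioc (1 / 2 : ℝ) 1, ∫⁻ x in F,
      ‖t x - g (AffineMap.homothety a r x)‖ₑ ∂μHE[d - 1] ≤
      2 ^ (d - 1) * D * ∫⁻ x in B, ‖H x‖ₑ := by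
  have haB := interior_subset ha
  obtain ⟨C, hCc, hCΩ, hCU, hCm⟩ := hΩ.exists_iUnion_isClosed
  have : IsFiniteMeasure (μHE[d - 1].restrict F : Measure (Pt d)) :=
    ⟨by simpa [lt_top_iff_ne_top] using hfin⟩
  have hcm : Measurable (fun z : Pt d × ℝ => AffineMap.homothety a z.2 z.1) :=
    (continuous_homothety_uncurry.comp
      (by fun_prop : Continuous fun z : Pt d × ℝ => ((a, z.2), z.1))).measurable
  have hm : Measurable (fun z : Pt d × ℝ => ‖t z.1 - g (AffineMap.homothety a z.2 z.1)‖ₑ) :=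
    ((ht.comp_measurable measurable_fst).sub (hg.comp_measurable hcm)).enorm
  set W : Pt d → ℝ≥0∞ := fun x =>
    ∫⁻ r in Set.Ioc (1 / 2 : ℝ) 1, ‖t x - g (AffineMap.homothety a r x)‖ₑ with hW
  have hswap : ∀ A : Set (Pt d), A ⊆ F → ∫⁻ r in Set.Ioc (1 / 2 : ℝ) 1, ∫⁻ x in A,
      ‖t x - g (AffineMap.homothety a r x)‖ₑ ∂μHE[d - 1] = ∫⁻ x in A, W x ∂μHE[d - 1] := by
    intro A hA
    have : IsFiniteMeasure (μHE[d - 1].restrict A : Measure (Pt d)) :=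
      ⟨by simpa [lt_top_iff_ne_top] using ne_top_of_le_ne_top hfin (measure_mono hA)⟩
    exact (lintegral_lintegral_swap hm.aemeasurable).symm
  have hFint : ∫⁻ x in F, W x ∂μHE[d - 1] = ⨆ n, ∫⁻ x in F ∩ C n, W x ∂μHE[d - 1] := by
    rw [← setLIntegral_iUnion_of_directed _
      (Monotone.directed_le fun n m h => Set.inter_subset_inter_right _ (hCm h)),
      ← Set.inter_iUnion, hCU]
    have : (F : Set (Pt d)) =ᵐ[μHE[d - 1]] (F ∩ Ω : Set (Pt d)) := by
      refine (ae_eq_set).2 ⟨by rwa [show F \ (F ∩ Ω) = F \ Ω by ext; simp], ?_⟩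
      rw [Set.sdiff_eq_empty.2 Set.inter_subset_left, measure_empty]
    rw [Measure.restrict_congr_set this]
  rw [hswap F subset_rfl, hFint, ENNReal.mul_iSup]
  refine iSup_le fun n => ?_
  have hFn : IsCompact (F ∩ C n) := hF.inter_right (hCc n)
  -- The outer halves of the rays to `F ∩ C n`. They form a compact subset of `Ω`: for ratios below
  -- 1 the points are interior to `B`, and for ratio 1 they lie in `C n`.
  set K : Set (Pt d) := (fun z : ℝ × Pt d => AffineMap.homothety a z.1 z.2) ''
    (Set.Icc (1 / 2 : ℝ) 1 ×ˢ (F ∩ C n)) with hK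
  have hKc : IsCompact K := (isCompact_Icc.prod hFn).image
    (continuous_homothety_uncurry.comp
      (by fun_prop : Continuous fun z : ℝ × Pt d => ((a, z.1), z.2)))
  have hKB : K ⊆ B := by
    rintro _ ⟨⟨r, x⟩, ⟨hr, hx⟩, rfl⟩
    exact homothety_mem hB haB (hFB hx.1) (by linarith [hr.1]) hr.2
  have hKΩ : K ⊆ Ω := by
    rintro _ ⟨⟨r, x⟩, ⟨hr, hx⟩, rfl⟩
    rcases hr.2.lt_or_eq with h1 | h1
    · exact hBΩ (homothety_mem_interior hB ha (hFB hx.1) (by linarith [hr.1]) h1)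
    · simp only at h1
      simp only [h1, AffineMap.homothety_one, AffineMap.id_apply]
      exact hCΩ n hx.2
  rw [← hswap _ Set.inter_subset_left]
  refine (lintegral_sub_homothety_le_of_tendsto hv hFn.measurableSet (fun x hx => hFv x hx.1)
    (ne_top_of_le_ne_top hfin (measure_mono Set.inter_subset_left)) hKc.measurableSet
    (fun x hx r hr => ⟨(r, x), ⟨⟨hr.1.le, hr.2⟩, hx⟩, rfl⟩) hDt
    (fun x hx => hD x (hFB hx.1) a haB) hφ hg hH ht (hφg _ hKc hKΩ) (hφH _ hKc hKΩ) ?_).trans ?_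
  · have := hφt (F ∩ C n) hFn (Set.inter_subset_right.trans (hCΩ n))
    rwa [← Set.inter_assoc, Set.inter_self] at this
  · gcongr

/-- The oscillation between the trace on a flat piece `F` of the boundary of a convex body `B` and
the function in `B`. -/
theorem lintegral_trace_sub_le {Ω B F : Set (Pt d)} (hΩ : IsOpen Ω) (hB : Convex ℝ B)
    (hBc : IsCompact B) (hBΩ : interior B ⊆ Ω) {a v : Pt d} (ha : a ∈ interior B)
    (hv : v ≠ 0) (hF : IsCompact F) (hFB : F ⊆ B)
    (hFv : ∀ x ∈ F, ⟪x - a, v⟫ = ‖v‖ ^ 2) (hfin : μHE[d - 1] F ≠ ⊤)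
    (hFΩ : μHE[d - 1] (F \ Ω) = 0)
    {D : ℝ≥0∞} (hDt : D ≠ ⊤) (hD : ∀ x ∈ B, ∀ y ∈ B, ‖x - y‖ₑ ≤ D)
    {φ : ℕ → Pt d → Pt d} (hφ : ∀ k, ContDiff ℝ ∞ (φ k)) {g t : Pt d → Pt d}
    {H : Pt d → Pt d →L[ℝ] Pt d} (hg : StronglyMeasurable g) (hH : StronglyMeasurable H)
    (ht : StronglyMeasurable t)
    (hφg : ∀ K, IsCompact K → K ⊆ Ω →
      Tendsto (fun k => ∫⁻ x in K, ‖φ k x - g x‖ₑ) atTop (𝓝 0))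
    (hφH : ∀ K, IsCompact K → K ⊆ Ω →
      Tendsto (fun k => ∫⁻ x in K, ‖fderiv ℝ (φ k) x - H x‖ₑ) atTop (𝓝 0))
    (hφt : ∀ K, IsCompact K → K ⊆ Ω →
      Tendsto (fun k => ∫⁻ x in F ∩ K, ‖φ k x - t x‖ₑ ∂μHE[d - 1]) atTop (𝓝 0)) :
    ‖v‖ₑ * ∫⁻ x in F, ∫⁻ y in B, ‖t x - g y‖ₑ ∂volume ∂μHE[d - 1] ≤
      2 * (2 ^ (d - 1) + 2 ^ (d - 1) * 2 ^ d) * D * volume B * ∫⁻ x in B, ‖H x‖ₑ := by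
  have haB := interior_subset ha
  have : IsFiniteMeasure (μHE[d - 1].restrict F : Measure (Pt d)) :=
    ⟨by simpa [lt_top_iff_ne_top] using hfin⟩
  have h1 := lintegral_sub_homothety_le hΩ hB hBΩ ha hv hF hFB hFv hfin hFΩ hDt hD hφ hg hH ht
    hφg hφH hφt
  have h2 := lintegral_lintegral_sub_le hB hBc hBΩ ha hDt hD hφ hg hH hφg hφH
  have hf : Measurable fun z : Pt d × Pt d => ‖g z.1 - g z.2‖ₑ :=
    ((hg.comp_measurable measurable_fst).sub (hg.comp_measurable measurable_snd)).enorm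
  set G : Pt d → ℝ≥0∞ := fun x => ∫⁻ y in B, ‖g x - g y‖ₑ with hG
  have hGm : Measurable G := hf.lintegral_prod_right'
  have h3 := lintegral_homothety_le hv hF.measurableSet hFv hfin hBc.measurableSet
    (fun x hx r hr => homothety_mem hB haB (hFB hx) (by linarith [hr.1]) hr.2) hGm
  have hcm : Measurable (fun z : ℝ × Pt d => AffineMap.homothety a z.1 z.2) :=
    (continuous_homothety_uncurry.comp
      (by fun_prop : Continuous fun z : ℝ × Pt d => ((a, z.1), z.2))).measurable
  set T := ∫⁻ x in F, ∫⁻ y in B, ‖t x - g y‖ₑ ∂volume ∂μHE[d - 1] with hT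
  set P : ℝ → ℝ≥0∞ := fun r => ∫⁻ x in F,
      ‖t x - g (AffineMap.homothety a r x)‖ₑ ∂μHE[d - 1] with hP
  set Q : ℝ → ℝ≥0∞ := fun r => ∫⁻ x in F, G (AffineMap.homothety a r x) ∂μHE[d - 1] with hQ
  have hPm : Measurable P := by
    have : Measurable fun z : ℝ × Pt d => ‖t z.2 - g (AffineMap.homothety a z.1 z.2)‖ₑ :=
      ((ht.comp_measurable measurable_snd).sub (hg.comp_measurable hcm)).enorm
    exact this.lintegral_prod_right'
  -- Triangle inequality through the point at ratio `r` on the ray. It holds for every `r` and is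
  -- averaged over an interval of length 1/2, whence the leading factor 2 of the constant.
  have hpt : ∀ r : ℝ, T ≤ P r * volume B + Q r := by
    intro r
    have hm : Measurable fun x : Pt d => ‖t x - g (AffineMap.homothety a r x)‖ₑ :=
      (ht.sub (hg.comp_measurable (AffineMap.homothety_continuous a r).measurable)).enorm
    rw [hP, hQ, ← lintegral_mul_const _ hm, ← lintegral_add_left (hm.mul_const _)]
    refine lintegral_mono fun x => ?_
    rw [← setLIntegral_const, hG, ← lintegral_add_left measurable_const]
    refine lintegral_mono fun y => ?_
    calc ‖t x - g y‖ₑ = ‖(t x - g (AffineMap.homothety a r x)) +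
          (g (AffineMap.homothety a r x) - g y)‖ₑ := by congr 1; abel
      _ ≤ _ := enorm_add_le _ _
  have havg : T * 2⁻¹ ≤ (∫⁻ r in Set.Ioc (1 / 2 : ℝ) 1, P r) * volume B +
      ∫⁻ r in Set.Ioc (1 / 2 : ℝ) 1, Q r := by
    have hvol : volume (Set.Ioc (1 / 2 : ℝ) 1) = 2⁻¹ := by
      rw [Real.volume_Ioc, show (1 : ℝ) - 1 / 2 = 2⁻¹ by norm_num,
        ENNReal.ofReal_inv_of_pos (by norm_num)]
      simp
    rw [← hvol, ← setLIntegral_const, ← lintegral_mul_const _ hPm,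
      ← lintegral_add_left (hPm.mul_const _)]
    exact lintegral_mono hpt
  calc ‖v‖ₑ * T = 2 * (‖v‖ₑ * (T * 2⁻¹)) := by
        rw [mul_left_comm, mul_left_comm 2 T, ENNReal.mul_inv_cancel (by norm_num) (by norm_num),
          mul_one]
    _ ≤ 2 * (‖v‖ₑ * ((∫⁻ r in Set.Ioc (1 / 2 : ℝ) 1, P r) * volume B +
      ∫⁻ r in Set.Ioc (1 / 2 : ℝ) 1, Q r)) := by gcongr
    _ = 2 * ((‖v‖ₑ * ∫⁻ r in Set.Ioc (1 / 2 : ℝ) 1, P r) * volume B +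
      ‖v‖ₑ * ∫⁻ r in Set.Ioc (1 / 2 : ℝ) 1, Q r) := by ring
    _ ≤ 2 * ((2 ^ (d - 1) * D * ∫⁻ x in B, ‖H x‖ₑ) * volume B +
      2 ^ (d - 1) * (2 ^ d * D * volume B * ∫⁻ x in B, ‖H x‖ₑ)) := by
        refine mul_le_mul_right (add_le_add (mul_le_mul_left h1 _) (h3.trans ?_)) _
        exact mul_le_mul_right h2 _
    _ = _ := by ring

end

theorem volume_hyperplane {d : ℕ} {w : Pt d} (hw : w ≠ 0) (a : Pt d) :
    volume {y : Pt d | ⟪y - a, w⟫ = 0} = 0 := by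
  have h : {y : Pt d | ⟪y - a, w⟫ = 0} = (AffineSubspace.mk' a (ℝ ∙ w)ᗮ : Set (Pt d)) := by
    ext y
    rw [Set.mem_ofPred_eq, SetLike.mem_coe, AffineSubspace.mem_mk',
      Submodule.mem_orthogonal_singleton_iff_inner_left, vsub_eq_sub]
  rw [h]
  refine Measure.addHaar_affineSubspace _ _ fun htop => hw ?_
  have h1 : a + w ∈ AffineSubspace.mk' a (ℝ ∙ w)ᗮ := htop ▸ AffineSubspace.mem_top ℝ _ _
  rw [AffineSubspace.mem_mk', Submodule.mem_orthogonal_singleton_iff_inner_left] at h1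
  simpa using h1

namespace Triangulation

variable {d : ℕ} {Ω : Set (Pt d)} (M : Triangulation d Ω)

/-! ### Elements -/

theorem convex_simplex (T : Finset (Fin M.N)) : Convex ℝ (M.simplex T) := convex_convexHull _ _

theorem isCompact_simplex (T : Finset (Fin M.N)) : IsCompact (M.simplex T) :=
  Set.Finite.isCompact_convexHull ℝ (T.finite_toSet.image M.vert)

variable {M}

theorem vert_mem_simplex {T : Finset (Fin M.N)} {k : Fin M.N} (hk : k ∈ T) :
    M.vert k ∈ M.simplex T :=
  subset_convexHull _ _ ⟨k, hk, rfl⟩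

theorem dist_le_diam {T : Finset (Fin M.N)} {x y : Pt d} (hx : x ∈ M.simplex T)
    (hy : y ∈ M.simplex T) : dist x y ≤ M.diam T :=
  Metric.dist_le_diam_of_mem (M.isCompact_simplex T).isBounded hx hy

theorem diam_le_meshSize {T : Finset (Fin M.N)} (hT : T ∈ M.elems) : M.diam T ≤ M.meshSize :=
  le_ciSup (f := fun T : M.elems => M.diam T.1) (Set.finite_range _).bddAbove ⟨T, hT⟩

theorem diam_pos (hd : 1 ≤ d) {T : Finset (Fin M.N)} (hT : T ∈ M.elems) : 0 < M.diam T := by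
  have hc := M.card_elem T hT
  obtain ⟨i, hi, j, hj, hij⟩ := Finset.one_lt_card.1 (by omega : 1 < T.card)
  exact (dist_pos.2 (M.vert_injective.ne hij)).trans_le
    (dist_le_diam (vert_mem_simplex hi) (vert_mem_simplex hj))

theorem simplex_subset {T : Finset (Fin M.N)} (hT : T ∈ M.elems) :
    M.simplex T ⊆ closure Ω := by
  rw [← M.cover]
  exact Set.subset_biUnion_of_mem (u := fun T : Finset (Fin M.N) =>
    convexHull ℝ (M.vert '' T)) hT

theorem exists_mem_simplex {x : Pt d} (hx : x ∈ closure Ω) : ∃ T ∈ M.elems, x ∈ M.simplex T := by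
  rw [← M.cover] at hx
  simpa [simplex] using hx

theorem nonempty_of_mem_elems {T : Finset (Fin M.N)} (hT : T ∈ M.elems) : T.Nonempty := by
  rw [← Finset.card_pos, M.card_elem T hT]
  omega

theorem isCompact_closure (M : Triangulation d Ω) : IsCompact (closure Ω) := by
  rw [← M.cover]
  exact M.elems.isCompact_biUnion fun T _ => M.isCompact_simplex T

/-! ### Cells and faces -/

theorem dist_le_dist_iff (x p q : Pt d) :
    dist x p ≤ dist x q ↔ ⟪x - p, q - p⟫ ≤ ‖q - p‖ ^ 2 / 2 := by
  rw [dist_eq_norm, dist_eq_norm, ← sq_le_sq₀ (norm_nonneg _) (norm_nonneg _),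
    show x - q = (x - p) - (q - p) by abel, norm_sub_sq_real (x - p) (q - p)]
  constructor <;> intro h <;> linarith

theorem mem_cell_iff {i : Fin M.N} {x : Pt d} : x ∈ M.cell i ↔
    ∀ k, ⟪x - M.vert i, M.vert k - M.vert i⟫ ≤ ‖M.vert k - M.vert i‖ ^ 2 / 2 :=
  forall_congr' fun _ => dist_le_dist_iff _ _ _

theorem isClosed_cell (i : Fin M.N) : IsClosed (M.cell i) := by
  simp only [cell, Set.ofPred_forall]
  exact isClosed_iInter fun k => isClosed_le (by fun_prop) (by fun_prop)

theorem convex_cell (i : Fin M.N) : Convex ℝ (M.cell i) := by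
  intro x hx y hy a b ha hb hab
  rw [mem_cell_iff] at *
  intro k
  have h : a • x + b • y - M.vert i = a • (x - M.vert i) + b • (y - M.vert i) := by
    have : M.vert i = (a + b) • M.vert i := by rw [hab, one_smul]
    conv_lhs => rw [this]
    module
  rw [h, inner_add_left, real_inner_smul_left, real_inner_smul_left]
  calc _ ≤ a * (‖M.vert k - M.vert i‖ ^ 2 / 2) + b * (‖M.vert k - M.vert i‖ ^ 2 / 2) :=
        add_le_add (mul_le_mul_of_nonneg_left (hx k) ha) (mul_le_mul_of_nonneg_left (hy k) hb)
    _ = _ := by rw [← add_mul, hab, one_mul]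

theorem vert_sub_ne_zero {i j : Fin M.N} (hij : j ≠ i) : M.vert j - M.vert i ≠ 0 :=
  sub_ne_zero.2 (M.vert_injective.ne hij)

theorem dij_pos {i j : Fin M.N} (hij : j ≠ i) : 0 < M.dij i j :=
  dist_pos.2 (M.vert_injective.ne hij.symm)

theorem dij_eq_norm (i j : Fin M.N) : M.dij i j = ‖M.vert j - M.vert i‖ := by
  rw [dij, dist_comm, dist_eq_norm]

theorem dij_comm (i j : Fin M.N) : M.dij i j = M.dij j i := dist_comm _ _

theorem face_comm (i j : Fin M.N) : M.face i j = M.face j i := Set.inter_comm _ _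

theorem faceArea_comm (i j : Fin M.N) : M.faceArea i j = M.faceArea j i := by
  rw [faceArea, face_comm, faceArea]

/-- The (scaled) distance of `a` from the bisecting hyperplane of `p_i` and `p_j`. -/
def gap (M : Triangulation d Ω) (a : Pt d) (i j : Fin M.N) : ℝ :=
  ‖M.vert j - M.vert i‖ ^ 2 / 2 - ⟪a - M.vert i, M.vert j - M.vert i⟫

/-- The vector from `a` to its projection to the bisecting hyperplane of `p_i` and `p_j`. -/
def foot (M : Triangulation d Ω) (a : Pt d) (i j : Fin M.N) : Pt d :=
  (M.gap a i j / ‖M.vert j - M.vert i‖ ^ 2) • (M.vert j - M.vert i)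

/-- The points which are closer to `p_i` than to the other vertices. -/
def openCell (M : Triangulation d Ω) (i : Fin M.N) : Set (Pt d) :=
  {a | ∀ j, j ≠ i → 0 < M.gap a i j}

theorem isOpen_openCell (i : Fin M.N) : IsOpen (M.openCell i) := by
  simp only [openCell, Set.ofPred_forall]
  refine isOpen_iInter_of_finite fun k => isOpen_iInter_of_finite fun _ => ?_
  refine isOpen_lt (by fun_prop) ?_
  unfold gap
  fun_prop

theorem vert_mem_openCell (i : Fin M.N) : M.vert i ∈ M.openCell i := by
  intro j hj
  have : 0 < ‖M.vert j - M.vert i‖ := norm_pos_iff.2 (vert_sub_ne_zero hj)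
  simp only [gap, sub_self, inner_zero_left, sub_zero]
  positivity

theorem openCell_subset_cell (i : Fin M.N) : M.openCell i ⊆ M.cell i := by
  intro a ha
  rw [mem_cell_iff]
  intro k
  by_cases hk : k = i
  · simp [hk]
  · have := ha k hk
    rw [gap] at this
    linarith

theorem openCell_subset_interior (i : Fin M.N) : M.openCell i ⊆ interior (M.cell i) :=
  interior_maximal (openCell_subset_cell i) (isOpen_openCell i)

theorem vert_mem_interior_cell (i : Fin M.N) : M.vert i ∈ interior (M.cell i) :=
  openCell_subset_interior i (vert_mem_openCell i)

theorem mem_face_iff {i j : Fin M.N} {x : Pt d} : x ∈ M.face i j ↔ x ∈ M.cell i ∧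
    ⟪x - M.vert i, M.vert j - M.vert i⟫ = ‖M.vert j - M.vert i‖ ^ 2 / 2 := by
  constructor
  · rintro ⟨h1, h2⟩
    refine ⟨h1, le_antisymm (mem_cell_iff.1 h1 j) ?_⟩
    by_contra hlt
    push Not at hlt
    have := dist_le_dist_iff x (M.vert j) (M.vert i)
    have h3 := this.1 (h2 i)
    rw [norm_sub_rev, show x - M.vert j = (x - M.vert i) - (M.vert j - M.vert i) by abel,
      show M.vert i - M.vert j = -(M.vert j - M.vert i) by abel, inner_neg_right, inner_sub_left,
      real_inner_self_eq_norm_sq] at h3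
    linarith
  · rintro ⟨h1, h2⟩
    refine ⟨h1, fun k => ?_⟩
    refine le_trans ?_ (h1 k)
    rw [dist_le_dist_iff, norm_sub_rev,
      show x - M.vert j = (x - M.vert i) - (M.vert j - M.vert i) by abel,
      show M.vert i - M.vert j = -(M.vert j - M.vert i) by abel, inner_neg_right, inner_sub_left,
      real_inner_self_eq_norm_sq, h2]
    linarith

theorem isClosed_face (i j : Fin M.N) : IsClosed (M.face i j) :=
  (isClosed_cell i).inter (isClosed_cell j)

theorem norm_foot {a : Pt d} {i j : Fin M.N} (hij : j ≠ i) (ha : 0 < M.gap a i j) :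
    ‖M.foot a i j‖ = M.gap a i j / M.dij i j := by
  have h := vert_sub_ne_zero hij
  have h' : 0 < ‖M.vert j - M.vert i‖ := norm_pos_iff.2 h
  rw [foot, norm_smul, Real.norm_of_nonneg (by positivity), dij_eq_norm]
  field_simp

theorem foot_ne_zero {a : Pt d} {i j : Fin M.N} (hij : j ≠ i) (ha : 0 < M.gap a i j) :
    M.foot a i j ≠ 0 := by
  rw [← norm_pos_iff, norm_foot hij ha]
  exact div_pos ha (dij_pos hij)

theorem inner_foot_div {a : Pt d} {i j : Fin M.N} (hij : j ≠ i) (ha : 0 < M.gap a i j)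
    (y : Pt d) : ⟪y - a, M.foot a i j⟫ / ‖M.foot a i j‖ ^ 2 =
      ⟪y - a, M.vert j - M.vert i⟫ / M.gap a i j := by
  have h' : 0 < ‖M.vert j - M.vert i‖ := norm_pos_iff.2 (vert_sub_ne_zero hij)
  rw [norm_foot hij ha, foot, real_inner_smul_right, dij_eq_norm]
  field_simp

theorem inner_sub_eq_gap {a x : Pt d} {i j : Fin M.N} (hx : x ∈ M.face i j) :
    ⟪x - a, M.vert j - M.vert i⟫ = M.gap a i j := by
  rw [gap, ← (mem_face_iff.1 hx).2, ← inner_sub_left]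
  congr 1
  abel

theorem inner_foot_of_mem_face {a x : Pt d} {i j : Fin M.N} (hij : j ≠ i)
    (ha : 0 < M.gap a i j) (hx : x ∈ M.face i j) :
    ⟪x - a, M.foot a i j⟫ = ‖M.foot a i j‖ ^ 2 := by
  have h1 := inner_foot_div hij ha x
  have h2 : 0 < ‖M.foot a i j‖ := norm_pos_iff.2 (foot_ne_zero hij ha)
  rw [inner_sub_eq_gap hx, div_self ha.ne', div_eq_one_iff_eq (by positivity)] at h1
  exact h1

/-- The scaled normals determine the bisectors as seen from `a`. If two of them agreed, then `p_j -
p_i = c (p_k - p_i)` and the gaps would have the same ratio `c`; as the gap is quadratic minus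
linear in the edge vector, this forces `c = 1`. -/
theorem normals_ne {a : Pt d} {i j k : Fin M.N} (hij : j ≠ i) (hjk : j ≠ k)
    (haj : 0 < M.gap a i j) (hak : 0 < M.gap a i k) :
    (M.gap a i j)⁻¹ • (M.vert j - M.vert i) - (M.gap a i k)⁻¹ • (M.vert k - M.vert i) ≠ 0 := by
  intro h
  rw [sub_eq_zero] at h
  set c := M.gap a i j / M.gap a i k with hc
  have hc0 : 0 < c := div_pos haj hak
  have hu : M.vert j - M.vert i = c • (M.vert k - M.vert i) := by
    rw [hc, div_eq_mul_inv, mul_smul, ← h, smul_smul, mul_inv_cancel₀ haj.ne', one_smul]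
  have hg : M.gap a i j = c * M.gap a i k := by rw [hc, div_mul_cancel₀ _ hak.ne']
  have hj0 : 0 < ‖M.vert j - M.vert i‖ := norm_pos_iff.2 (vert_sub_ne_zero hij)
  rw [hu, norm_smul, Real.norm_of_nonneg hc0.le] at hj0
  have hk0 : 0 < ‖M.vert k - M.vert i‖ := pos_of_mul_pos_right hj0 hc0.le
  rw [gap, gap, hu, norm_smul, Real.norm_of_nonneg hc0.le, real_inner_smul_right] at hg
  have h2 : c * (c - 1) * ‖M.vert k - M.vert i‖ ^ 2 = 0 := by linear_combination 2 * hg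
  have hc1 : c = 1 := by
    rcases mul_eq_zero.1 h2 with h3 | h3
    · rcases mul_eq_zero.1 h3 with h4 | h4
      · exact absurd h4 hc0.ne'
      · linarith
    · exact absurd h3 (by positivity)
  rw [hc1, one_smul] at hu
  exact hjk (M.vert_injective (sub_left_injective hu))

/-- A ray from `a` through a common point leaves the cell through both faces. Neither bisector can
be reached before the other, so the two relative heights agree, and the point lies in a hyperplane
through `a` normal to the difference of the scaled normals. -/
theorem volume_coneOver_inter_coneOver {a : Pt d} {i j k : Fin M.N} (hij : j ≠ i) (hik : k ≠ i)
    (hjk : j ≠ k) (haj : 0 < M.gap a i j) (hak : 0 < M.gap a i k) :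
    volume (coneOver a (M.foot a i j) (M.face i j) ∩
      coneOver a (M.foot a i k) (M.face i k)) = 0 := by
  refine measure_mono_null ?_ (volume_hyperplane (normals_ne hij hjk haj hak) a)
  rintro y ⟨⟨hy1, hy2⟩, ⟨hy3, hy4⟩⟩
  rw [inner_foot_div hij haj] at hy1 hy2
  rw [inner_foot_div hik hak] at hy3 hy4
  set rj := ⟪y - a, M.vert j - M.vert i⟫ / M.gap a i j with hrj
  set rk := ⟪y - a, M.vert k - M.vert i⟫ / M.gap a i k with hrk
  have e1 := mem_cell_iff.1 (mem_face_iff.1 hy2).1 k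
  have e2 := mem_cell_iff.1 (mem_face_iff.1 hy4).1 j
  have f1 : ⟪y - a, M.vert k - M.vert i⟫ = rk * M.gap a i k := by
    rw [hrk, div_mul_cancel₀ _ hak.ne']
  have f2 : ⟪y - a, M.vert j - M.vert i⟫ = rj * M.gap a i j := by
    rw [hrj, div_mul_cancel₀ _ haj.ne']
  rw [show a + rj⁻¹ • (y - a) - M.vert i = rj⁻¹ • (y - a) + (a - M.vert i) by abel,
    inner_add_left, real_inner_smul_left, f1] at e1
  rw [show a + rk⁻¹ • (y - a) - M.vert i = rk⁻¹ • (y - a) + (a - M.vert i) by abel,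
    inner_add_left, real_inner_smul_left, f2] at e2
  have g1 : rj⁻¹ * rk * M.gap a i k ≤ 1 * M.gap a i k := by
    rw [mul_assoc, one_mul]
    conv_rhs => rw [gap]
    linarith
  have g2 : rk⁻¹ * rj * M.gap a i j ≤ 1 * M.gap a i j := by
    rw [mul_assoc, one_mul]
    conv_rhs => rw [gap]
    linarith
  have l1 := le_of_mul_le_mul_right g1 hak
  have l2 := le_of_mul_le_mul_right g2 haj
  rw [inv_mul_le_iff₀ hy1.1, mul_one] at l1
  rw [inv_mul_le_iff₀ hy3.1, mul_one] at l2
  have : rj = rk := le_antisymm l2 l1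
  rw [Set.mem_ofPred_eq, inner_sub_right, real_inner_smul_right, real_inner_smul_right,
    ← div_eq_inv_mul, ← div_eq_inv_mul, ← hrj, ← hrk, this, sub_self]

/-- The points of the face that also belong to a third cell lie on two different bisectors. The cone
over them from `p_i` is contained in a hyperplane, so it has no volume, and by the cone formula its
base has no area. -/
theorem faceMeasure_inter_cell {i j k : Fin M.N} (hij : j ≠ i) (hik : k ≠ i) (hjk : j ≠ k) :
    (μHE[d - 1] : Measure (Pt d)) (M.face i j ∩ M.cell k) = 0 := by
  have haj := vert_mem_openCell i j hij
  have hak := vert_mem_openCell i k hik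
  have hv := foot_ne_zero hij haj
  have h := volume_coneOver hv ((isClosed_face i j).inter (isClosed_cell k)).measurableSet
    (fun x hx => inner_foot_of_mem_face hij haj hx.1)
  have h0 : volume (coneOver (M.vert i) (M.foot (M.vert i) i j) (M.face i j ∩ M.cell k)) = 0 := by
    refine measure_mono_null ?_ (volume_hyperplane (normals_ne hij hjk haj hak) (M.vert i))
    rintro y ⟨hy1, hy2⟩
    have h1 := inner_sub_eq_gap (a := M.vert i) hy2.1
    have h2 := inner_sub_eq_gap (a := M.vert i) (show _ ∈ M.face i k from ⟨hy2.1.1, hy2.2⟩)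
    rw [add_sub_cancel_left, real_inner_smul_left] at h1 h2
    rw [inner_foot_div hij haj] at hy1
    have hr := (inv_pos.2 hy1.1).ne'
    rw [inner_foot_div hij haj] at h1 h2
    rw [Set.mem_ofPred_eq, inner_sub_right, real_inner_smul_right, real_inner_smul_right, ← h1,
      ← h2]
    have h3 : ⟪y - M.vert i, M.vert j - M.vert i⟫ ≠ 0 := by
      intro h4
      rw [h4, zero_div] at hr
      simp at hr
    have h4 : ⟪y - M.vert i, M.vert k - M.vert i⟫ ≠ 0 := by
      intro h4
      rw [h4, mul_zero] at h2
      exact hak.ne h2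
    have h5 := haj.ne'
    field_simp
    simp
  rw [h0] at h
  have := mul_eq_zero.1 h.symm
  rcases this with h1 | h1
  · rcases mul_eq_zero.1 h1 with h2 | h2
    · exact absurd (enorm_eq_zero.1 h2) hv
    · exact absurd h2 (coneFactor_ne_zero d)
  · exact h1

/-- The midpoint of the edge lies on the bisector and gives one inequality; the triangle inequality
for an equidistant point gives the other. -/
theorem weight_eq {i j : Fin M.N} (hij : j ≠ i) : M.weight i j = 1 / 2 := by
  have hd := dij_pos hij
  rw [weight, div_eq_iff hd.ne']
  apply le_antisymm
  · refine (Metric.infDist_le_dist_of_mem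
      (AffineSubspace.midpoint_mem_perpBisector (M.vert i) (M.vert j))).trans (le_of_eq ?_)
    rw [dist_right_midpoint, dij]
    norm_num
  · refine (Metric.le_infDist AffineSubspace.perpBisector_nonempty).2 fun y hy => ?_
    have h1 := AffineSubspace.mem_perpBisector_iff_dist_eq.1 (SetLike.mem_coe.1 hy)
    have h2 := dist_triangle (M.vert i) y (M.vert j)
    rw [dist_comm _ y, h1] at h2
    rw [dij, dist_comm (M.vert j) y]
    linarith

/-! ### Boxes -/

theorem mem_interiorVerts {i : Fin M.N} : i ∈ M.interiorVerts ↔ M.vert i ∈ Ω := by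
  simp [interiorVerts]

theorem mem_neighbours {i j : Fin M.N} : j ∈ M.neighbours i ↔
    j ≠ i ∧ 0 < (μHE[d - 1] : Measure (Pt d)) (M.face i j) := by
  simp [neighbours]

theorem mem_faces {e : Fin M.N × Fin M.N} : e ∈ M.faces ↔ e.1 ∈ M.interiorVerts ∧
    e.2 ∈ M.interiorVerts ∧ e.1 < e.2 ∧ e.2 ∈ M.neighbours e.1 := by
  simp [faces]

theorem mem_neighbours_comm {i j : Fin M.N} : j ∈ M.neighbours i ↔ i ∈ M.neighbours j := by
  rw [mem_neighbours, mem_neighbours, face_comm, ne_comm]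

/-- A point of a box lies in some element, whose vertices are at distance at most `h`, and `p_i` is
no farther away than any of them. -/
theorem cell_subset_closedBall (hbox : M.BoxesInside) {i : Fin M.N} (hi : i ∈ M.interiorVerts) :
    M.cell i ⊆ Metric.closedBall (M.vert i) M.meshSize := by
  intro x hx
  obtain ⟨T, hT, hxT⟩ := exists_mem_simplex (M := M) (hbox i hi hx)
  obtain ⟨k, hk⟩ := nonempty_of_mem_elems hT
  exact (hx k).trans ((dist_le_diam hxT (vert_mem_simplex hk)).trans (diam_le_meshSize hT))

theorem isCompact_cell (hbox : M.BoxesInside) {i : Fin M.N} (hi : i ∈ M.interiorVerts) :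
    IsCompact (M.cell i) :=
  (isCompact_closedBall _ _).of_isClosed_subset (isClosed_cell i) (cell_subset_closedBall hbox hi)

theorem cellVol_pos (hbox : M.BoxesInside) {i : Fin M.N} (hi : i ∈ M.interiorVerts) :
    0 < M.cellVol i :=
  ENNReal.toReal_pos (Measure.measure_pos_of_nonempty_interior _ ⟨_, vert_mem_interior_cell i⟩).ne'
    (isCompact_cell hbox hi).measure_lt_top.ne

theorem interior_cell_subset (hΩ : interior (closure Ω) = Ω) (hbox : M.BoxesInside)
    {i : Fin M.N} (hi : i ∈ M.interiorVerts) : interior (M.cell i) ⊆ Ω :=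
  (interior_mono (hbox i hi)).trans hΩ.subset

end Triangulation

namespace Triangulation

variable {d : ℕ} {Ω : Set (Pt d)} {M : Triangulation d Ω}

/-! ### Decomposition of the boxes into cones -/

theorem coneOver_subset {B F : Set (Pt d)} (hB : Convex ℝ B) {a v : Pt d} (ha : a ∈ B)
    (hFB : F ⊆ B) : coneOver a v F ⊆ B := by
  rintro y ⟨hr, hx⟩
  have := homothety_mem hB ha (hFB hx) hr.1.le hr.2
  rwa [AffineMap.homothety_apply, vsub_eq_sub, vadd_eq_add, add_sub_cancel_left, smul_smul,
    mul_inv_cancel₀ hr.1.ne', one_smul, sub_add_cancel] at this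

/-- The ray from `a` through `y` leaves the cell through the bisector for which the relative height
`ρ j` of `y` is largest. -/
theorem cell_subset_iUnion_coneOver (hbox : M.BoxesInside) {i : Fin M.N}
    (hi : i ∈ M.interiorVerts) {a : Pt d} (ha : a ∈ M.openCell i) :
    M.cell i \ {a} ⊆ ⋃ j ∈ Finset.univ.erase i, coneOver a (M.foot a i j) (M.face i j) := by
  rintro y ⟨hy, hya⟩
  have hya' : y - a ≠ 0 := sub_ne_zero.2 hya
  have hyc := mem_cell_iff.1 hy
  set ρ : Fin M.N → ℝ := fun j => ⟪y - a, M.vert j - M.vert i⟫ / M.gap a i j with hρ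
  have hin : ∀ j, j ≠ i → ⟪y - a, M.vert j - M.vert i⟫ = ρ j * M.gap a i j := by
    intro j hj
    rw [hρ]
    simp only
    rw [div_mul_cancel₀ _ (ha j hj).ne']
  have hmem : ∀ s : ℝ, (∀ j, j ≠ i → s * ρ j ≤ 1) → a + s • (y - a) ∈ M.cell i := by
    intro s hs
    rw [mem_cell_iff]
    intro k
    by_cases hk : k = i
    · simp [hk]
    rw [show a + s • (y - a) - M.vert i = s • (y - a) + (a - M.vert i) by abel,
      inner_add_left, real_inner_smul_left, hin k hk]
    have h1 := mul_le_mul_of_nonneg_right (hs k hk) (ha k hk).le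
    have h2 : M.gap a i k = ‖M.vert k - M.vert i‖ ^ 2 / 2 - ⟪a - M.vert i, M.vert k - M.vert i⟫ :=
      rfl
    linarith
  -- If no height were positive, the whole ray would stay in the cell, which is bounded.
  have hpos : ∃ j ∈ Finset.univ.erase i, 0 < ρ j := by
    by_contra hcon
    push Not at hcon
    have hall : ∀ s : ℝ, 0 ≤ s → a + s • (y - a) ∈ M.cell i := by
      intro s hs
      refine hmem s fun j hj => ?_
      have := hcon j (by simp [hj])
      nlinarith
    obtain ⟨R, hR⟩ := (isCompact_cell hbox hi).isBounded.subset_closedBall a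
    have hR0 : 0 ≤ R := by
      have := hR (hall 0 le_rfl)
      simpa using this
    have h1 := hR (hall ((R + 1) / ‖y - a‖) (by positivity))
    rw [Metric.mem_closedBall, dist_eq_norm, add_sub_cancel_left, norm_smul,
      Real.norm_of_nonneg (by positivity), div_mul_cancel₀ _ (norm_ne_zero_iff.2 hya')] at h1
    linarith
  obtain ⟨j0, hj0, hj0p⟩ := hpos
  obtain ⟨j, hj, hmax⟩ := Finset.exists_max_image (Finset.univ.erase i) ρ ⟨j0, hj0⟩
  have hji : j ≠ i := (Finset.mem_erase.1 hj).1
  have hjp : 0 < ρ j := hj0p.trans_le (hmax j0 hj0)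
  have hj1 : ρ j ≤ 1 := by
    rw [hρ]
    simp only
    rw [div_le_one (ha j hji), gap]
    have := hyc j
    rw [show y - M.vert i = (y - a) + (a - M.vert i) by abel, inner_add_left] at this
    linarith
  refine Set.mem_biUnion hj ⟨?_, ?_⟩
  · rw [inner_foot_div hji (ha j hji)]
    exact ⟨hjp, hj1⟩
  · rw [inner_foot_div hji (ha j hji)]
    change a + (ρ j)⁻¹ • (y - a) ∈ _
    refine mem_face_iff.2 ⟨hmem _ fun k hk => ?_, ?_⟩
    · rw [inv_mul_le_iff₀ hjp, mul_one]
      exact hmax k (by simp [hk])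
    · rw [show a + (ρ j)⁻¹ • (y - a) - M.vert i = (ρ j)⁻¹ • (y - a) + (a - M.vert i) by abel,
        inner_add_left, real_inner_smul_left, hin j hji, inv_mul_cancel_left₀ hjp.ne', gap]
      ring

theorem volume_coneOver_face {a : Pt d} {i j : Fin M.N} (hij : j ≠ i) (ha : 0 < M.gap a i j) :
    volume (coneOver a (M.foot a i j) (M.face i j)) =
      ENNReal.ofReal (M.gap a i j / M.dij i j) * coneFactor d * μHE[d - 1] (M.face i j) := by
  rw [volume_coneOver (foot_ne_zero hij ha) (isClosed_face i j).measurableSet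
    (fun x hx => inner_foot_of_mem_face hij ha hx), ← norm_foot hij ha, ofReal_norm]

/-- A face of infinite area would span a cone of infinite volume inside the compact box. -/
theorem faceMeasure_ne_top (hbox : M.BoxesInside) {i j : Fin M.N} (hi : i ∈ M.interiorVerts)
    (hij : j ≠ i) : (μHE[d - 1] : Measure (Pt d)) (M.face i j) ≠ ⊤ := by
  have ha := vert_mem_openCell i j hij
  have h := volume_coneOver_face hij ha
  intro htop
  rw [htop, ENNReal.mul_top] at h
  · have h1 := measure_mono (μ := volume) (coneOver_subset (v := M.foot (M.vert i) i j)
      (convex_cell i) (openCell_subset_cell i (vert_mem_openCell i))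
      (Set.inter_subset_left : M.face i j ⊆ _))
    rw [← face, h] at h1
    exact (isCompact_cell hbox hi).measure_lt_top.not_ge h1
  · refine mul_ne_zero ?_ (coneFactor_ne_zero d)
    simpa using div_pos ha (dij_pos hij)

theorem cellVol_eq_sum (hd : 1 ≤ d) (hbox : M.BoxesInside) {i : Fin M.N}
    (hi : i ∈ M.interiorVerts) {a : Pt d} (ha : a ∈ M.openCell i) :
    M.cellVol i = ∑ j ∈ Finset.univ.erase i,
      M.gap a i j / M.dij i j * (coneFactor d).toReal * M.faceArea i j := by
  have : NeZero d := ⟨by omega⟩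
  have hne : ∀ j ∈ Finset.univ.erase i, j ≠ i := fun j hj => (Finset.mem_erase.1 hj).1
  have hvol : volume (M.cell i) = ∑ j ∈ Finset.univ.erase i,
      volume (coneOver a (M.foot a i j) (M.face i j)) := by
    rw [← measure_biUnion_finset₀]
    · apply le_antisymm
      · refine (measure_mono_ae ?_)
        have h0 : ∀ᵐ y ∂(volume : Measure (Pt d)), y ≠ a := by
          simp [ae_iff]
        filter_upwards [h0] with y hya hy
        exact cell_subset_iUnion_coneOver hbox hi ha ⟨hy, hya⟩
      · exact measure_mono (Set.iUnion₂_subset fun j _ =>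
          coneOver_subset (convex_cell i) (openCell_subset_cell i ha) Set.inter_subset_left)
    · intro j hj k hk hjk
      exact volume_coneOver_inter_coneOver (hne j hj) (hne k hk) hjk (ha j (hne j hj))
        (ha k (hne k hk))
    · exact fun j _ => (measurableSet_coneOver _ _ (isClosed_face i j).measurableSet).nullMeasurableSet
  rw [cellVol, Measure.real, hvol, ENNReal.toReal_sum]
  · refine Finset.sum_congr rfl fun j hj => ?_
    have hp : 0 < M.gap a i j / M.dij i j := div_pos (ha j (hne j hj)) (dij_pos (hne j hj))
    rw [volume_coneOver_face (hne j hj) (ha j (hne j hj)), ENNReal.toReal_mul, ENNReal.toReal_mul,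
      ENNReal.toReal_ofReal hp.le, faceArea, Measure.real]
  · intro j hj
    refine ne_top_of_le_ne_top (isCompact_cell hbox hi).measure_lt_top.ne (measure_mono
      (coneOver_subset (convex_cell i) (openCell_subset_cell i ha) Set.inter_subset_left))

/-- The outer normals of a box, weighted with the areas of its faces, add up to zero. -/
theorem sum_faceArea_smul_normal (hd : 1 ≤ d) (hbox : M.BoxesInside) {i : Fin M.N}
    (hi : i ∈ M.interiorVerts) :
    ∑ j ∈ M.neighbours i, M.faceArea i j • M.normal i j = 0 := by
  have hsub : ∑ j ∈ M.neighbours i, M.faceArea i j • M.normal i j =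
      ∑ j ∈ Finset.univ.erase i, M.faceArea i j • M.normal i j := by
    refine Finset.sum_subset (fun j hj => by simp [(mem_neighbours.1 hj).1]) fun j hj hj' => ?_
    have : (μHE[d - 1] : Measure (Pt d)) (M.face i j) = 0 := by
      by_contra h0
      exact hj' (mem_neighbours.2 ⟨(Finset.mem_erase.1 hj).1, pos_iff_ne_zero.2 h0⟩)
    rw [faceArea, Measure.real, this, ENNReal.toReal_zero, zero_smul]
  rw [hsub]
  -- The decomposition of the box into cones gives the same volume for every apex in the open cell,
  -- and it is affine in the apex. Moving the apex from `p_i` by `ε • w` lowers the sum by `ε ‖w‖²`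
  -- times the cone factor, so `w = 0`.
  set w := ∑ j ∈ Finset.univ.erase i, M.faceArea i j • M.normal i j with hw
  obtain ⟨ε, hε, hmem⟩ : ∃ ε : ℝ, 0 < ε ∧ M.vert i + ε • w ∈ M.openCell i := by
    have hc : Continuous fun ε : ℝ => M.vert i + ε • w := by fun_prop
    have h0 : M.vert i + (0 : ℝ) • w ∈ M.openCell i := by simpa using vert_mem_openCell i
    have hev := (hc.tendsto 0).eventually ((isOpen_openCell i).mem_nhds h0)
    obtain ⟨ε, h1, h2⟩ := ((hev.filter_mono nhdsWithin_le_nhds).and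
      (self_mem_nhdsWithin (s := Set.Ioi (0 : ℝ)))).exists
    exact ⟨ε, h2, h1⟩
  have e1 := cellVol_eq_sum hd hbox hi (vert_mem_openCell i)
  have e2 := cellVol_eq_sum hd hbox hi hmem
  rw [e1, ← sub_eq_zero, ← Finset.sum_sub_distrib] at e2
  have hterm : ∀ j ∈ Finset.univ.erase i,
      M.gap (M.vert i) i j / M.dij i j * (coneFactor d).toReal * M.faceArea i j -
      M.gap (M.vert i + ε • w) i j / M.dij i j * (coneFactor d).toReal * M.faceArea i j =
      ε * (coneFactor d).toReal * ⟪w, M.faceArea i j • M.normal i j⟫ := by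
    intro j hj
    have := (dij_pos (Finset.mem_erase.1 hj).1).ne'
    simp only [gap, normal, sub_self, inner_zero_left, add_sub_cancel_left, real_inner_smul_left,
      real_inner_smul_right]
    field_simp
    ring
  rw [Finset.sum_congr rfl hterm, ← Finset.mul_sum, ← inner_sum, ← hw] at e2
  have hcf : 0 < (coneFactor d).toReal :=
    ENNReal.toReal_pos (coneFactor_ne_zero d) (coneFactor_ne_top d)
  have h3 := (mul_eq_zero.1 e2).resolve_left (by positivity)
  exact inner_self_eq_zero.1 h3

/-! ### Neighbouring vertices are joined by an edge -/

theorem exists_weights_of_mem_simplex {T : Finset (Fin M.N)} {x : Pt d} (hx : x ∈ M.simplex T) :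
    ∃ w : Fin M.N → ℝ, (∀ k ∈ T, 0 ≤ w k) ∧ ∑ k ∈ T, w k = 1 ∧ ∑ k ∈ T, w k • M.vert k = x := by
  classical
  rw [simplex, ← Finset.coe_image, Finset.mem_convexHull'] at hx
  obtain ⟨w, h0, h1, h2⟩ := hx
  rw [Finset.sum_image fun a _ b _ h => M.vert_injective h] at h1 h2
  exact ⟨fun k => w (M.vert k), fun k hk => h0 _ (Finset.mem_image_of_mem _ hk), h1, h2⟩

theorem exists_circumcenter {T : Finset (Fin M.N)} (hT : T ∈ M.elems) :
    ∃ (c : Pt d) (r : ℝ), ∀ k ∈ T, dist (M.vert k) c = r := by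
  set e := T.equivFinOfCardEq (M.card_elem T hT)
  let s : Affine.Simplex ℝ (Pt d) d :=
    ⟨fun n => M.vert (e.symm n), (M.affineIndependent T hT).comp_embedding e.symm.toEmbedding⟩
  refine ⟨s.circumcenter, s.circumradius, fun k hk => ?_⟩
  have := s.dist_circumcenter_eq_circumradius (e ⟨k, hk⟩)
  simpa [s] using this

/-- A face of positive area is not covered by its finitely many null intersections with third cells.
-/
theorem exists_mem_face_forall_lt {i j : Fin M.N} (hj : j ∈ M.neighbours i) :
    ∃ x ∈ M.face i j, ∀ k, k ≠ i → k ≠ j → dist x (M.vert i) < dist x (M.vert k) := by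
  obtain ⟨hji, hpos⟩ := mem_neighbours.1 hj
  by_contra hcon
  push Not at hcon
  refine hpos.ne' (measure_mono_null (t := ⋃ k ∈ {k | k ≠ i ∧ k ≠ j},
    M.face i j ∩ M.cell k) ?_ ?_)
  · intro x hx
    obtain ⟨k, hki, hkj, hk⟩ := hcon x hx
    exact Set.mem_biUnion (⟨hki, hkj⟩ : k ∈ {k | k ≠ i ∧ k ≠ j})
      ⟨hx, fun l => hk.trans (hx.1 l)⟩
  · exact (measure_biUnion_null_iff (Set.to_countable _)).2 fun k hk =>
      faceMeasure_inter_cell hji hk.1 hk.2.symm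

/-- A point `y` of the open segment between the vertices lies in some element `T`. The powers `f`
with respect to the circumsphere of `T` and `g` with respect to the sphere through `p_i` and `p_j`
about a relatively interior point of the face are nonnegative at all vertices; `f` vanishes on `T`,
and `g` vanishes only at `p_i` and `p_j`. Their difference is affine, so its value at `y` is
nonnegative when computed on the segment and nonpositive when computed on `T`. Hence `y` has no
weight on the vertices of `T` other than `p_i` and `p_j`. -/
theorem exists_elem_of_mem_neighbours (hΩ : IsOpen Ω) (hdel : M.IsDelaunay) {i j : Fin M.N}
    (hi : i ∈ M.interiorVerts) (hj : j ∈ M.neighbours i) :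
    ∃ T ∈ M.elems, i ∈ T ∧ j ∈ T := by
  have hji := (mem_neighbours.1 hj).1
  have hne : M.vert j - M.vert i ≠ 0 := vert_sub_ne_zero hji
  obtain ⟨x, hx, hxk⟩ := exists_mem_face_forall_lt hj
  -- Only points of the segment near `p_i` are known to be in `Ω`. The strict bounds on `θ` keep `y`
  -- away from both ends, so that in the end both vertices must belong to `T`.
  obtain ⟨θ, hθ0, hθ1, hθ⟩ : ∃ θ : ℝ, 0 < θ ∧ θ < 1 ∧
      M.vert i + θ • (M.vert j - M.vert i) ∈ Ω := by
    have hc : Continuous fun ε : ℝ => M.vert i + ε • (M.vert j - M.vert i) := by fun_prop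
    have h0 : M.vert i + (0 : ℝ) • (M.vert j - M.vert i) ∈ Ω := by
      simpa using mem_interiorVerts.1 hi
    have hev := (hc.tendsto 0).eventually (hΩ.mem_nhds h0)
    obtain ⟨ε, h1, h2⟩ := ((hev.filter_mono nhdsWithin_le_nhds).and
      (Ioo_mem_nhdsGT (zero_lt_one' ℝ))).exists
    exact ⟨ε, h2.1, h2.2, h1⟩
  set y := M.vert i + θ • (M.vert j - M.vert i) with hy
  obtain ⟨T, hT, hyT⟩ := exists_mem_simplex (M := M) (subset_closure hθ)
  obtain ⟨w, hw0, hw1, hwy⟩ := exists_weights_of_mem_simplex hyT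
  obtain ⟨c, r, hcr⟩ := exists_circumcenter hT
  have hr0 : 0 ≤ r := by
    obtain ⟨k, hk⟩ := nonempty_of_mem_elems hT
    exact hcr k hk ▸ dist_nonneg
  have hdm := hdel T hT c r hcr
  set f : Pt d → ℝ := fun p => ‖p - c‖ ^ 2 - r ^ 2 with hf
  set R := ‖M.vert i - x‖ with hR
  set g : Pt d → ℝ := fun p => ‖p - x‖ ^ 2 - R ^ 2 with hg
  set L : Pt d → ℝ := fun p => 2 * ⟪p, x - c⟫ + (‖c‖ ^ 2 - ‖x‖ ^ 2 - r ^ 2 + R ^ 2) with hL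
  have hLfg : ∀ p, L p = f p - g p := by
    intro p
    simp only [hL, hf, hg, norm_sub_sq_real, inner_sub_right]
    ring
  have hfT : ∀ k ∈ T, f (M.vert k) = 0 := by
    intro k hk
    simp only [hf]
    rw [← dist_eq_norm, hcr k hk, sub_self]
  have hf0 : ∀ k, 0 ≤ f (M.vert k) := by
    intro k
    simp only [hf]
    rw [← dist_eq_norm]
    have := pow_le_pow_left₀ hr0 (hdm k) 2
    linarith
  have hgi : g (M.vert i) = 0 := sub_self _
  have hgj : g (M.vert j) = 0 := by
    simp only [hg, hR, ← dist_eq_norm]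
    rw [dist_comm _ x, dist_comm _ x, le_antisymm (hx.2 i) (hx.1 j), sub_self]
  have hgk : ∀ k, k ≠ i → k ≠ j → 0 < g (M.vert k) := by
    intro k hki hkj
    simp only [hg, hR, ← dist_eq_norm]
    rw [dist_comm _ x, dist_comm _ x]
    have := pow_lt_pow_left₀ (hxk k hki hkj) dist_nonneg two_ne_zero
    linarith
  have hg0 : ∀ k, 0 ≤ g (M.vert k) := by
    intro k
    by_cases hki : k = i
    · rw [hki, hgi]
    by_cases hkj : k = j
    · rw [hkj, hgj]
    exact (hgk k hki hkj).le
  have hLy1 : L y = ∑ k ∈ T, w k * L (M.vert k) := by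
    simp only [hL, mul_add, Finset.sum_add_distrib, ← Finset.sum_mul, hw1, one_mul]
    congr 1
    rw [← hwy, sum_inner, Finset.mul_sum]
    refine Finset.sum_congr rfl fun k _ => ?_
    rw [real_inner_smul_left]
    ring
  have hLy2 : L y = (1 - θ) * f (M.vert i) + θ * f (M.vert j) := by
    have h1 : L y = (1 - θ) * L (M.vert i) + θ * L (M.vert j) := by
      simp only [hL, hy, inner_add_left, real_inner_smul_left, inner_sub_left]
      ring
    rw [h1, hLfg, hLfg, hgi, hgj, sub_zero, sub_zero]
  have hLy3 : L y = - ∑ k ∈ T, w k * g (M.vert k) := by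
    rw [hLy1, ← Finset.sum_neg_distrib]
    refine Finset.sum_congr rfl fun k hk => ?_
    rw [hLfg, hfT k hk]
    ring
  have hnn : 0 ≤ L y := by
    rw [hLy2]
    exact add_nonneg (mul_nonneg (by linarith) (hf0 i)) (mul_nonneg hθ0.le (hf0 j))
  have hterm : ∀ k ∈ T, 0 ≤ w k * g (M.vert k) := fun k hk => mul_nonneg (hw0 k hk) (hg0 k)
  have hsum0 : ∑ k ∈ T, w k * g (M.vert k) = 0 :=
    le_antisymm (by linarith) (Finset.sum_nonneg hterm)
  have hw : ∀ k ∈ T, k ≠ i → k ≠ j → w k = 0 := by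
    intro k hk hki hkj
    have := (Finset.sum_eq_zero_iff_of_nonneg hterm).1 hsum0 k hk
    exact (mul_eq_zero.1 this).resolve_right (hgk k hki hkj).ne'
  refine ⟨T, hT, ?_, ?_⟩
  · by_contra hiT
    have h1 : y = M.vert j := by
      rw [← hwy, ← one_smul ℝ (M.vert j), ← hw1, Finset.sum_smul]
      refine Finset.sum_congr rfl fun k hk => ?_
      by_cases hkj : k = j
      · rw [hkj]
      · rw [hw k hk (fun h => hiT (h ▸ hk)) hkj, zero_smul, zero_smul]
    have h2 : (1 - θ) • (M.vert j - M.vert i) = 0 := by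
      rw [sub_smul, one_smul, sub_eq_zero, sub_eq_iff_eq_add', ← hy, h1]
    exact (smul_ne_zero (by linarith) hne) h2
  · by_contra hjT
    have h1 : y = M.vert i := by
      rw [← hwy, ← one_smul ℝ (M.vert i), ← hw1, Finset.sum_smul]
      refine Finset.sum_congr rfl fun k hk => ?_
      by_cases hki : k = i
      · rw [hki]
      · rw [hw k hk hki (fun h => hjT (h ▸ hk)), zero_smul, zero_smul]
    rw [hy, add_eq_left] at h1
    exact (smul_ne_zero hθ0.ne' hne) h1

theorem dij_le_meshSize (hΩ : IsOpen Ω) (hdel : M.IsDelaunay) {i j : Fin M.N}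
    (hi : i ∈ M.interiorVerts) (hj : j ∈ M.neighbours i) : M.dij i j ≤ M.meshSize := by
  obtain ⟨T, hT, hiT, hjT⟩ := exists_elem_of_mem_neighbours hΩ hdel hi hj
  exact (dist_le_diam (vert_mem_simplex hiT) (vert_mem_simplex hjT)).trans (diam_le_meshSize hT)

/-- The volume of the unit ball. -/
def ballVol (d : ℕ) : ℝ := volume.real (Metric.ball (0 : Pt d) 1)

theorem ballVol_pos (d : ℕ) : 0 < ballVol d :=
  ENNReal.toReal_pos (Metric.measure_ball_pos _ _ one_pos).ne' measure_ball_lt_top.ne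

theorem volume_real_closedBall (x : Pt d) {r : ℝ} (hr : 0 ≤ r) :
    volume.real (Metric.closedBall x r) = r ^ d * ballVol d := by
  rw [Measure.real, Measure.addHaar_closedBall _ _ hr, ENNReal.toReal_mul,
    ENNReal.toReal_ofReal (by positivity), finrank_euclideanSpace_fin, ballVol, Measure.real]

/-- Mesh regularity bounds only faces between two boxes, but the Gauss-Green gradient also uses
faces towards boundary vertices. For these the area is controlled by the volume of a cone of height
`h` in a ball of radius `h`. -/
theorem faceArea_le (hd : 1 ≤ d) (hΩ : IsOpen Ω) (hdel : M.IsDelaunay) (hbox : M.BoxesInside)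
    {i j : Fin M.N} (hi : i ∈ M.interiorVerts) (hj : j ∈ M.neighbours i) :
    M.faceArea i j ≤ ballVol d / (coneFactor d).toReal * M.meshSize ^ (d - 1) := by
  have hji := (mem_neighbours.1 hj).1
  have hdh := dij_le_meshSize hΩ hdel hi hj
  have hdp := dij_pos hji
  set h := M.meshSize with hh
  have hh0 : 0 < h := hdp.trans_le hdh
  have hcf : 0 < (coneFactor d).toReal :=
    ENNReal.toReal_pos (coneFactor_ne_zero d) (coneFactor_ne_top d)
  have hn : ‖M.normal i j‖ = 1 := by
    rw [normal, norm_smul, norm_inv, Real.norm_of_nonneg hdp.le, ← dij_eq_norm,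
      inv_mul_cancel₀ hdp.ne']
  have hu : M.vert j - M.vert i = M.dij i j • M.normal i j := by
    rw [normal, smul_smul, mul_inv_cancel₀ hdp.ne', one_smul]
  have hnn : ⟪M.normal i j, M.normal i j⟫ = 1 := by
    rw [real_inner_self_eq_norm_sq, hn, one_pow]
  -- This apex is at distance exactly `h` from the bisector, and `d_ij ≤ h` keeps it within distance
  -- `h` of `p_i`.
  set a := M.vert i + (M.dij i j / 2 - h) • M.normal i j with ha
  set v := h • M.normal i j with hv
  have hv' : ‖v‖ = h := by rw [hv, norm_smul, hn, mul_one, Real.norm_of_nonneg hh0.le]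
  have hv0 : v ≠ 0 := by
    rw [← norm_pos_iff, hv']
    exact hh0
  have hplane : ∀ x ∈ M.face i j, ⟪x - a, v⟫ = ‖v‖ ^ 2 := by
    intro x hx
    have h1 := (mem_face_iff.1 hx).2
    rw [hu, norm_smul, hn, mul_one, Real.norm_of_nonneg hdp.le, real_inner_smul_right] at h1
    have h2 : ⟪x - M.vert i, M.normal i j⟫ = M.dij i j / 2 := by
      refine mul_left_cancel₀ hdp.ne' (h1.trans ?_)
      ring
    rw [hv', ha, hv, real_inner_smul_right, ← sub_sub, inner_sub_left, h2, real_inner_smul_left,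
      hnn]
    ring
  have hvol := volume_coneOver hv0 (isClosed_face i j).measurableSet hplane
  have hsub : coneOver a v (M.face i j) ⊆ Metric.closedBall (M.vert i) h := by
    refine coneOver_subset (convex_closedBall _ _) ?_
      (Set.inter_subset_left.trans (cell_subset_closedBall hbox hi))
    rw [Metric.mem_closedBall, dist_eq_norm, ha, add_sub_cancel_left, norm_smul, hn, mul_one,
      Real.norm_eq_abs, abs_le]
    constructor <;> linarith
  have h3 := ENNReal.toReal_mono measure_closedBall_lt_top.ne (measure_mono (μ := volume) hsub)
  rw [hvol, ENNReal.toReal_mul, ENNReal.toReal_mul, toReal_enorm, hv'] at h3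
  change h * (coneFactor d).toReal * M.faceArea i j ≤ volume.real (Metric.closedBall _ _) at h3
  rw [volume_real_closedBall _ hh0.le] at h3
  have h4 : h ^ d = h * h ^ (d - 1) := by rw [← pow_succ', Nat.sub_add_cancel hd]
  rw [h4] at h3
  rw [div_mul_eq_mul_div, le_div_iff₀ hcf]
  have h5 : h * (M.faceArea i j * (coneFactor d).toReal) ≤ h * (ballVol d * h ^ (d - 1)) := by
    calc _ = h * (coneFactor d).toReal * M.faceArea i j := by ring
      _ ≤ _ := h3
      _ = _ := by ring
  exact le_of_mul_le_mul_left h5 hh0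

end Triangulation

namespace Triangulation

variable {d : ℕ} {Ω : Set (Pt d)} {M : Triangulation d Ω} {κ : ℝ}

/-! ### Volumes of elements and the number of elements at a vertex -/

theorem meshSize_pos (hd : 1 ≤ d) {T : Finset (Fin M.N)} (hT : T ∈ M.elems) : 0 < M.meshSize :=
  (diam_pos hd hT).trans_le (diam_le_meshSize hT)

theorem le_volume_simplex (hκ : 0 < κ) (hd : 1 ≤ d) (hreg : M.IsRegular κ) {T : Finset (Fin M.N)}
    (hT : T ∈ M.elems) :
    M.meshSize ^ d * (ballVol d / (κ ^ 2) ^ d) ≤ volume.real (M.simplex T) := by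
  obtain ⟨c, hc⟩ := hreg.shape T hT
  have hdp := diam_pos hd hT
  have h1 : volume.real (Metric.closedBall c (M.diam T / κ)) ≤ volume.real (M.simplex T) :=
    ENNReal.toReal_mono (M.isCompact_simplex T).measure_lt_top.ne (measure_mono hc)
  rw [volume_real_closedBall _ (by positivity)] at h1
  refine le_trans ?_ h1
  rw [mul_div_assoc', mul_div_right_comm, ← div_pow]
  refine mul_le_mul_of_nonneg_right (pow_le_pow_left₀ ?_ ?_ _) (ballVol_pos d).le
  · exact div_nonneg (meshSize_pos hd hT).le (by positivity)
  · rw [div_le_div_iff₀ (by positivity) hκ]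
    calc M.meshSize * κ ≤ (κ * M.diam T) * κ :=
          mul_le_mul_of_nonneg_right (hreg.quasiUniform T hT) hκ.le
      _ = _ := by ring

/-- By conformity the intersection lies in the affine span of at most `d` common vertices, a proper
affine subspace. -/
theorem volume_simplex_inter {S T : Finset (Fin M.N)} (hS : S ∈ M.elems)
    (hT : T ∈ M.elems) (hST : S ≠ T) : volume (M.simplex S ∩ M.simplex T) = 0 := by
  classical
  have hcard : (S ∩ T).card ≤ d := by
    have h1 : S ∩ T ⊂ S := by
      refine Finset.inter_subset_left.ssubset_of_ne fun h => hST ?_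
      exact Finset.eq_of_subset_of_card_le (Finset.inter_eq_left.1 h)
        (by rw [M.card_elem S hS, M.card_elem T hT])
    have h2 := Finset.card_lt_card h1
    rw [M.card_elem S hS] at h2
    omega
  refine measure_mono_null ((M.conforming S hS T hT).trans (convexHull_subset_affineSpan _)) ?_
  refine Measure.addHaar_affineSubspace _ _ fun htop => ?_
  rw [← Finset.coe_inter] at htop
  rcases Nat.eq_zero_or_pos (S ∩ T).card with h0 | h0
  · rw [Finset.card_eq_zero] at h0
    rw [h0] at htop
    simp only [Finset.coe_empty, Set.image_empty, AffineSubspace.span_empty] at htop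
    exact AffineSubspace.bot_ne_top ℝ _ _ htop
  · obtain ⟨n, hn⟩ : ∃ n, (S ∩ T).card = n + 1 := ⟨_, (Nat.succ_pred_eq_of_pos h0).symm⟩
    have h1 := finrank_vectorSpan_image_finset_le ℝ M.vert (S ∩ T) hn
    have h2 := congrArg AffineSubspace.direction htop
    rw [direction_affineSpan, AffineSubspace.direction_top, ← Finset.coe_image] at h2
    rw [h2, finrank_top, finrank_euclideanSpace_fin] at h1
    omega

open Classical in
/-- The elements with vertex `p_i`. -/
def elemsAt (M : Triangulation d Ω) (i : Fin M.N) : Finset (Finset (Fin M.N)) :=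
  M.elems.filter (i ∈ ·)

theorem mem_elemsAt {i : Fin M.N} {T : Finset (Fin M.N)} :
    T ∈ M.elemsAt i ↔ T ∈ M.elems ∧ i ∈ T := by
  simp [elemsAt]

/-- Packing: the elements at `p_i` are almost disjoint, lie in the ball of radius `h`, and each
contains a ball of radius at least `h / κ²`. -/
theorem card_elemsAt_le (hκ : 0 < κ) (hd : 1 ≤ d) (hreg : M.IsRegular κ) (i : Fin M.N) :
    ((M.elemsAt i).card : ℝ) ≤ (κ ^ 2) ^ d := by
  rcases (M.elemsAt i).eq_empty_or_nonempty with h0 | ⟨T₀, hT₀⟩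
  · rw [h0]
    simp only [Finset.card_empty, Nat.cast_zero]
    positivity
  have hh := meshSize_pos hd (mem_elemsAt.1 hT₀).1
  have hb := ballVol_pos d
  have h1 : ∑ T ∈ M.elemsAt i, volume.real (M.simplex T) ≤ M.meshSize ^ d * ballVol d := by
    rw [← volume_real_closedBall (M.vert i) hh.le]
    simp only [Measure.real]
    rw [← ENNReal.toReal_sum fun T _ => (M.isCompact_simplex T).measure_lt_top.ne]
    refine ENNReal.toReal_mono measure_closedBall_lt_top.ne ?_
    rw [← measure_biUnion_finset₀]
    · refine measure_mono (Set.iUnion₂_subset fun T hT x hx => ?_)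
      rw [mem_elemsAt] at hT
      exact (dist_le_diam hx (vert_mem_simplex hT.2)).trans (diam_le_meshSize hT.1)
    · intro S hS T hT hST
      exact volume_simplex_inter (mem_elemsAt.1 hS).1 (mem_elemsAt.1 hT).1 hST
    · exact fun T _ => (M.isCompact_simplex T).measurableSet.nullMeasurableSet
  have h2 : (M.elemsAt i).card • (M.meshSize ^ d * (ballVol d / (κ ^ 2) ^ d)) ≤
      ∑ T ∈ M.elemsAt i, volume.real (M.simplex T) :=
    Finset.card_nsmul_le_sum _ _ _ fun T hT => le_volume_simplex hκ hd hreg (mem_elemsAt.1 hT).1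
  have h3 := h2.trans h1
  rw [nsmul_eq_mul] at h3
  have hp : 0 < M.meshSize ^ d * ballVol d := by positivity
  refine le_of_mul_le_mul_right ?_ hp
  calc ((M.elemsAt i).card : ℝ) * (M.meshSize ^ d * ballVol d)
      = (κ ^ 2) ^ d * ((M.elemsAt i).card * (M.meshSize ^ d * (ballVol d / (κ ^ 2) ^ d))) := by
        field_simp
    _ ≤ _ := by gcongr

/-- A bound for the number of neighbours of a box. -/
def maxNeighbours (d : ℕ) (κ : ℝ) : ℝ := (κ ^ 2) ^ d * (d + 1)

theorem card_neighbours_le (hκ : 0 < κ) (hd : 1 ≤ d) (hΩ : IsOpen Ω) (hdel : M.IsDelaunay)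
    (hreg : M.IsRegular κ) {i : Fin M.N} (hi : i ∈ M.interiorVerts) :
    ((M.neighbours i).card : ℝ) ≤ maxNeighbours d κ := by
  classical
  have h1 : M.neighbours i ⊆ (M.elemsAt i).biUnion id := by
    intro j hj
    obtain ⟨T, hT, hiT, hjT⟩ := exists_elem_of_mem_neighbours hΩ hdel hi hj
    exact Finset.mem_biUnion.2 ⟨T, mem_elemsAt.2 ⟨hT, hiT⟩, hjT⟩
  have h2 : (M.neighbours i).card ≤ (M.elemsAt i).card * (d + 1) :=
    (Finset.card_le_card h1).trans (Finset.card_biUnion_le_card_mul _ _ _ fun T hT =>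
      (M.card_elem T (mem_elemsAt.1 hT).1).le)
  calc ((M.neighbours i).card : ℝ) ≤ (M.elemsAt i).card * (d + 1) := by exact_mod_cast h2
    _ ≤ _ := mul_le_mul_of_nonneg_right (card_elemsAt_le hκ hd hreg i) (by positivity)

/-- Each box occurs in boundedly many faces. Of the factor 4, one 2 comes from squaring a sum and
one from counting the two sides of a face separately. -/
theorem sum_faces_le (hκ : 0 < κ) (hd : 1 ≤ d) (hΩ : IsOpen Ω) (hdel : M.IsDelaunay)
    (hreg : M.IsRegular κ) (m : Fin M.N → ℝ) :
    ∑ e ∈ M.faces, (m e.1 + m e.2) ^ 2 ≤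
      4 * maxNeighbours d κ * ∑ i ∈ M.interiorVerts, m i ^ 2 := by
  classical
  set R : Finset (Fin M.N × Fin M.N) := Finset.univ.filter fun e =>
    e.1 ∈ M.interiorVerts ∧ e.2 ∈ M.neighbours e.1 with hR
  set R' : Finset (Fin M.N × Fin M.N) := Finset.univ.filter fun e =>
    e.2 ∈ M.interiorVerts ∧ e.1 ∈ M.neighbours e.2 with hR'
  have hN : ∀ i ∈ M.interiorVerts, ∑ _j ∈ M.neighbours i, m i ^ 2 ≤
      maxNeighbours d κ * m i ^ 2 := by
    intro i hi
    rw [Finset.sum_const, nsmul_eq_mul]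
    exact mul_le_mul_of_nonneg_right (card_neighbours_le hκ hd hΩ hdel hreg hi) (sq_nonneg _)
  have h1 : ∑ e ∈ M.faces, m e.1 ^ 2 ≤ maxNeighbours d κ * ∑ i ∈ M.interiorVerts, m i ^ 2 := by
    calc ∑ e ∈ M.faces, m e.1 ^ 2 ≤ ∑ e ∈ R, m e.1 ^ 2 := by
          refine Finset.sum_le_sum_of_subset_of_nonneg (fun e he => ?_) fun _ _ _ => sq_nonneg _
          have := mem_faces.1 he
          simp only [hR, Finset.mem_filter, Finset.mem_univ, true_and]
          exact ⟨this.1, this.2.2.2⟩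
      _ = ∑ i ∈ M.interiorVerts, ∑ _j ∈ M.neighbours i, m i ^ 2 :=
          Finset.sum_finset_product R M.interiorVerts M.neighbours (by simp [hR])
      _ ≤ _ := by
          rw [Finset.mul_sum]
          exact Finset.sum_le_sum hN
  have h2 : ∑ e ∈ M.faces, m e.2 ^ 2 ≤ maxNeighbours d κ * ∑ i ∈ M.interiorVerts, m i ^ 2 := by
    calc ∑ e ∈ M.faces, m e.2 ^ 2 ≤ ∑ e ∈ R', m e.2 ^ 2 := by
          refine Finset.sum_le_sum_of_subset_of_nonneg (fun e he => ?_) fun _ _ _ => sq_nonneg _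
          have := mem_faces.1 he
          simp only [hR', Finset.mem_filter, Finset.mem_univ, true_and]
          exact ⟨this.2.1, mem_neighbours_comm.1 this.2.2.2⟩
      _ = ∑ i ∈ M.interiorVerts, ∑ _j ∈ M.neighbours i, m i ^ 2 :=
          Finset.sum_finset_product_right R' M.interiorVerts M.neighbours (by simp [hR'])
      _ ≤ _ := by
          rw [Finset.mul_sum]
          exact Finset.sum_le_sum hN
  calc ∑ e ∈ M.faces, (m e.1 + m e.2) ^ 2 ≤ ∑ e ∈ M.faces, 2 * (m e.1 ^ 2 + m e.2 ^ 2) :=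
        Finset.sum_le_sum fun e _ => add_sq_le
    _ = 2 * (∑ e ∈ M.faces, m e.1 ^ 2 + ∑ e ∈ M.faces, m e.2 ^ 2) := by
        rw [← Finset.mul_sum, Finset.sum_add_distrib]
    _ ≤ _ := by linarith

/-! ### Comparability of the dual quantities with powers of the mesh size -/

theorem cellVol_le (hκ : 0 < κ) (hreg : M.IsRegular κ) {i : Fin M.N} (hi : i ∈ M.interiorVerts) :
    M.cellVol i ≤ κ * M.meshSize ^ d := by
  obtain ⟨T, hT, -, -, h⟩ := hreg.box i hi
  refine h.trans (mul_le_mul_of_nonneg_left ?_ hκ.le)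
  exact pow_le_pow_left₀ Metric.diam_nonneg (diam_le_meshSize hT) _

theorem meshSize_le_dij (hκ : 0 < κ) (hreg : M.IsRegular κ) {e : Fin M.N × Fin M.N}
    (he : e ∈ M.faces) : M.meshSize ≤ κ ^ 2 * M.dij e.1 e.2 := by
  obtain ⟨T, hT, -, ⟨h, -⟩, -⟩ := hreg.face e he
  rw [inv_mul_le_iff₀ hκ] at h
  calc M.meshSize ≤ κ * M.diam T := hreg.quasiUniform T hT
    _ ≤ κ * (κ * M.dij e.1 e.2) := mul_le_mul_of_nonneg_left h hκ.le
    _ = _ := by ring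

theorem dij_le (hκ : 0 < κ) (hreg : M.IsRegular κ) {e : Fin M.N × Fin M.N}
    (he : e ∈ M.faces) : M.dij e.1 e.2 ≤ κ * M.meshSize := by
  obtain ⟨T, hT, -, ⟨-, h⟩, -⟩ := hreg.face e he
  exact h.trans (mul_le_mul_of_nonneg_left (diam_le_meshSize hT) hκ.le)

theorem faceArea_le_of_mem_faces (hκ : 0 < κ) (hreg : M.IsRegular κ) {e : Fin M.N × Fin M.N}
    (he : e ∈ M.faces) : M.faceArea e.1 e.2 ≤ κ * M.meshSize ^ (d - 1) := by
  obtain ⟨T, hT, -, -, -, h⟩ := hreg.face e he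
  refine h.trans (mul_le_mul_of_nonneg_left ?_ hκ.le)
  exact pow_le_pow_left₀ Metric.diam_nonneg (diam_le_meshSize hT) _

theorem meshSize_nonneg (M : Triangulation d Ω) : 0 ≤ M.meshSize :=
  Real.iSup_nonneg fun _ => Metric.diam_nonneg

theorem pow_le_faceArea (hd : 1 ≤ d) (hκ : 0 < κ) (hreg : M.IsRegular κ) {e : Fin M.N × Fin M.N}
    (he : e ∈ M.faces) : M.meshSize ^ (d - 1) ≤ κ ^ d * M.faceArea e.1 e.2 := by
  obtain ⟨T, hT, -, -, h, -⟩ := hreg.face e he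
  rw [inv_mul_le_iff₀ hκ] at h
  calc M.meshSize ^ (d - 1) ≤ (κ * M.diam T) ^ (d - 1) :=
        pow_le_pow_left₀ M.meshSize_nonneg (hreg.quasiUniform T hT) _
    _ = κ ^ (d - 1) * M.diam T ^ (d - 1) := mul_pow _ _ _
    _ ≤ κ ^ (d - 1) * (κ * M.faceArea e.1 e.2) := by gcongr
    _ = _ := by rw [← mul_assoc, ← pow_succ, Nat.sub_add_cancel hd]

theorem meshSize_pos_of_vert (hd : 1 ≤ d) (i : Fin M.N) :
    0 < M.meshSize := by
  obtain ⟨T, hT, -⟩ := M.vert_used i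
  exact meshSize_pos hd hT

theorem diagCoeff_ge {ν : ℝ} (hν : 0 < ν) {i j : Fin M.N} (hj : j ∈ M.neighbours i) :
    ν * (M.faceArea i j / M.dij i j) ≤ M.diagCoeff ν i := by
  refine Finset.single_le_sum (f := fun j => ν * (M.faceArea i j / M.dij i j)) (fun k _ => ?_) hj
  exact mul_nonneg hν.le (div_nonneg ENNReal.toReal_nonneg dist_nonneg)

/-- `D_i⁻¹` is of order `h ^ (2 - d)`. Only a lower bound of `D_i` is needed, and the single term of
the face `e` supplies it. -/
theorem diagCoeff_bound {ν : ℝ} (hd : 1 ≤ d) (hκ : 0 < κ) (hν : 0 < ν) (hreg : M.IsRegular κ)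
    {e : Fin M.N × Fin M.N} (he : e ∈ M.faces) {i : Fin M.N} (hi : i = e.1 ∨ i = e.2) :
    0 < M.diagCoeff ν i ∧
      M.meshSize ^ (d - 1) * (M.diagCoeff ν i)⁻¹ ≤ κ ^ (d + 1) / ν * M.meshSize := by
  have hh := meshSize_pos_of_vert hd e.1
  have hf := mem_faces.1 he
  have hdp : 0 < M.dij e.1 e.2 := dij_pos hf.2.2.1.ne'
  have hge : ν * (M.faceArea e.1 e.2 / M.dij e.1 e.2) ≤ M.diagCoeff ν i := by
    rcases hi with rfl | rfl
    · exact diagCoeff_ge hν hf.2.2.2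
    · rw [faceArea_comm, dij_comm]
      exact diagCoeff_ge hν (mem_neighbours_comm.1 hf.2.2.2)
  have hF := pow_le_faceArea hd hκ hreg he
  have hFp : 0 < M.faceArea e.1 e.2 := by
    have : 0 < κ ^ d * M.faceArea e.1 e.2 := (by positivity : 0 < M.meshSize ^ (d - 1)).trans_le hF
    exact pos_of_mul_pos_right this (by positivity)
  have hDp : 0 < M.diagCoeff ν i := lt_of_lt_of_le (by positivity) hge
  refine ⟨hDp, ?_⟩
  rw [← div_eq_mul_inv, div_le_iff₀ hDp]
  have hdl := dij_le hκ hreg he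
  calc M.meshSize ^ (d - 1) ≤ κ ^ d * M.faceArea e.1 e.2 := hF
    _ = κ ^ d / ν * M.dij e.1 e.2 * (ν * (M.faceArea e.1 e.2 / M.dij e.1 e.2)) := by
        field_simp
    _ ≤ κ ^ d / ν * (κ * M.meshSize) * M.diagCoeff ν i := by gcongr
    _ = _ := by ring

/-! ### Edge derivatives, the star seminorm and summation over faces -/

theorem edgeDeriv_eq (hΩ : IsOpen Ω) (hdel : M.IsDelaunay) {q : Pt d → ℝ} (hq : M.IsP1 q)
    {i j : Fin M.N} (hi : i ∈ M.interiorVerts) (hj : j ∈ M.neighbours i) (x : Pt d) :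
    M.edgeDeriv q i j x = (M.lump q j - M.lump q i) / M.dij i j := by
  obtain ⟨T, hT, hiT, hjT⟩ := exists_elem_of_mem_neighbours hΩ hdel hi hj
  obtain ⟨A, hA⟩ := hq.2 T hT
  have hdp := dij_pos (mem_neighbours.1 hj).1
  set m := midpoint ℝ (M.vert i) (M.vert j) with hm
  have hmA : ∀ s : ℝ, A (m + s • M.normal i j) =
      A m + s * ((A (M.vert j) - A (M.vert i)) / M.dij i j) := by
    intro s
    have h1 := A.map_vadd m (s • M.normal i j)
    rw [vadd_eq_add, vadd_eq_add, add_comm] at h1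
    rw [h1, map_smul, normal, map_smul, ← vsub_eq_sub (M.vert j), A.linearMap_vsub, vsub_eq_sub,
      smul_eq_mul, smul_eq_mul]
    ring
  -- The line derivative at the midpoint sees only the interior of the edge, where the function
  -- agrees with the affine map of `T`.
  have hseg : ∀ᶠ s : ℝ in 𝓝 0, m + s • M.normal i j ∈ M.simplex T := by
    have : ∀ᶠ s : ℝ in 𝓝 0, |s| < M.dij i j / 2 := by
      have h0 : ∀ᶠ s : ℝ in 𝓝 0, s ∈ Metric.ball (0 : ℝ) (M.dij i j / 2) :=
        Metric.ball_mem_nhds _ (by positivity)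
      filter_upwards [h0] with s hs
      simpa using hs
    filter_upwards [this] with s hs
    rw [abs_lt] at hs
    have h1 := M.convex_simplex T (vert_mem_simplex hiT) (vert_mem_simplex hjT)
      (a := 1 / 2 - s / M.dij i j) (b := 1 / 2 + s / M.dij i j) ?_ ?_ (by ring)
    · convert h1 using 1
      rw [hm, midpoint_eq_smul_add, normal, smul_smul, ← div_eq_mul_inv]
      simp only [invOf_eq_inv]
      module
    · rw [sub_nonneg, div_le_iff₀ hdp]
      linarith
    · have : -(1 / 2) ≤ s / M.dij i j := by
        rw [le_div_iff₀ hdp]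
        linarith
      linarith
  rw [edgeDeriv, lineDeriv]
  have hev : (fun s : ℝ => q (m + s • M.normal i j)) =ᶠ[𝓝 0]
      fun s => A m + s * ((A (M.vert j) - A (M.vert i)) / M.dij i j) := by
    filter_upwards [hseg] with s hs
    rw [hA hs, hmA]
  rw [hev.deriv_eq, lump, lump, hA (vert_mem_simplex hiT), hA (vert_mem_simplex hjT)]
  simp

/-- The edge derivative is the jump divided by `d_ij`, so a face contributes `h_△ ^ 3 |F| / d_ij`
times the squared jump, which scales like `h ^ (d + 1)`. -/
theorem starSeminorm_ge (hd : 1 ≤ d) (hκ : 0 < κ) (hΩ : IsOpen Ω) (hdel : M.IsDelaunay)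
    (hreg : M.IsRegular κ) {τ : Fin M.N → Fin M.N → Finset (Fin M.N)} (hτ : M.IsLocalChoice τ)
    {q : Pt d → ℝ} (hq : M.IsP1 q) :
    M.meshSize ^ (d + 1) * ∑ e ∈ M.faces, (M.lump q e.1 - M.lump q e.2) ^ 2 ≤
      κ ^ (d + 4) * M.starSeminorm τ q ^ 2 := by
  have hnn : ∀ e ∈ M.faces, M.meshSize ^ (d + 1) * (M.lump q e.1 - M.lump q e.2) ^ 2 ≤
      κ ^ (d + 4) * (M.diam (τ e.1 e.2) ^ 3 * M.dij e.1 e.2 *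
        ∫ x in M.face e.1 e.2, |M.edgeDeriv q e.1 e.2 x| ^ 2 ∂μHE[d - 1]) := by
    intro e he
    have hf := mem_faces.1 he
    have hdp : 0 < M.dij e.1 e.2 := dij_pos hf.2.2.1.ne'
    simp_rw [edgeDeriv_eq hΩ hdel hq hf.1 hf.2.2.2]
    rw [integral_const, Measure.real, Measure.restrict_apply_univ, smul_eq_mul, sq_abs]
    change _ ≤ κ ^ (d + 4) * (M.diam (τ e.1 e.2) ^ 3 * M.dij e.1 e.2 * (M.faceArea e.1 e.2 *
      ((M.lump q e.2 - M.lump q e.1) / M.dij e.1 e.2) ^ 2))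
    have h1 : M.meshSize ^ 3 ≤ κ ^ 3 * M.diam (τ e.1 e.2) ^ 3 := by
      rw [← mul_pow]
      exact pow_le_pow_left₀ M.meshSize_nonneg (hreg.quasiUniform _ (hτ e he).1) _
    have h2 := pow_le_faceArea hd hκ hreg he
    have h3 : M.dij e.1 e.2 ≤ κ * M.meshSize := dij_le hκ hreg he
    have hh := meshSize_pos_of_vert hd e.1
    have h4 : 1 ≤ κ * M.meshSize / M.dij e.1 e.2 := by rwa [one_le_div hdp]
    have hF : 0 ≤ M.faceArea e.1 e.2 := ENNReal.toReal_nonneg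
    have hD : 0 ≤ M.diam (τ e.1 e.2) := Metric.diam_nonneg
    have hpow : M.meshSize ^ (d + 1) * M.meshSize = M.meshSize ^ 3 * M.meshSize ^ (d - 1) := by
      rw [← pow_succ, ← pow_add]
      congr 1
      omega
    have h5 : M.meshSize ^ (d + 1) ≤ κ ^ (d + 4) * M.diam (τ e.1 e.2) ^ 3 *
        (M.faceArea e.1 e.2 / M.dij e.1 e.2) := by
      refine le_of_mul_le_mul_right ?_ hh
      calc M.meshSize ^ (d + 1) * M.meshSize = M.meshSize ^ 3 * M.meshSize ^ (d - 1) := hpow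
        _ ≤ (κ ^ 3 * M.diam (τ e.1 e.2) ^ 3) * (κ ^ d * M.faceArea e.1 e.2) := by gcongr
        _ ≤ (κ ^ 3 * M.diam (τ e.1 e.2) ^ 3) * (κ ^ d * M.faceArea e.1 e.2) *
            (κ * M.meshSize / M.dij e.1 e.2) :=
            le_mul_of_one_le_right (by positivity) h4
        _ = _ := by ring
    calc _ ≤ κ ^ (d + 4) * M.diam (τ e.1 e.2) ^ 3 *
        (M.faceArea e.1 e.2 / M.dij e.1 e.2) * (M.lump q e.1 - M.lump q e.2) ^ 2 :=
          mul_le_mul_of_nonneg_right h5 (sq_nonneg _)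
      _ = _ := by
          field_simp
          ring
  rw [starSeminorm, Real.sq_sqrt, Finset.mul_sum, Finset.mul_sum]
  · exact Finset.sum_le_sum hnn
  · exact Finset.sum_nonneg fun e _ => mul_nonneg
      (mul_nonneg (pow_nonneg Metric.diam_nonneg _) dist_nonneg)
      (integral_nonneg fun _ => by positivity)

/-- Summation of bounds on the single faces. -/
theorem abs_sum_faces_le (hd : 1 ≤ d) (hκ : 0 < κ) (hΩ : IsOpen Ω) (hdel : M.IsDelaunay)
    (hreg : M.IsRegular κ) {τ : Fin M.N → Fin M.N → Finset (Fin M.N)} (hτ : M.IsLocalChoice τ)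
    {q : Pt d → ℝ} (hq : M.IsP1 q) {A : ℝ} (hA : 0 ≤ A) {k : ℕ}
    {s : Fin M.N × Fin M.N → ℝ} {m : Fin M.N → ℝ} {Q : ℝ} (hQ : 0 ≤ Q)
    (hs : ∀ e ∈ M.faces, |s e| ≤ A * M.meshSize ^ k * √(M.meshSize ^ d) *
      (m e.1 + m e.2) * |M.lump q e.1 - M.lump q e.2|)
    (hm : ∑ i ∈ M.interiorVerts, m i ^ 2 ≤ Q ^ 2) :
    |∑ e ∈ M.faces, s e| ≤ A * √(4 * maxNeighbours d κ * κ ^ (d + 4)) *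
      M.meshSize ^ ((k : ℝ) - 1 / 2) * Q * M.starSeminorm τ q := by
  have hstar0 : 0 ≤ M.starSeminorm τ q := Real.sqrt_nonneg _
  have hN : 0 ≤ maxNeighbours d κ := by
    unfold maxNeighbours
    positivity
  rcases M.faces.eq_empty_or_nonempty with h0 | ⟨e₀, he₀⟩
  · rw [h0, Finset.sum_empty, abs_zero]
    have := Real.rpow_nonneg M.meshSize_nonneg ((k : ℝ) - 1 / 2)
    positivity
  have hh := meshSize_pos_of_vert hd e₀.1
  set h := M.meshSize with hhdef
  set Z := ∑ e ∈ M.faces, (M.lump q e.1 - M.lump q e.2) ^ 2 with hZ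
  have hZ0 : 0 ≤ Z := Finset.sum_nonneg fun _ _ => sq_nonneg _
  have h1 : |∑ e ∈ M.faces, s e| ≤ A * h ^ k * √(h ^ d) *
      ∑ e ∈ M.faces, (m e.1 + m e.2) * |M.lump q e.1 - M.lump q e.2| := by
    rw [Finset.mul_sum]
    refine (Finset.abs_sum_le_sum_abs _ _).trans (Finset.sum_le_sum fun e he => ?_)
    rw [← mul_assoc]
    exact hs e he
  have h2 : ∑ e ∈ M.faces, (m e.1 + m e.2) * |M.lump q e.1 - M.lump q e.2| ≤
      √(4 * maxNeighbours d κ * Q ^ 2) * √Z := by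
    refine (Real.sum_mul_le_sqrt_mul_sqrt _ _ _).trans ?_
    simp only [sq_abs]
    gcongr
    exact (sum_faces_le hκ hd hΩ hdel hreg m).trans
      (mul_le_mul_of_nonneg_left hm (by positivity))
  have h3 : √(h ^ (d + 1)) * √Z ≤ √(κ ^ (d + 4)) * M.starSeminorm τ q := by
    rw [← Real.sqrt_mul (by positivity)]
    refine (Real.sqrt_le_sqrt (starSeminorm_ge hd hκ hΩ hdel hreg hτ hq)).trans (le_of_eq ?_)
    rw [Real.sqrt_mul (by positivity), Real.sqrt_sq hstar0]
  -- The face terms carry `h ^ (d / 2)`, whereas the star seminorm absorbs `h ^ ((d + 1) / 2)`: half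
  -- a power of `h` is lost.
  have h4 : h ^ k * √(h ^ d) = h ^ ((k : ℝ) - 1 / 2) * √(h ^ (d + 1)) := by
    rw [pow_succ, Real.sqrt_mul (by positivity), Real.rpow_sub hh, Real.rpow_natCast,
      ← Real.sqrt_eq_rpow]
    have : √h ≠ 0 := (Real.sqrt_pos.2 hh).ne'
    field_simp
  calc |∑ e ∈ M.faces, s e|
      ≤ A * h ^ k * √(h ^ d) * (√(4 * maxNeighbours d κ * Q ^ 2) * √Z) := by
        refine h1.trans (mul_le_mul_of_nonneg_left h2 (by positivity))
    _ = A * √(4 * maxNeighbours d κ) * Q * h ^ ((k : ℝ) - 1 / 2) * (√(h ^ (d + 1)) * √Z) := by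
        rw [Real.sqrt_mul (by positivity) (Q ^ 2), Real.sqrt_sq hQ, mul_assoc A, h4]
        ring
    _ ≤ A * √(4 * maxNeighbours d κ) * Q * h ^ ((k : ℝ) - 1 / 2) *
        (√(κ ^ (d + 4)) * M.starSeminorm τ q) := by gcongr
    _ = _ := by
        rw [Real.sqrt_mul (by positivity) (κ ^ (d + 4))]
        ring

end Triangulation

/-! ### Sums of integrals over almost disjoint sets, and Cauchy-Schwarz -/

theorem sum_setIntegral_le {α ι : Type*} {m : MeasurableSpace α} {μ : Measure α} {s : Finset ι}
    {S : ι → Set α} {U : Set α} (hS : ∀ i ∈ s, MeasurableSet (S i))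
    (hdisj : Set.Pairwise (↑s) (Function.onFun (AEDisjoint μ) S)) (hSU : ∀ i ∈ s, S i ⊆ U)
    {f : α → ℝ} (hf0 : ∀ x, 0 ≤ f x) (hf : IntegrableOn f U μ) :
    ∑ i ∈ s, ∫ x in S i, f x ∂μ ≤ ∫ x in U, f x ∂μ := by
  have hconv : ∀ A : Set α, A ⊆ U →
      ∫ x in A, f x ∂μ = (∫⁻ x in A, ENNReal.ofReal (f x) ∂μ).toReal := fun A hA =>
    integral_eq_lintegral_of_nonneg_ae (ae_of_all _ hf0) (hf.mono_set hA).aestronglyMeasurable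
  have hfin : ∀ A : Set α, A ⊆ U → ∫⁻ x in A, ENNReal.ofReal (f x) ∂μ ≠ ⊤ := fun A hA =>
    (hf.mono_set hA).lintegral_lt_top.ne
  rw [Finset.sum_congr rfl fun i hi => hconv (S i) (hSU i hi), hconv U subset_rfl,
    ← ENNReal.toReal_sum fun i hi => hfin (S i) (hSU i hi)]
  refine ENNReal.toReal_mono (hfin U subset_rfl) ?_
  rw [← lintegral_biUnion_finset₀ hdisj fun i hi => (hS i hi).nullMeasurableSet]
  exact lintegral_mono_set (Set.iUnion₂_subset hSU)

theorem sq_integral_norm_le {α G : Type*} {m : MeasurableSpace α} [NormedAddCommGroup G]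
    {μ : Measure α} [IsFiniteMeasure μ] {f : α → G}
    (hf : Integrable f μ) (hf2 : Integrable (fun x => ‖f x‖ ^ 2) μ) :
    (∫ x, ‖f x‖ ∂μ) ^ 2 ≤ μ.real Set.univ * ∫ x, ‖f x‖ ^ 2 ∂μ := by
  set V := μ.real Set.univ with hV
  set I := ∫ x, ‖f x‖ ∂μ with hI
  have hV0 : 0 ≤ V := measureReal_nonneg
  -- Expanding gives `V` times the difference of the two sides, so the case `V = 0` is treated
  -- separately.
  have h : 0 ≤ ∫ x, (V * ‖f x‖ - I) ^ 2 ∂μ := integral_nonneg fun _ => sq_nonneg _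
  have e : ∀ x, (V * ‖f x‖ - I) ^ 2 = V ^ 2 * ‖f x‖ ^ 2 - 2 * V * I * ‖f x‖ + I ^ 2 := by
    intro x
    ring
  simp_rw [e] at h
  have hi1 : Integrable (fun x => V ^ 2 * ‖f x‖ ^ 2) μ := hf2.const_mul _
  have hi2 : Integrable (fun x => 2 * V * I * ‖f x‖) μ := hf.norm.const_mul _
  rw [integral_add (f := fun x => V ^ 2 * ‖f x‖ ^ 2 - 2 * V * I * ‖f x‖) (hi1.sub hi2)
    (integrable_const _), integral_sub hi1 hi2, integral_const_mul, integral_const_mul,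
    integral_const, smul_eq_mul, ← hI, ← hV] at h
  rcases hV0.eq_or_lt with h0 | h0
  · have hμ : μ = 0 := by
      rw [← Measure.measure_univ_eq_zero]
      exact (measureReal_eq_zero_iff).1 h0.symm
    rw [hI, hμ]
    simp
  · nlinarith

namespace Triangulation

variable {d : ℕ} {Ω : Set (Pt d)} {M : Triangulation d Ω} {κ : ℝ}

/-! ### Measure theory of the meshes -/

theorem volume_frontier_simplex (T : Finset (Fin M.N)) : volume (frontier (M.simplex T)) = 0 :=
  (M.convex_simplex T).addHaar_frontier volume

theorem volume_cell_inter {i j : Fin M.N} (hij : i ≠ j) :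
    volume (M.cell i ∩ M.cell j) = 0 := by
  refine measure_mono_null ?_ (volume_hyperplane (vert_sub_ne_zero hij.symm)
    (M.vert i + (1 / 2 : ℝ) • (M.vert j - M.vert i)))
  intro x hx
  rw [Set.mem_ofPred_eq, ← sub_sub, inner_sub_left, (mem_face_iff.1 hx).2, real_inner_smul_left,
    real_inner_self_eq_norm_sq]
  ring

theorem interior_simplex_subset (hΩ : interior (closure Ω) = Ω) {T : Finset (Fin M.N)}
    (hT : T ∈ M.elems) : interior (M.simplex T) ⊆ Ω :=
  (interior_mono (simplex_subset hT)).trans hΩ.subset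

/-- Points of the closure outside `Ω` lie on the frontier of an element, and frontiers of convex
sets are null. -/
theorem closure_ae_eq (M : Triangulation d Ω) (hΩ : interior (closure Ω) = Ω) :
    (closure Ω : Set (Pt d)) =ᵐ[volume] Ω := by
  refine ae_eq_set.2 ⟨?_, by rw [Set.sdiff_eq_empty.2 subset_closure, measure_empty]⟩
  refine measure_mono_null (t := ⋃ T ∈ M.elems, frontier (M.simplex T)) ?_ ?_
  · rintro x ⟨hx, hxΩ⟩
    obtain ⟨T, hT, hxT⟩ := exists_mem_simplex (M := M) hx
    exact Set.mem_biUnion hT ⟨subset_closure hxT, fun h => hxΩ (interior_simplex_subset hΩ hT h)⟩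
  · exact (measure_biUnion_null_iff M.elems.countable_toSet).2 fun T _ =>
      volume_frontier_simplex T

theorem integrableOn_closure_iff {G : Type*} [NormedAddCommGroup G] {f : Pt d → G} :
    IntegrableOn f (closure Ω) ↔ ∀ T ∈ M.elems, IntegrableOn f (M.simplex T) := by
  rw [← M.cover, integrableOn_finset_iUnion]
  rfl

theorem sum_simplex_le {f : Pt d → ℝ} (hf0 : ∀ x, 0 ≤ f x) (hf : IntegrableOn f (closure Ω)) :
    ∑ T ∈ M.elems, ∫ x in M.simplex T, f x ≤ ∫ x in closure Ω, f x :=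
  sum_setIntegral_le (fun T _ => (M.isCompact_simplex T).measurableSet)
    (fun _ hS _ hT hST => volume_simplex_inter hS hT hST) (fun _ hT => simplex_subset hT) hf0 hf

theorem sum_cell_le (hbox : M.BoxesInside) {f : Pt d → ℝ} (hf0 : ∀ x, 0 ≤ f x)
    (hf : IntegrableOn f (closure Ω)) :
    ∑ i ∈ M.interiorVerts, ∫ x in M.cell i, f x ≤ ∫ x in closure Ω, f x :=
  sum_setIntegral_le (fun i _ => (isClosed_cell i).measurableSet)
    (fun _ _ _ _ hij => volume_cell_inter hij) (fun i hi => hbox i hi) hf0 hf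

theorem closure_le_sum_simplex {f : Pt d → ℝ} (hf0 : ∀ x, 0 ≤ f x)
    (hf : IntegrableOn f (closure Ω)) :
    ∫ x in closure Ω, f x ≤ ∑ T ∈ M.elems, ∫ x in M.simplex T, f x := by
  have hfT := (integrableOn_closure_iff (M := M)).1 hf
  have hnn : ∀ (A : Set (Pt d)), ∫ x in A, f x = (∫⁻ x in A, ENNReal.ofReal (f x)).toReal ∨
      ¬ IntegrableOn f A := by
    intro A
    by_cases hA : IntegrableOn f A
    · exact Or.inl (integral_eq_lintegral_of_nonneg_ae (ae_of_all _ hf0) hA.aestronglyMeasurable)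
    · exact Or.inr hA
  rw [(hnn _).resolve_right (not_not.2 hf), Finset.sum_congr rfl fun T hT =>
    (hnn (M.simplex T)).resolve_right (not_not.2 (hfT T hT)),
    ← ENNReal.toReal_sum fun T hT => (hfT T hT).lintegral_lt_top.ne]
  refine ENNReal.toReal_mono (ENNReal.sum_lt_top.2 fun T hT => (hfT T hT).lintegral_lt_top).ne ?_
  rw [← lintegral_biUnion_finset₀ (fun _ hS _ hT hST => volume_simplex_inter hS hT hST)
    fun T _ => (M.isCompact_simplex T).measurableSet.nullMeasurableSet, ← M.cover]
  rfl

/-! ### Discrete functions -/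

theorem exists_gradient {p : Pt d → ℝ} (hp : M.IsP1 p) {T : Finset (Fin M.N)}
    (hT : T ∈ M.elems) : ∃ b : Pt d, (∀ x ∈ interior (M.simplex T), gradient p x = b) ∧
      ∀ i ∈ T, ∀ j ∈ T, M.lump p j - M.lump p i = ⟪b, M.vert j - M.vert i⟫ := by
  obtain ⟨A, hA⟩ := hp.2 T hT
  set l : Pt d →L[ℝ] ℝ := LinearMap.toContinuousLinearMap A.linear with hl
  set b : Pt d := (InnerProductSpace.toDual ℝ (Pt d)).symm l with hb
  have hbl : ∀ w, ⟪b, w⟫ = A.linear w := by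
    intro w
    rw [hb, InnerProductSpace.toDual_symm_apply]
    rfl
  refine ⟨b, fun x hx => ?_, fun i hi j hj => ?_⟩
  · have hAd : HasFDerivAt A l x := by
      have h1 : (A : Pt d → ℝ) = fun y => l y + A 0 := by
        ext y
        have := congrFun A.decomp y
        rw [Pi.add_apply] at this
        exact this
      rw [h1]
      exact l.hasFDerivAt.add_const _
    have hpd : HasFDerivAt p l x := by
      refine hAd.congr_of_eventuallyEq ?_
      filter_upwards [mem_interior_iff_mem_nhds.1 hx] with y hy
      exact hA hy
    refine HasGradientAt.gradient ?_
    rw [hasGradientAt_iff_hasFDerivAt, hb, LinearIsometryEquiv.apply_symm_apply]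
    exact hpd
  · rw [lump, lump, hA (vert_mem_simplex hi), hA (vert_mem_simplex hj), hbl, ← vsub_eq_sub,
      ← vsub_eq_sub, A.linearMap_vsub]

/-- The default value 0 of `gradient` at points without a derivative does not matter, since such
points of `T` can only be on its null frontier. -/
theorem gradient_ae_eq {p : Pt d → ℝ} {T : Finset (Fin M.N)} {b : Pt d}
    (hb : ∀ x ∈ interior (M.simplex T), gradient p x = b) :
    gradient p =ᵐ[volume.restrict (M.simplex T)] fun _ => b := by
  rw [← Measure.restrict_congr_set (interior_ae_eq_of_null_frontier (volume_frontier_simplex T))]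
  exact (ae_restrict_iff' isOpen_interior.measurableSet).2 (ae_of_all _ hb)

theorem integrableOn_gradient {p : Pt d → ℝ} (hp : M.IsP1 p) :
    IntegrableOn (gradient p) (closure Ω) := by
  rw [integrableOn_closure_iff (M := M)]
  intro T hT
  obtain ⟨b, hb, -⟩ := exists_gradient hp hT
  exact (integrableOn_const (M.isCompact_simplex T).measure_lt_top.ne).congr
    (gradient_ae_eq hb).symm

theorem integrableOn_sq_norm_gradient {p : Pt d → ℝ} (hp : M.IsP1 p) :
    IntegrableOn (fun x => ‖gradient p x‖ ^ 2) (closure Ω) := by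
  rw [integrableOn_closure_iff (M := M)]
  intro T hT
  obtain ⟨b, hb, -⟩ := exists_gradient hp hT
  refine (integrableOn_const (C := ‖b‖ ^ 2)
    (M.isCompact_simplex T).measure_lt_top.ne).congr ?_
  filter_upwards [gradient_ae_eq hb] with x hx
  rw [hx]

/-- The energy of `p` in the box `B_i` and the elements with vertex `p_i`. -/
def localEnergy (M : Triangulation d Ω) (p : Pt d → ℝ) (i : Fin M.N) : ℝ :=
  (∫ x in M.cell i, ‖gradient p x‖ ^ 2) +
    ∑ T ∈ M.elemsAt i, ∫ x in M.simplex T, ‖gradient p x‖ ^ 2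

theorem setIntegral_simplex_nonneg (p : Pt d → ℝ) (A : Set (Pt d)) :
    0 ≤ ∫ x in A, ‖gradient p x‖ ^ 2 := integral_nonneg fun _ => sq_nonneg _

theorem localEnergy_nonneg (p : Pt d → ℝ) (i : Fin M.N) : 0 ≤ M.localEnergy p i :=
  add_nonneg (setIntegral_simplex_nonneg _ _)
    (Finset.sum_nonneg fun _ _ => setIntegral_simplex_nonneg _ _)

/-- The boxes cover almost every point at most once, and each element is counted at most once for
each of its `d + 1` vertices. -/
theorem sum_localEnergy_le (hΩ : interior (closure Ω) = Ω) (hbox : M.BoxesInside)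
    {p : Pt d → ℝ} (hp : M.IsP1 p) :
    ∑ i ∈ M.interiorVerts, M.localEnergy p i ≤ (d + 2) * h1Seminorm Ω p ^ 2 := by
  classical
  have hint := integrableOn_sq_norm_gradient hp
  set f : Pt d → ℝ := fun x => ‖gradient p x‖ ^ 2 with hf
  have hf0 : ∀ x, 0 ≤ f x := fun _ => sq_nonneg _
  have h1 : h1Seminorm Ω p ^ 2 = ∫ x in closure Ω, f x := by
    rw [h1Seminorm, Real.sq_sqrt (setIntegral_simplex_nonneg _ _),
      Measure.restrict_congr_set (M.closure_ae_eq hΩ)]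
  have h2 : ∑ i ∈ M.interiorVerts, ∑ T ∈ M.elemsAt i, ∫ x in M.simplex T, f x ≤
      (d + 1) * ∫ x in closure Ω, f x := by
    calc ∑ i ∈ M.interiorVerts, ∑ T ∈ M.elemsAt i, ∫ x in M.simplex T, f x
        ≤ ∑ i, ∑ T ∈ M.elemsAt i, ∫ x in M.simplex T, f x :=
          Finset.sum_le_sum_of_subset_of_nonneg (Finset.subset_univ _) fun _ _ _ =>
            Finset.sum_nonneg fun _ _ => setIntegral_simplex_nonneg _ _
      _ = ∑ T ∈ M.elems, ∑ _i ∈ T, ∫ x in M.simplex T, f x := by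
          refine Finset.sum_comm' fun i T => ?_
          simp [mem_elemsAt, and_comm]
      _ = ∑ T ∈ M.elems, (d + 1) * ∫ x in M.simplex T, f x := by
          refine Finset.sum_congr rfl fun T hT => ?_
          rw [Finset.sum_const, M.card_elem T hT, nsmul_eq_mul]
          push_cast
          rfl
      _ ≤ _ := by
          rw [← Finset.mul_sum]
          exact mul_le_mul_of_nonneg_left (sum_simplex_le hf0 hint) (by positivity)
  have h3 := sum_cell_le hbox hf0 hint
  simp only [localEnergy, Finset.sum_add_distrib]
  rw [h1]
  linarith

/-- The two vertices share an element, on which the gradient is a constant `b`. The difference is at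
most `‖b‖ h`, and the energy on the element is `‖b‖²` times a volume of order `h ^ d`. -/
theorem abs_lump_sub_le (hκ : 0 < κ) (hd : 1 ≤ d) (hΩ : IsOpen Ω) (hdel : M.IsDelaunay)
    (hreg : M.IsRegular κ) {p : Pt d → ℝ} (hp : M.IsP1 p) {i j : Fin M.N}
    (hi : i ∈ M.interiorVerts) (hj : j ∈ M.neighbours i) :
    √(M.meshSize ^ d) * |M.lump p j - M.lump p i| ≤
      √((κ ^ 2) ^ d / ballVol d) * M.meshSize * √(M.localEnergy p i) := by
  obtain ⟨T, hT, hiT, hjT⟩ := exists_elem_of_mem_neighbours hΩ hdel hi hj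
  obtain ⟨b, hb, hbd⟩ := exists_gradient hp hT
  have hh := M.meshSize_nonneg
  have hB := ballVol_pos d
  have h1 : |M.lump p j - M.lump p i| ≤ ‖b‖ * M.meshSize := by
    rw [hbd i hiT j hjT]
    refine (abs_real_inner_le_norm _ _).trans (mul_le_mul_of_nonneg_left ?_ (norm_nonneg _))
    rw [← dij_eq_norm]
    exact dij_le_meshSize hΩ hdel hi hj
  have h2 : volume.real (M.simplex T) * ‖b‖ ^ 2 ≤ M.localEnergy p i := by
    have e : ∫ x in M.simplex T, ‖gradient p x‖ ^ 2 = volume.real (M.simplex T) * ‖b‖ ^ 2 := by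
      rw [integral_congr_ae (g := fun _ => ‖b‖ ^ 2), integral_const, Measure.real,
        Measure.restrict_apply_univ, smul_eq_mul]
      · rfl
      · filter_upwards [gradient_ae_eq hb] with x hx
        rw [hx]
    rw [← e]
    refine le_trans ?_ (le_add_of_nonneg_left (setIntegral_simplex_nonneg _ _))
    exact Finset.single_le_sum (f := fun T => ∫ x in M.simplex T, ‖gradient p x‖ ^ 2)
      (fun _ _ => setIntegral_simplex_nonneg _ _) (mem_elemsAt.2 ⟨hT, hiT⟩)
  have h3 : M.meshSize ^ d * ‖b‖ ^ 2 ≤ (κ ^ 2) ^ d / ballVol d * M.localEnergy p i := by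
    have h4 := mul_le_mul_of_nonneg_right (le_volume_simplex hκ hd hreg hT) (sq_nonneg ‖b‖)
    calc M.meshSize ^ d * ‖b‖ ^ 2 = (κ ^ 2) ^ d / ballVol d *
        (M.meshSize ^ d * (ballVol d / (κ ^ 2) ^ d) * ‖b‖ ^ 2) := by field_simp
      _ ≤ _ := by
        gcongr
        exact h4.trans h2
  have h5 : √(M.meshSize ^ d) * ‖b‖ ≤ √((κ ^ 2) ^ d / ballVol d) * √(M.localEnergy p i) := by
    rw [← Real.sqrt_mul (by positivity)]
    refine Real.le_sqrt_of_sq_le ?_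
    rw [mul_pow, Real.sq_sqrt (by positivity)]
    exact h3
  calc √(M.meshSize ^ d) * |M.lump p j - M.lump p i|
      ≤ √(M.meshSize ^ d) * (‖b‖ * M.meshSize) := by gcongr
    _ = √(M.meshSize ^ d) * ‖b‖ * M.meshSize := by ring
    _ ≤ √((κ ^ 2) ^ d / ballVol d) * √(M.localEnergy p i) * M.meshSize := by gcongr
    _ = _ := by ring

theorem norm_integral_gradient_le (hκ : 0 < κ) (hbox : M.BoxesInside)
    (hreg : M.IsRegular κ) {p : Pt d → ℝ} (hp : M.IsP1 p) {i : Fin M.N}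
    (hi : i ∈ M.interiorVerts) :
    ‖∫ x in M.cell i, gradient p x‖ ≤ √κ * √(M.meshSize ^ d) * √(M.localEnergy p i) := by
  have : IsFiniteMeasure (volume.restrict (M.cell i)) :=
    ⟨by simpa using (isCompact_cell hbox hi).measure_lt_top⟩
  have hh := M.meshSize_nonneg
  have h1 := sq_integral_norm_le ((integrableOn_gradient hp).mono_set (hbox i hi))
    ((integrableOn_sq_norm_gradient hp).mono_set (hbox i hi))
  rw [measureReal_restrict_apply_univ] at h1
  refine (norm_integral_le_integral_norm _).trans ?_
  rw [← Real.sqrt_mul hκ.le, ← Real.sqrt_mul (by positivity)]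
  refine Real.le_sqrt_of_sq_le (h1.trans ?_)
  refine mul_le_mul (cellVol_le hκ hreg hi) ?_ (setIntegral_simplex_nonneg _ _) (by positivity)
  exact le_add_of_nonneg_right (Finset.sum_nonneg fun _ _ => setIntegral_simplex_nonneg _ _)

/-! ### The Gauss-Green gradient and the forms of discrete functions -/

theorem norm_normal_le (i j : Fin M.N) : ‖M.normal i j‖ ≤ 1 := by
  rw [normal, norm_smul, norm_inv, dij_eq_norm, norm_norm]
  exact inv_mul_le_one

/-- Since the weighted normals add up to zero, the constant `p(p_i)` may be subtracted from all face
values, which leaves half-differences along edges. -/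
theorem cellVol_smul_gaussGreen (hd : 1 ≤ d) (hbox : M.BoxesInside) {i : Fin M.N}
    (hi : i ∈ M.interiorVerts) (p : Pt d → ℝ) :
    M.cellVol i • M.gaussGreen p i = ∑ j ∈ M.neighbours i,
      (M.faceArea i j * ((M.lump p j - M.lump p i) / 2)) • M.normal i j := by
  rw [gaussGreen, smul_smul, mul_inv_cancel₀ (cellVol_pos hbox hi).ne', one_smul,
    ← sub_eq_zero, ← Finset.sum_sub_distrib]
  have h1 : ∀ j ∈ M.neighbours i,
      (M.faceArea i j * (M.weight i j * M.lump p i + (1 - M.weight i j) * M.lump p j)) •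
      M.normal i j - (M.faceArea i j * ((M.lump p j - M.lump p i) / 2)) • M.normal i j =
      M.lump p i • (M.faceArea i j • M.normal i j) := by
    intro j hj
    rw [weight_eq (mem_neighbours.1 hj).1, ← sub_smul, smul_smul]
    congr 1
    ring
  rw [Finset.sum_congr rfl h1, ← Finset.smul_sum, sum_faceArea_smul_normal hd hbox hi, smul_zero]

theorem norm_gaussGreen_le (hκ : 0 < κ) (hd : 1 ≤ d) (hΩ : IsOpen Ω) (hdel : M.IsDelaunay)
    (hbox : M.BoxesInside) (hreg : M.IsRegular κ) {p : Pt d → ℝ} (hp : M.IsP1 p) {i : Fin M.N}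
    (hi : i ∈ M.interiorVerts) :
    ‖M.cellVol i • M.gaussGreen p i‖ ≤
      (maxNeighbours d κ * (ballVol d / (coneFactor d).toReal) *
        √((κ ^ 2) ^ d / ballVol d)) * √(M.meshSize ^ d) * √(M.localEnergy p i) := by
  have hh := meshSize_pos_of_vert hd i
  have hcf : 0 < (coneFactor d).toReal :=
    ENNReal.toReal_pos (coneFactor_ne_zero d) (coneFactor_ne_top d)
  have hB := ballVol_pos d
  rw [cellVol_smul_gaussGreen hd hbox hi]
  set c := √((κ ^ 2) ^ d / ballVol d) with hc
  set cF := ballVol d / (coneFactor d).toReal with hcF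
  have hterm : ∀ j ∈ M.neighbours i,
      ‖(M.faceArea i j * ((M.lump p j - M.lump p i) / 2)) • M.normal i j‖ ≤
      cF * c * √(M.meshSize ^ d) * √(M.localEnergy p i) := by
    intro j hj
    have h1 := abs_lump_sub_le hκ hd hΩ hdel hreg hp hi hj
    have h2 := faceArea_le hd hΩ hdel hbox hi hj
    have hF : 0 ≤ M.faceArea i j := ENNReal.toReal_nonneg
    rw [norm_smul, Real.norm_eq_abs, abs_mul, abs_of_nonneg hF, abs_div, abs_two]
    have hpow : M.meshSize ^ (d - 1) * M.meshSize = √(M.meshSize ^ d) * √(M.meshSize ^ d) := by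
      rw [← pow_succ, Nat.sub_add_cancel hd, Real.mul_self_sqrt (by positivity)]
    have hs : 0 < √(M.meshSize ^ d) := Real.sqrt_pos.2 (by positivity)
    refine le_of_mul_le_mul_left ?_ hs
    calc √(M.meshSize ^ d) * (M.faceArea i j * (|M.lump p j - M.lump p i| / 2) * ‖M.normal i j‖)
        ≤ √(M.meshSize ^ d) * (M.faceArea i j * |M.lump p j - M.lump p i| * 1) := by
          gcongr
          · exact half_le_self (abs_nonneg _)
          · exact norm_normal_le i j
      _ = M.faceArea i j * (√(M.meshSize ^ d) * |M.lump p j - M.lump p i|) := by ring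
      _ ≤ (cF * M.meshSize ^ (d - 1)) * (c * M.meshSize * √(M.localEnergy p i)) := by
          gcongr
      _ = cF * c * (M.meshSize ^ (d - 1) * M.meshSize) * √(M.localEnergy p i) := by ring
      _ = _ := by
          rw [hpow]
          ring
  refine (norm_sum_le_of_le _ hterm).trans ?_
  rw [Finset.sum_const, nsmul_eq_mul]
  calc ((M.neighbours i).card : ℝ) * (cF * c * √(M.meshSize ^ d) * √(M.localEnergy p i))
      ≤ maxNeighbours d κ * (cF * c * √(M.meshSize ^ d) * √(M.localEnergy p i)) := by
        gcongr
        exact card_neighbours_le hκ hd hΩ hdel hreg hi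
    _ = _ := by ring

/-- The contribution of one face to the Rhie-Chow forms of a discrete function. -/
theorem abs_faceTerm_le {ν : ℝ} (hν : 0 < ν) (hκ : 0 < κ) (hd : 1 ≤ d) (hΩ : IsOpen Ω)
    (hdel : M.IsDelaunay) (hreg : M.IsRegular κ) {p : Pt d → ℝ} (hp : M.IsP1 p)
    {G : Fin M.N → Pt d} {c : ℝ}
    (hG : ∀ i ∈ M.interiorVerts, ‖G i‖ ≤ c * √(M.meshSize ^ d) * √(M.localEnergy p i))
    {e : Fin M.N × Fin M.N} (he : e ∈ M.faces) (z : ℝ) :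
    |M.faceArea e.1 e.2 * (⟪(M.weight e.1 e.2 * (M.diagCoeff ν e.1)⁻¹) • G e.1
        + ((1 - M.weight e.1 e.2) * (M.diagCoeff ν e.2)⁻¹) • G e.2, M.normal e.1 e.2⟫ * z)
      - M.faceArea e.1 e.2 * ((M.weight e.1 e.2 * M.cellVol e.1 * (M.diagCoeff ν e.1)⁻¹
        + (1 - M.weight e.1 e.2) * M.cellVol e.2 * (M.diagCoeff ν e.2)⁻¹)
        * ((M.lump p e.2 - M.lump p e.1) / M.dij e.1 e.2) * z)| ≤
      (κ ^ (d + 2) / ν * (c + κ ^ 3 * √((κ ^ 2) ^ d / ballVol d))) * M.meshSize ^ 1 *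
        √(M.meshSize ^ d) * (√(M.localEnergy p e.1) + √(M.localEnergy p e.2)) * |z| := by
  have hf := mem_faces.1 he
  have hne : e.2 ≠ e.1 := hf.2.2.1.ne'
  have hdp := dij_pos hne
  have hh := meshSize_pos_of_vert hd e.1
  obtain ⟨hD1, hb1⟩ := diagCoeff_bound hd hκ hν hreg he (Or.inl rfl)
  obtain ⟨hD2, hb2⟩ := diagCoeff_bound hd hκ hν hreg he (Or.inr rfl)
  have hF : 0 ≤ M.faceArea e.1 e.2 := ENNReal.toReal_nonneg
  have hFle := faceArea_le_of_mem_faces hκ hreg he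
  have hdl := abs_lump_sub_le hκ hd hΩ hdel hreg hp hf.1 hf.2.2.2
  have hG1 := hG e.1 hf.1
  have hG2 := hG e.2 hf.2.1
  have hV1 := cellVol_le hκ hreg hf.1
  have hV2 := cellVol_le hκ hreg hf.2.1
  have hV1' : 0 ≤ M.cellVol e.1 := ENNReal.toReal_nonneg
  have hV2' : 0 ≤ M.cellVol e.2 := ENNReal.toReal_nonneg
  have hdh := meshSize_le_dij hκ hreg he
  rw [weight_eq hne]
  set h := M.meshSize with hhdef
  set F := M.faceArea e.1 e.2 with hFdef
  set D1 := (M.diagCoeff ν e.1)⁻¹ with hD1def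
  set D2 := (M.diagCoeff ν e.2)⁻¹ with hD2def
  set m1 := √(M.localEnergy p e.1) with hm1
  set m2 := √(M.localEnergy p e.2) with hm2
  set n := M.normal e.1 e.2 with hn
  set δ := M.lump p e.2 - M.lump p e.1 with hδ
  set c2 := √((κ ^ 2) ^ d / ballVol d) with hc2
  set S := √(h ^ d) with hS
  set A := κ ^ (d + 2) / ν with hA
  have hm1' : 0 ≤ m1 := Real.sqrt_nonneg _
  have hm2' : 0 ≤ m2 := Real.sqrt_nonneg _
  have hc2' : 0 ≤ c2 := Real.sqrt_nonneg _
  have hS' : 0 ≤ S := Real.sqrt_nonneg _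
  have hA' : 0 < A := by positivity
  have hD1' : 0 ≤ D1 := (inv_pos.2 hD1).le
  have hD2' : 0 ≤ D2 := (inv_pos.2 hD2).le
  have hSS : S * S = h ^ d := Real.mul_self_sqrt (by positivity)
  have ha : ∀ D : ℝ, 0 ≤ D → h ^ (d - 1) * D ≤ κ ^ (d + 1) / ν * h → F * D ≤ A * h := by
    intro D hD hb
    calc F * D ≤ κ * h ^ (d - 1) * D := by gcongr
      _ = κ * (h ^ (d - 1) * D) := by ring
      _ ≤ κ * (κ ^ (d + 1) / ν * h) := by gcongr
      _ = _ := by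
        rw [hA]
        ring
  have ha1 := ha D1 hD1' hb1
  have ha2 := ha D2 hD2' hb2
  have hin : ∀ i, |⟪G i, n⟫| ≤ ‖G i‖ := fun i =>
    (abs_real_inner_le_norm _ _).trans
      (mul_le_of_le_one_right (norm_nonneg _) (norm_normal_le _ _))
  have hg : ∀ D : ℝ, ∀ i, ∀ m : ℝ, 0 ≤ D → F * D ≤ A * h → ‖G i‖ ≤ c * S * m →
      |F * D * ⟪G i, n⟫ * z| ≤ A * h * (c * S * m) * |z| := by
    intro D i m hD hFD hGi
    rw [abs_mul, abs_mul, abs_of_nonneg (mul_nonneg hF hD)]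
    refine mul_le_mul_of_nonneg_right ?_ (abs_nonneg _)
    exact mul_le_mul hFD ((hin i).trans hGi) (abs_nonneg _) (by positivity)
  -- The difference quotient is charged to the energy at the first vertex in both halves; the energy
  -- at the second vertex is added only to make the final bound symmetric.
  have hv : ∀ D V : ℝ, 0 ≤ D → 0 ≤ V → F * D ≤ A * h → V ≤ κ * h ^ d →
      |F * D * V * (δ / M.dij e.1 e.2) * z| ≤ A * κ ^ 3 * c2 * h * S * m1 * |z| := by
    intro D V hD hV hFD hVle
    rw [abs_mul, abs_mul, abs_mul, abs_of_nonneg (mul_nonneg hF hD), abs_of_nonneg hV, abs_div,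
      abs_of_pos hdp]
    refine mul_le_mul_of_nonneg_right ?_ (abs_nonneg _)
    have h1 : h * |δ| / M.dij e.1 e.2 ≤ κ ^ 2 * |δ| := by
      rw [div_le_iff₀ hdp]
      calc h * |δ| ≤ (κ ^ 2 * M.dij e.1 e.2) * |δ| := by gcongr
        _ = _ := by ring
    calc F * D * V * (|δ| / M.dij e.1 e.2) ≤ (A * h) * (κ * h ^ d) * (|δ| / M.dij e.1 e.2) := by
          gcongr
      _ = A * κ * h ^ d * (h * |δ| / M.dij e.1 e.2) := by ring
      _ ≤ A * κ * h ^ d * (κ ^ 2 * |δ|) := by gcongr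
      _ = A * κ ^ 3 * S * (S * |δ|) := by
          rw [← hSS]
          ring
      _ ≤ A * κ ^ 3 * S * (c2 * h * m1) := by gcongr
      _ = _ := by ring
  have g1 := hg D1 e.1 m1 hD1' ha1 hG1
  have g2 := hg D2 e.2 m2 hD2' ha2 hG2
  have v1 := hv D1 (M.cellVol e.1) hD1' hV1' ha1 hV1
  have v2 := hv D2 (M.cellVol e.2) hD2' hV2' ha2 hV2
  have hn1 : 0 ≤ A * h * (c * S * m1) * |z| := (abs_nonneg _).trans g1
  have hn2 : 0 ≤ A * h * (c * S * m2) * |z| := (abs_nonneg _).trans g2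
  have hn3 : 0 ≤ A * κ ^ 3 * c2 * h * S * m2 * |z| := by positivity
  rw [inner_add_left, real_inner_smul_left, real_inner_smul_left]
  have hsplit : F * ((1 / 2 * D1 * ⟪G e.1, n⟫ + (1 - 1 / 2) * D2 * ⟪G e.2, n⟫) * z) -
      F * ((1 / 2 * M.cellVol e.1 * D1 + (1 - 1 / 2) * M.cellVol e.2 * D2) *
        (δ / M.dij e.1 e.2) * z) =
      1 / 2 * (F * D1 * ⟪G e.1, n⟫ * z) + 1 / 2 * (F * D2 * ⟪G e.2, n⟫ * z) -
      (1 / 2 * (F * D1 * M.cellVol e.1 * (δ / M.dij e.1 e.2) * z) +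
        1 / 2 * (F * D2 * M.cellVol e.2 * (δ / M.dij e.1 e.2) * z)) := by ring
  rw [hsplit]
  rw [abs_le] at g1 g2 v1 v2 ⊢
  have hR : A * (c + κ ^ 3 * c2) * h ^ 1 * S * (m1 + m2) * |z| =
      A * h * (c * S * m1) * |z| + A * h * (c * S * m2) * |z| +
      (A * κ ^ 3 * c2 * h * S * m1 * |z| + A * κ ^ 3 * c2 * h * S * m2 * |z|) := by ring
  rw [hR]
  constructor <;> linarith

/-- The constant in the bounds for discrete functions. -/
theorem abs_discreteForm_le (hd : 1 ≤ d) {ν : ℝ} (hν : 0 < ν) (hκ : 0 < κ)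
    (hΩ : interior (closure Ω) = Ω) (hdel : M.IsDelaunay) (hbox : M.BoxesInside)
    (hreg : M.IsRegular κ) {τ : Fin M.N → Fin M.N → Finset (Fin M.N)} (hτ : M.IsLocalChoice τ)
    {p q : Pt d → ℝ} (hp : M.IsP1 p) (hq : M.IsP1 q) {G : Fin M.N → Pt d} {c : ℝ} (hc : 0 ≤ c)
    (hG : ∀ i ∈ M.interiorVerts, ‖G i‖ ≤ c * √(M.meshSize ^ d) * √(M.localEnergy p i)) :
    |∑ e ∈ M.faces, (M.faceArea e.1 e.2 * (⟪(M.weight e.1 e.2 * (M.diagCoeff ν e.1)⁻¹) • G e.1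
        + ((1 - M.weight e.1 e.2) * (M.diagCoeff ν e.2)⁻¹) • G e.2, M.normal e.1 e.2⟫ *
          (M.lump q e.1 - M.lump q e.2))
      - M.faceArea e.1 e.2 * ((M.weight e.1 e.2 * M.cellVol e.1 * (M.diagCoeff ν e.1)⁻¹
        + (1 - M.weight e.1 e.2) * M.cellVol e.2 * (M.diagCoeff ν e.2)⁻¹)
        * ((M.lump p e.2 - M.lump p e.1) / M.dij e.1 e.2) * (M.lump q e.1 - M.lump q e.2)))| ≤
      (κ ^ (d + 2) / ν * (c + κ ^ 3 * √((κ ^ 2) ^ d / ballVol d))) *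
        √(4 * maxNeighbours d κ * κ ^ (d + 4)) * √(d + 2) *
        M.meshSize ^ (1 / 2 : ℝ) * h1Seminorm Ω p * M.starSeminorm τ q := by
  have hΩo : IsOpen Ω := hΩ ▸ isOpen_interior
  have hs0 : 0 ≤ h1Seminorm Ω p := Real.sqrt_nonneg _
  have hA : 0 ≤ κ ^ (d + 2) / ν * (c + κ ^ 3 * √((κ ^ 2) ^ d / ballVol d)) := by positivity
  have hm : ∑ i ∈ M.interiorVerts, √(M.localEnergy p i) ^ 2 ≤
      (√(d + 2) * h1Seminorm Ω p) ^ 2 := by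
    rw [mul_pow, Real.sq_sqrt (by positivity)]
    refine le_trans (le_of_eq ?_) (sum_localEnergy_le hΩ hbox hp)
    exact Finset.sum_congr rfl fun i _ => Real.sq_sqrt (localEnergy_nonneg p i)
  have := abs_sum_faces_le hd hκ hΩo hdel hreg hτ hq hA (k := 1) (by positivity)
    (fun e he => abs_faceTerm_le hν hκ hd hΩo hdel hreg hp hG he
      (M.lump q e.1 - M.lump q e.2)) hm
  refine this.trans (le_of_eq ?_)
  rw [show ((1 : ℕ) : ℝ) - 1 / 2 = 1 / 2 by norm_num]
  ring

theorem setIntegral_face_const (i j : Fin M.N) (c : ℝ) :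
    ∫ _x in M.face i j, c ∂μHE[d - 1] = M.faceArea i j * c := by
  rw [integral_const, measureReal_restrict_apply_univ, smul_eq_mul, faceArea]

theorem sBDiscrete_eq (hΩ : IsOpen Ω) (hdel : M.IsDelaunay) (ν : ℝ) {p : Pt d → ℝ}
    (hp : M.IsP1 p) (z : Fin M.N → ℝ) : M.sBDiscrete ν p z = ∑ e ∈ M.faces,
      (M.faceArea e.1 e.2 * (⟪(M.weight e.1 e.2 * (M.diagCoeff ν e.1)⁻¹) •
          (∫ y in M.cell e.1, gradient p y)
        + ((1 - M.weight e.1 e.2) * (M.diagCoeff ν e.2)⁻¹) • (∫ y in M.cell e.2, gradient p y),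
        M.normal e.1 e.2⟫ * (z e.1 - z e.2))
      - M.faceArea e.1 e.2 * ((M.weight e.1 e.2 * M.cellVol e.1 * (M.diagCoeff ν e.1)⁻¹
        + (1 - M.weight e.1 e.2) * M.cellVol e.2 * (M.diagCoeff ν e.2)⁻¹)
        * ((M.lump p e.2 - M.lump p e.1) / M.dij e.1 e.2) * (z e.1 - z e.2))) := by
  rw [sBDiscrete, auxForm₁, auxForm₂, ← Finset.sum_sub_distrib]
  refine Finset.sum_congr rfl fun e he => ?_
  have hf := mem_faces.1 he
  simp_rw [edgeDeriv_eq hΩ hdel hp hf.1 hf.2.2.2]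
  rw [setIntegral_face_const, setIntegral_face_const]

theorem sTilde_eq (ν : ℝ) (p : Pt d → ℝ) (z : Fin M.N → ℝ) : M.sTilde ν p z = ∑ e ∈ M.faces,
      (M.faceArea e.1 e.2 * (⟪(M.weight e.1 e.2 * (M.diagCoeff ν e.1)⁻¹) •
          (M.cellVol e.1 • M.gaussGreen p e.1)
        + ((1 - M.weight e.1 e.2) * (M.diagCoeff ν e.2)⁻¹) • (M.cellVol e.2 • M.gaussGreen p e.2),
        M.normal e.1 e.2⟫ * (z e.1 - z e.2))
      - M.faceArea e.1 e.2 * ((M.weight e.1 e.2 * M.cellVol e.1 * (M.diagCoeff ν e.1)⁻¹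
        + (1 - M.weight e.1 e.2) * M.cellVol e.2 * (M.diagCoeff ν e.2)⁻¹)
        * ((M.lump p e.2 - M.lump p e.1) / M.dij e.1 e.2) * (z e.1 - z e.2))) := by
  rw [sTilde, ← Finset.sum_sub_distrib]
  refine Finset.sum_congr rfl fun e _ => ?_
  rw [setIntegral_face_const, setIntegral_face_const, smul_smul, smul_smul]

end Triangulation

/-! ### The form with traces of functions in H²_loc -/

section

variable {d : ℕ}

/-- The gradient is only locally square integrable in `Ω`, so its integrability up to the boundary
of a box has to be proved. A finite double integral of `|t(x) - g(y)|` provides it: by Tonelli, for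
some fixed `x` the function `t x - g` is integrable, and likewise with the roles exchanged. -/
theorem integrable_of_lintegral_lintegral_sub {α : Type*} [MeasurableSpace α] {μ ν : Measure α}
    [IsFiniteMeasure μ] [IsFiniteMeasure ν] [NeZero μ] [NeZero ν] {t g : α → Pt d}
    (ht : StronglyMeasurable t) (hg : StronglyMeasurable g)
    (hX : ∫⁻ x, ∫⁻ y, ‖t x - g y‖ₑ ∂ν ∂μ ≠ ⊤) :
    Integrable g ν ∧ Integrable t μ ∧
      ∫ x, ‖(∫ y, g y ∂ν) - ν.real Set.univ • t x‖ ∂μ ≤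
        (∫⁻ x, ∫⁻ y, ‖t x - g y‖ₑ ∂ν ∂μ).toReal := by
  have hm : Measurable fun z : α × α => ‖t z.1 - g z.2‖ₑ :=
    ((ht.comp_measurable measurable_fst).sub (hg.comp_measurable measurable_snd)).enorm
  have hgi : Integrable g ν := by
    have hae := ae_lt_top hm.lintegral_prod_right' hX
    obtain ⟨x, hx⟩ := hae.exists
    have h1 : Integrable (fun y => t x - g y) ν :=
      ⟨(stronglyMeasurable_const.sub hg).aestronglyMeasurable, hx⟩
    exact ((integrable_const (t x)).sub h1).congr (ae_of_all _ fun y => by simp)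
  have hti : Integrable t μ := by
    have hX' := hX
    rw [lintegral_lintegral_swap hm.aemeasurable] at hX'
    have hae := ae_lt_top (hm.comp measurable_swap).lintegral_prod_right' hX'
    obtain ⟨y, hy⟩ := hae.exists
    have h1 : Integrable (fun x => t x - g y) μ :=
      ⟨(ht.sub stronglyMeasurable_const).aestronglyMeasurable, hy⟩
    exact (h1.add (integrable_const (g y))).congr (ae_of_all _ fun x => by simp)
  refine ⟨hgi, hti, ?_⟩
  have hs : Integrable (fun x => ν.real Set.univ • t x) μ :=
    hti.smul (ν.real Set.univ)
  have hi : Integrable (fun x => (∫ y, g y ∂ν) - ν.real Set.univ • t x) μ :=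
    (integrable_const _).sub hs
  rw [integral_norm_eq_lintegral_enorm hi.aestronglyMeasurable]
  refine ENNReal.toReal_mono hX (lintegral_mono fun x => ?_)
  have h1 : (∫ y, g y ∂ν) - ν.real Set.univ • t x = ∫ y, (g y - t x) ∂ν := by
    rw [integral_sub hgi (integrable_const _), integral_const]
  rw [h1]
  refine (enorm_integral_le_lintegral_enorm _).trans (le_of_eq ?_)
  refine lintegral_congr fun y => ?_
  rw [← enorm_neg, neg_sub]

/-- The broken seminorm uses the Frobenius norm, which dominates the operator norm of the trace
estimates. -/
theorem norm_sq_le_sum (L : Pt d →L[ℝ] Pt d) :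
    ‖L‖ ^ 2 ≤ ∑ k : Fin d, ‖L (EuclideanSpace.single k 1)‖ ^ 2 := by
  have h : ‖L‖ ≤ √(∑ k : Fin d, ‖L (EuclideanSpace.single k 1)‖ ^ 2) := by
    refine L.opNorm_le_bound (Real.sqrt_nonneg _) fun v => ?_
    have hv : v = ∑ k, v k • EuclideanSpace.single k (1 : ℝ) := by
      conv_lhs => rw [← (EuclideanSpace.basisFun (Fin d) ℝ).sum_repr v]
      simp
    calc ‖L v‖ = ‖∑ k, v k • L (EuclideanSpace.single k 1)‖ := by
          conv_lhs => rw [hv]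
          simp only [map_sum, map_smul]
      _ ≤ ∑ k, ‖L (EuclideanSpace.single k 1)‖ * |v k| := by
          refine norm_sum_le_of_le _ fun k _ => ?_
          rw [norm_smul, Real.norm_eq_abs, mul_comm]
      _ ≤ √(∑ k : Fin d, ‖L (EuclideanSpace.single k 1)‖ ^ 2) * √(∑ k, |v k| ^ 2) :=
          Real.sum_mul_le_sqrt_mul_sqrt _ _ _
      _ = _ := by
          rw [EuclideanSpace.norm_eq v]
          rfl
  calc ‖L‖ ^ 2 ≤ √(∑ k : Fin d, ‖L (EuclideanSpace.single k 1)‖ ^ 2) ^ 2 := by gcongr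
    _ = _ := Real.sq_sqrt (Finset.sum_nonneg fun _ _ => sq_nonneg _)

theorem aestronglyMeasurable_of_memLp_compact {G : Type*} [NormedAddCommGroup G] {Ω : Set (Pt d)}
    {μ : Measure (Pt d)} (hΩ : IsOpen Ω) (hΩb : Bornology.IsBounded Ω) {f : Pt d → G}
    (hf : ∀ K, IsCompact K → K ⊆ Ω → MemLp f 2 (μ.restrict K)) :
    AEStronglyMeasurable f (μ.restrict Ω) := by
  obtain ⟨C, hCc, hCΩ, hCU, -⟩ := hΩ.exists_iUnion_isClosed
  rw [← hCU, aestronglyMeasurable_iUnion_iff]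
  intro n
  exact (hf _ (Metric.isCompact_of_isClosed_isBounded (hCc n) (hΩb.subset (hCΩ n)))
    (hCΩ n)).aestronglyMeasurable

/-- Replacing the limit of an `L²`-approximation by a measurable representative. -/
theorem tendsto_lintegral_enorm_of_ae_eq {G : Type*} [NormedAddCommGroup G] {μ : Measure (Pt d)}
    [IsFiniteMeasure μ] {u : ℕ → Pt d → G} {f f' : Pt d → G}
    (hu : ∀ k, AEStronglyMeasurable (u k) μ) (hf' : StronglyMeasurable f') (hff' : f =ᵐ[μ] f')
    (h : Tendsto (fun k => eLpNorm (u k - f) 2 μ) atTop (𝓝 0)) :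
    Tendsto (fun k => ∫⁻ x, ‖u k x - f' x‖ₑ ∂μ) atTop (𝓝 0) := by
  refine tendsto_lintegral_enorm_of_tendsto_eLpNorm_two (u := fun k => u k - f')
    (fun k => (hu k).sub hf'.aestronglyMeasurable) ?_
  refine h.congr fun k => eLpNorm_congr_ae ?_
  filter_upwards [hff'] with x hx
  simp [hx]

namespace Triangulation

variable {Ω : Set (Pt d)} {M : Triangulation d Ω} {κ : ℝ}

/-- A point of the face outside all third cells has a neighbourhood contained in the union of the
two boxes, hence in the closure of `Ω`, and so it is interior to that closure, which means it lies
in `Ω`. The remaining points form a null set. -/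
theorem faceMeasure_sdiff (hΩ : interior (closure Ω) = Ω) (hbox : M.BoxesInside) {i j : Fin M.N}
    (hi : i ∈ M.interiorVerts) (hj : j ∈ M.interiorVerts) (hji : j ≠ i) :
    (μHE[d - 1] : Measure (Pt d)) (M.face i j \ Ω) = 0 := by
  refine measure_mono_null (t := ⋃ k ∈ {k | k ≠ i ∧ k ≠ j}, M.face i j ∩ M.cell k) ?_ ?_
  · rintro x ⟨hx, hxΩ⟩
    by_contra hcon
    simp only [Set.mem_iUnion, not_exists] at hcon
    refine hxΩ ?_
    set U : Set (Pt d) :=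
      {y | ∀ k, k ≠ i → k ≠ j → dist y (M.vert i) < dist y (M.vert k)} with hU
    have hUo : IsOpen U := by
      simp only [hU, Set.ofPred_forall]
      exact isOpen_iInter_of_finite fun k => isOpen_iInter_of_finite fun _ =>
        isOpen_iInter_of_finite fun _ => isOpen_lt (by fun_prop) (by fun_prop)
    have hxU : x ∈ U := by
      intro k hki hkj
      by_contra hle
      push Not at hle
      exact hcon k ⟨hki, hkj⟩ ⟨hx, fun l => hle.trans (hx.1 l)⟩
    have hUc : U ⊆ closure Ω := by
      intro y hy
      rcases le_or_gt (dist y (M.vert i)) (dist y (M.vert j)) with hle | hlt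
      · refine hbox i hi fun k => ?_
        by_cases hki : k = i
        · rw [hki]
        by_cases hkj : k = j
        · rwa [hkj]
        exact (hy k hki hkj).le
      · refine hbox j hj fun k => ?_
        by_cases hki : k = i
        · rw [hki]
          exact hlt.le
        by_cases hkj : k = j
        · rw [hkj]
        exact hlt.le.trans (hy k hki hkj).le
    exact hΩ.subset (interior_maximal hUc hUo hxU)
  · exact (measure_biUnion_null_iff (Set.to_countable _)).2 fun k hk =>
      faceMeasure_inter_cell hji hk.1 hk.2.symm

/-- The constant in the comparison of traces and mean values. -/
def traceConst (d : ℕ) : ℝ := 2 * (2 ^ (d - 1) + 2 ^ (d - 1) * 2 ^ d)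

/-- The trace estimate is applied to the box with apex `p_i`, whose distance to the bisector is
`d_ij / 2` and whose diameter is at most `2 h`. The factor `d_ij / 2` on the left cancels the
diameter because `h ≤ κ² d_ij`, and Cauchy-Schwarz turns the L¹ norm of the Hessian into its L²
norm. -/
theorem trace_cell_le (hd : 1 ≤ d) (hκ : 0 < κ) (hΩ : interior (closure Ω) = Ω)
    (hbox : M.BoxesInside) (hreg : M.IsRegular κ) {i j : Fin M.N}
    (hi : i ∈ M.interiorVerts) (hj : j ∈ M.interiorVerts) (hij : j ∈ M.neighbours i)
    (hdij : M.meshSize ≤ κ ^ 2 * M.dij i j)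
    {p : Pt d → ℝ} {g t : Pt d → Pt d} {H : Pt d → Pt d →L[ℝ] Pt d} (hp : IsH2Loc Ω p g H)
    (hH : ∀ T ∈ M.elems, MemLp H 2 (volume.restrict (M.simplex T)))
    (htr : IsTrace Ω (M.face i j) g H t) :
    IntegrableOn t (M.face i j) μHE[d - 1] ∧
      ∫ x in M.face i j, ‖(∫ y in M.cell i, g y) - M.cellVol i • t x‖ ∂μHE[d - 1] ≤
        4 * traceConst d * κ ^ 3 * √κ * M.meshSize ^ d * √(M.meshSize ^ d) *
          √(∫ x in M.cell i, ‖H x‖ ^ 2) := by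
  have hΩo : IsOpen Ω := hΩ ▸ isOpen_interior
  have hΩb : Bornology.IsBounded Ω := M.isCompact_closure.isBounded.subset subset_closure
  have hji := (mem_neighbours.1 hij).1
  have hdp := dij_pos hji
  have hh := meshSize_pos_of_vert hd i
  have hBc := isCompact_cell hbox hi
  have hBconv := convex_cell (M := M) i
  have hBint := interior_cell_subset hΩ hbox hi
  have hFfin := faceMeasure_ne_top hbox hi hji
  have hFΩ := faceMeasure_sdiff hΩ hbox hi hj hji
  have hFB : M.face i j ⊆ M.cell i := Set.inter_subset_left
  have hFc : IsCompact (M.face i j) := hBc.of_isClosed_subset (isClosed_face i j) hFB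
  have hBae : (interior (M.cell i) : Set (Pt d)) =ᵐ[volume] M.cell i :=
    interior_ae_eq_of_null_frontier (hBconv.addHaar_frontier volume)
  have hFae : (M.face i j ∩ Ω : Set (Pt d)) =ᵐ[μHE[d - 1]] M.face i j := by
    refine ae_eq_set.2 ⟨by rw [Set.sdiff_eq_empty.2 Set.inter_subset_left, measure_empty], ?_⟩
    rwa [show M.face i j \ (M.face i j ∩ Ω) = M.face i j \ Ω by ext; simp]
  have iB : IsFiniteMeasure (volume.restrict (M.cell i)) :=
    ⟨by simpa using hBc.measure_lt_top⟩
  have iF : IsFiniteMeasure (μHE[d - 1].restrict (M.face i j) : Measure (Pt d)) :=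
    ⟨by simpa [lt_top_iff_ne_top] using hFfin⟩
  have nB : NeZero (volume.restrict (M.cell i)) := by
    refine ⟨fun h0 => ?_⟩
    rw [Measure.restrict_eq_zero] at h0
    exact (Measure.measure_pos_of_nonempty_interior _ ⟨_, vert_mem_interior_cell i⟩).ne' h0
  have nF : NeZero (μHE[d - 1].restrict (M.face i j) : Measure (Pt d)) := by
    refine ⟨fun h0 => ?_⟩
    rw [Measure.restrict_eq_zero] at h0
    exact (mem_neighbours.1 hij).2.ne' h0
  obtain ⟨φ, hφ, hlim⟩ := htr
  -- measurable representatives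
  have hgm : AEStronglyMeasurable g (volume.restrict Ω) :=
    aestronglyMeasurable_of_memLp_compact hΩo hΩb hp.grad_memL2Loc
  have hHm : AEStronglyMeasurable H (volume.restrict Ω) :=
    aestronglyMeasurable_of_memLp_compact hΩo hΩb hp.hess_memL2Loc
  have htm : AEStronglyMeasurable t (μHE[d - 1].restrict (M.face i j)) := by
    rw [← Measure.restrict_congr_set hFae, Set.inter_comm, ← Measure.restrict_restrict
      hΩo.measurableSet]
    refine aestronglyMeasurable_of_memLp_compact hΩo hΩb fun K hK hKΩ => ?_
    rw [Measure.restrict_restrict hK.measurableSet, Set.inter_comm]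
    exact (hlim K hK hKΩ).2.2.1
  have hφm : ∀ k, StronglyMeasurable (φ k) := fun k => (hφ k).continuous.stronglyMeasurable
  have hφm' : ∀ k, StronglyMeasurable (fderiv ℝ (φ k)) :=
    fun k => ((hφ k).continuous_fderiv (by simp)).stronglyMeasurable
  have main := lintegral_trace_sub_le hΩo hBconv hBc hBint (vert_mem_interior_cell i)
    (foot_ne_zero hji (vert_mem_openCell i j hji)) hFc hFB
    (fun x hx => inner_foot_of_mem_face hji (vert_mem_openCell i j hji) hx) hFfin hFΩ
    (D := ENNReal.ofReal (2 * M.meshSize)) ENNReal.ofReal_ne_top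
    (fun x hx y hy => by
      rw [← ofReal_norm, ← dist_eq_norm]
      refine ENNReal.ofReal_le_ofReal ?_
      have h1 := cell_subset_closedBall hbox hi hx
      have h2 := cell_subset_closedBall hbox hi hy
      rw [Metric.mem_closedBall] at h1 h2
      have := dist_triangle_right x y (M.vert i)
      linarith)
    hφ hgm.stronglyMeasurable_mk hHm.stronglyMeasurable_mk htm.stronglyMeasurable_mk
    (fun K hK hKΩ => by
      have : IsFiniteMeasure (volume.restrict K) := ⟨by simpa using hK.measure_lt_top⟩
      exact tendsto_lintegral_enorm_of_ae_eq (fun k => (hφm k).aestronglyMeasurable)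
        hgm.stronglyMeasurable_mk (ae_restrict_of_ae_restrict_of_subset hKΩ hgm.ae_eq_mk)
        (hlim K hK hKΩ).1)
    (fun K hK hKΩ => by
      have : IsFiniteMeasure (volume.restrict K) := ⟨by simpa using hK.measure_lt_top⟩
      exact tendsto_lintegral_enorm_of_ae_eq (fun k => (hφm' k).aestronglyMeasurable)
        hHm.stronglyMeasurable_mk (ae_restrict_of_ae_restrict_of_subset hKΩ hHm.ae_eq_mk)
        (hlim K hK hKΩ).2.1)
    (fun K hK hKΩ => by
      have : IsFiniteMeasure (μHE[d - 1].restrict (M.face i j ∩ K) : Measure (Pt d)) :=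
        ⟨by simpa [lt_top_iff_ne_top] using
          ne_top_of_le_ne_top hFfin (measure_mono Set.inter_subset_left)⟩
      exact tendsto_lintegral_enorm_of_ae_eq (fun k => (hφm k).aestronglyMeasurable)
        htm.stronglyMeasurable_mk
        (ae_restrict_of_ae_restrict_of_subset Set.inter_subset_left htm.ae_eq_mk)
        (hlim K hK hKΩ).2.2.2)
  have hgae : g =ᵐ[volume.restrict (M.cell i)] hgm.mk g := by
    rw [← Measure.restrict_congr_set hBae]
    exact ae_restrict_of_ae_restrict_of_subset hBint hgm.ae_eq_mk
  have hHae : H =ᵐ[volume.restrict (M.cell i)] hHm.mk H := by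
    rw [← Measure.restrict_congr_set hBae]
    exact ae_restrict_of_ae_restrict_of_subset hBint hHm.ae_eq_mk
  -- integrability of the Hessian
  have hHsq : IntegrableOn (fun x => ‖H x‖ ^ 2) (M.cell i) := by
    refine IntegrableOn.mono_set ?_ (hbox i hi)
    rw [integrableOn_closure_iff (M := M)]
    exact fun T hT => (memLp_two_iff_integrable_sq_norm (hH T hT).aestronglyMeasurable).1 (hH T hT)
  have hHi : IntegrableOn H (M.cell i) := by
    refine IntegrableOn.mono_set ?_ (hbox i hi)
    rw [integrableOn_closure_iff (M := M)]
    intro T hT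
    have : IsFiniteMeasure (volume.restrict (M.simplex T)) :=
      ⟨by simpa using (M.isCompact_simplex T).measure_lt_top⟩
    exact (hH T hT).integrable (by norm_num)
  set I := ∫ x in M.cell i, ‖H x‖ with hI
  have hI0 : 0 ≤ I := integral_nonneg fun _ => norm_nonneg _
  have hIl : ∫⁻ x in M.cell i, ‖hHm.mk H x‖ₑ = ENNReal.ofReal I := by
    rw [hI, ofReal_integral_norm_eq_lintegral_enorm hHi]
    refine lintegral_congr_ae ?_
    filter_upwards [hHae] with x hx
    rw [hx]
  have hIle : I ≤ √κ * √(M.meshSize ^ d) * √(∫ x in M.cell i, ‖H x‖ ^ 2) := by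
    have h1 := sq_integral_norm_le hHi hHsq
    rw [measureReal_restrict_apply_univ] at h1
    rw [← Real.sqrt_mul hκ.le, ← Real.sqrt_mul (by positivity)]
    refine Real.le_sqrt_of_sq_le (h1.trans ?_)
    exact mul_le_mul_of_nonneg_right (cellVol_le hκ hreg hi)
      (integral_nonneg fun _ => sq_nonneg _)
  -- the estimate
  have hfoot : ‖M.foot (M.vert i) i j‖ = M.dij i j / 2 := by
    rw [norm_foot hji (vert_mem_openCell i j hji), gap, sub_self, inner_zero_left, sub_zero,
      ← dij_eq_norm]
    field_simp
  set X := ∫⁻ x in M.face i j, ∫⁻ y in M.cell i, ‖htm.mk t x - hgm.mk g y‖ₑ ∂volume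
    ∂μHE[d - 1] with hX
  have hVol : volume (M.cell i) = ENNReal.ofReal (M.cellVol i) :=
    (ENNReal.ofReal_toReal hBc.measure_lt_top.ne).symm
  have hc0 : 0 ≤ traceConst d := by
    unfold traceConst
    positivity
  have hcE : (2 * (2 ^ (d - 1) + 2 ^ (d - 1) * 2 ^ d) : ℝ≥0∞) = ENNReal.ofReal (traceConst d) := by
    unfold traceConst
    have h2 : ∀ n : ℕ, (2 : ℝ≥0∞) ^ n = ENNReal.ofReal (2 ^ n) := by
      intro n
      rw [ENNReal.ofReal_pow (by norm_num), ENNReal.ofReal_ofNat]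
    rw [ENNReal.ofReal_mul (by norm_num), ENNReal.ofReal_add (by positivity) (by positivity),
      ENNReal.ofReal_mul (by positivity), ← h2, ← h2, ENNReal.ofReal_ofNat]
  have hcV : 0 ≤ traceConst d * (2 * M.meshSize) * M.cellVol i :=
    mul_nonneg (by positivity) ENNReal.toReal_nonneg
  rw [hIl, hVol, hcE, ← ofReal_norm, hfoot, ← ENNReal.ofReal_mul hc0,
    ← ENNReal.ofReal_mul (by positivity), ← ENNReal.ofReal_mul hcV] at main
  -- Finiteness is part of the conclusion: the right side is finite and the factor `d_ij / 2` on the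
  -- left is not zero.
  have hXt : X ≠ ⊤ := by
    intro h0
    rw [h0, ENNReal.mul_top (by simpa using hdp)] at main
    exact ENNReal.ofReal_ne_top (top_le_iff.1 main)
  have hXle : X.toReal ≤ 4 * traceConst d * κ ^ 3 * M.meshSize ^ d * I := by
    have h1 := ENNReal.toReal_mono ENNReal.ofReal_ne_top main
    rw [ENNReal.toReal_mul, ENNReal.toReal_ofReal (by positivity), ENNReal.toReal_ofReal
      (mul_nonneg hcV hI0)] at h1
    have hV := cellVol_le hκ hreg hi
    have hV0 : 0 ≤ M.cellVol i := ENNReal.toReal_nonneg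
    refine le_of_mul_le_mul_left ?_ (half_pos hdp)
    calc M.dij i j / 2 * X.toReal ≤ traceConst d * (2 * M.meshSize) * M.cellVol i * I := h1
      _ ≤ traceConst d * (2 * (κ ^ 2 * M.dij i j)) * (κ * M.meshSize ^ d) * I := by
        gcongr
      _ = _ := by ring
  obtain ⟨-, hti, hle⟩ := integrable_of_lintegral_lintegral_sub htm.stronglyMeasurable_mk
    hgm.stronglyMeasurable_mk hXt
  refine ⟨hti.congr htm.ae_eq_mk.symm, ?_⟩
  have hcong : ∫ x in M.face i j, ‖(∫ y in M.cell i, g y) - M.cellVol i • t x‖ ∂μHE[d - 1] =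
      ∫ x in M.face i j, ‖(∫ y in M.cell i, hgm.mk g y) -
        (volume.restrict (M.cell i)).real Set.univ • htm.mk t x‖ ∂μHE[d - 1] := by
    rw [integral_congr_ae hgae, measureReal_restrict_apply_univ]
    refine integral_congr_ae ?_
    filter_upwards [htm.ae_eq_mk] with x hx
    rw [hx, cellVol]
  rw [hcong]
  refine hle.trans (hXle.trans ?_)
  calc 4 * traceConst d * κ ^ 3 * M.meshSize ^ d * I ≤ 4 * traceConst d * κ ^ 3 * M.meshSize ^ d *
        (√κ * √(M.meshSize ^ d) * √(∫ x in M.cell i, ‖H x‖ ^ 2)) := by gcongr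
    _ = _ := by ring

theorem sum_hessian_le (hbox : M.BoxesInside) {H : Pt d → Pt d →L[ℝ] Pt d}
    (hH : ∀ T ∈ M.elems, MemLp H 2 (volume.restrict (M.simplex T))) :
    ∑ i ∈ M.interiorVerts, √(∫ x in M.cell i, ‖H x‖ ^ 2) ^ 2 ≤ M.brokenSeminorm H ^ 2 := by
  have hnn : ∀ A : Set (Pt d), 0 ≤ ∫ x in A, ‖H x‖ ^ 2 :=
    fun A => integral_nonneg fun _ => sq_nonneg _
  have hHT : ∀ T ∈ M.elems, IntegrableOn (fun x => ‖H x‖ ^ 2) (M.simplex T) := fun T hT =>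
    (memLp_two_iff_integrable_sq_norm (hH T hT).aestronglyMeasurable).1 (hH T hT)
  have hint : IntegrableOn (fun x => ‖H x‖ ^ 2) (closure Ω) :=
    (integrableOn_closure_iff (M := M)).2 hHT
  have h1 : ∑ i ∈ M.interiorVerts, √(∫ x in M.cell i, ‖H x‖ ^ 2) ^ 2 =
      ∑ i ∈ M.interiorVerts, ∫ x in M.cell i, ‖H x‖ ^ 2 :=
    Finset.sum_congr rfl fun i _ => Real.sq_sqrt (hnn _)
  rw [h1, brokenSeminorm, Real.sq_sqrt]
  · refine (sum_cell_le hbox (fun _ => sq_nonneg _) hint).trans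
      ((closure_le_sum_simplex (M := M) (fun _ => sq_nonneg _) hint).trans
        (Finset.sum_le_sum fun T hT => ?_))
    refine integral_mono (hHT T hT) ?_ fun x => norm_sq_le_sum (H x)
    refine integrable_finsetSum _ fun k _ => ?_
    have hm : AEStronglyMeasurable (fun x => H x (EuclideanSpace.single k 1))
        (volume.restrict (M.simplex T)) :=
      (ContinuousLinearMap.apply ℝ (Pt d) (EuclideanSpace.single k (1 : ℝ))).continuous
        |>.comp_aestronglyMeasurable (hH T hT).aestronglyMeasurable
    refine (hHT T hT).mono' (hm.norm.pow 2) (ae_of_all _ fun x => ?_)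
    rw [Real.norm_of_nonneg (sq_nonneg _)]
    refine pow_le_pow_left₀ (norm_nonneg _) ?_ 2
    refine ((H x).le_opNorm _).trans (le_of_eq ?_)
    simp
  · exact Finset.sum_nonneg fun T _ => integral_nonneg fun x =>
      Finset.sum_nonneg fun _ _ => sq_nonneg _

/-- The contribution of a single face to the form with traces. -/
theorem abs_traceTerm_le {μ : Measure (Pt d)} [IsFiniteMeasure μ] {t : Pt d → Pt d}
    (ht : Integrable t μ) {G₁ G₂ n : Pt d} (hn : ‖n‖ ≤ 1) {D₁ D₂ V₁ V₂ z T₁ T₂ : ℝ}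
    (hD₁ : 0 ≤ D₁) (hD₂ : 0 ≤ D₂) (hT₁ : ∫ x, ‖G₁ - V₁ • t x‖ ∂μ ≤ T₁)
    (hT₂ : ∫ x, ‖G₂ - V₂ • t x‖ ∂μ ≤ T₂) :
    |(∫ _x, ⟪(1 / 2 * D₁) • G₁ + ((1 - 1 / 2) * D₂) • G₂, n⟫ * z ∂μ) -
      ∫ x, (1 / 2 * V₁ * D₁ + (1 - 1 / 2) * V₂ * D₂) * ⟪t x, n⟫ * z ∂μ| ≤
      1 / 2 * |z| * (D₁ * T₁ + D₂ * T₂) := by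
  have hi : ∀ (G : Pt d) (V : ℝ), Integrable (fun x => ‖G - V • t x‖) μ := by
    intro G V
    have hs : Integrable (fun x => V • t x) μ := ht.smul V
    have hs' : Integrable (fun x => G - V • t x) μ := (integrable_const G).sub hs
    exact hs'.norm
  have hit : Integrable (fun x => (1 / 2 * V₁ * D₁ + (1 - 1 / 2) * V₂ * D₂) * ⟪t x, n⟫ * z) μ :=
    ((ht.inner_const n).const_mul _).mul_const _
  have hdom : Integrable (fun x => 1 / 2 * |z| *
      (D₁ * ‖G₁ - V₁ • t x‖ + D₂ * ‖G₂ - V₂ • t x‖)) μ :=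
    (((hi G₁ V₁).const_mul D₁).add ((hi G₂ V₂).const_mul D₂)).const_mul _
  rw [← integral_sub (integrable_const _) hit, ← Real.norm_eq_abs]
  refine (norm_integral_le_of_norm_le hdom (ae_of_all _ fun x => ?_)).trans ?_
  -- Both parts of the form carry the same weights, so they combine into the defect of each box.
  · have e1 : ⟪(1 / 2 * D₁) • G₁ + ((1 - 1 / 2) * D₂) • G₂, n⟫ * z -
        (1 / 2 * V₁ * D₁ + (1 - 1 / 2) * V₂ * D₂) * ⟪t x, n⟫ * z =
        1 / 2 * z * (D₁ * ⟪G₁ - V₁ • t x, n⟫ + D₂ * ⟪G₂ - V₂ • t x, n⟫) := by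
      simp only [inner_add_left, inner_sub_left, real_inner_smul_left]
      ring
    have hin : ∀ w : Pt d, |⟪w, n⟫| ≤ ‖w‖ := fun w =>
      (abs_real_inner_le_norm _ _).trans (mul_le_of_le_one_right (norm_nonneg _) hn)
    rw [e1, Real.norm_eq_abs, abs_mul, abs_mul, abs_of_pos (by norm_num : (0 : ℝ) < 1 / 2)]
    refine mul_le_mul_of_nonneg_left ((abs_add_le _ _).trans ?_) (by positivity)
    rw [abs_mul, abs_mul, abs_of_nonneg hD₁, abs_of_nonneg hD₂]
    exact add_le_add (mul_le_mul_of_nonneg_left (hin _) hD₁)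
      (mul_le_mul_of_nonneg_left (hin _) hD₂)
  · rw [integral_const_mul, integral_add ((hi G₁ V₁).const_mul D₁) ((hi G₂ V₂).const_mul D₂),
      integral_const_mul, integral_const_mul]
    gcongr

/-- The defect on a face is of order `h ^ (3 d / 2)` times the local Hessian norm and `D_i⁻¹` is of
order `h ^ (2 - d)`. The product has the factor `h² h ^ (d / 2)`, so the summation applies with `k =
2`. -/
theorem abs_sB_le (hd : 1 ≤ d) {ν : ℝ} (hν : 0 < ν) (hκ : 0 < κ)
    (hΩ : interior (closure Ω) = Ω) (hdel : M.IsDelaunay) (hbox : M.BoxesInside)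
    (hreg : M.IsRegular κ) {τ : Fin M.N → Fin M.N → Finset (Fin M.N)} (hτ : M.IsLocalChoice τ)
    {p : Pt d → ℝ} {g t : Pt d → Pt d} {H : Pt d → Pt d →L[ℝ] Pt d} (hp : IsH2Loc Ω p g H)
    (hH : ∀ T ∈ M.elems, MemLp H 2 (volume.restrict (M.simplex T)))
    (htr : ∀ e ∈ M.faces, IsTrace Ω (M.face e.1 e.2) g H t)
    {q : Pt d → ℝ} (hq : M.IsP1 q) :
    |M.sB ν g t (M.lump q)| ≤
      2 * traceConst d * κ ^ 3 * √κ * (κ ^ (d + 1) / ν) *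
        √(4 * maxNeighbours d κ * κ ^ (d + 4)) * M.meshSize ^ (3 / 2 : ℝ) * M.brokenSeminorm H *
        M.starSeminorm τ q := by
  have hΩo : IsOpen Ω := hΩ ▸ isOpen_interior
  have hc0 : 0 ≤ traceConst d := by
    unfold traceConst
    positivity
  have hA : 0 ≤ 2 * traceConst d * κ ^ 3 * √κ * (κ ^ (d + 1) / ν) := by positivity
  rw [sB, auxForm₁, auxForm₂, ← Finset.sum_sub_distrib]
  have key := abs_sum_faces_le hd hκ hΩo hdel hreg hτ hq hA (k := 2)
    (s := fun e => (∫ _x in M.face e.1 e.2,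
      ⟪(M.weight e.1 e.2 * (M.diagCoeff ν e.1)⁻¹) • (∫ y in M.cell e.1, g y)
      + ((1 - M.weight e.1 e.2) * (M.diagCoeff ν e.2)⁻¹) • (∫ y in M.cell e.2, g y),
      M.normal e.1 e.2⟫ * (M.lump q e.1 - M.lump q e.2) ∂μHE[d - 1]) -
      ∫ x in M.face e.1 e.2,
      (M.weight e.1 e.2 * M.cellVol e.1 * (M.diagCoeff ν e.1)⁻¹
      + (1 - M.weight e.1 e.2) * M.cellVol e.2 * (M.diagCoeff ν e.2)⁻¹)
      * ⟪t x, M.normal e.1 e.2⟫ * (M.lump q e.1 - M.lump q e.2) ∂μHE[d - 1])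
    (m := fun i => √(∫ x in M.cell i, ‖H x‖ ^ 2)) (Q := M.brokenSeminorm H)
    (Real.sqrt_nonneg _) ?_ (sum_hessian_le hbox hH)
  · refine key.trans (le_of_eq ?_)
    rw [show ((2 : ℕ) : ℝ) - 1 / 2 = 3 / 2 by norm_num]
  intro e he
  have hf := mem_faces.1 he
  have hne : e.2 ≠ e.1 := hf.2.2.1.ne'
  have hh := meshSize_pos_of_vert hd e.1
  obtain ⟨hD1, hb1⟩ := diagCoeff_bound hd hκ hν hreg he (Or.inl rfl)
  obtain ⟨hD2, hb2⟩ := diagCoeff_bound hd hκ hν hreg he (Or.inr rfl)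
  have hdh := meshSize_le_dij hκ hreg he
  obtain ⟨hti, hT1⟩ := trace_cell_le hd hκ hΩ hbox hreg hf.1 hf.2.1 hf.2.2.2 hdh hp hH (htr e he)
  obtain ⟨-, hT2⟩ := trace_cell_le hd hκ hΩ hbox hreg hf.2.1 hf.1
    (mem_neighbours_comm.1 hf.2.2.2) (by rwa [dij_comm]) hp hH
    (by rw [face_comm]; exact htr e he)
  rw [face_comm] at hT2
  have iF : IsFiniteMeasure (μHE[d - 1].restrict (M.face e.1 e.2) : Measure (Pt d)) :=
    ⟨by simpa [lt_top_iff_ne_top] using faceMeasure_ne_top hbox hf.1 hne⟩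
  have hc' : 0 ≤ 4 * traceConst d * κ ^ 3 * √κ := by positivity
  have hend : ∀ D m T : ℝ, 0 ≤ D → 0 ≤ m →
      M.meshSize ^ (d - 1) * D ≤ κ ^ (d + 1) / ν * M.meshSize →
      T = 4 * traceConst d * κ ^ 3 * √κ * M.meshSize ^ d * √(M.meshSize ^ d) * m →
      D * T ≤ 4 * traceConst d * κ ^ 3 * √κ * (κ ^ (d + 1) / ν) * M.meshSize ^ 2 *
        √(M.meshSize ^ d) * m := by
    intro D m T hD hm hb hT
    have hb' : M.meshSize ^ d * D ≤ κ ^ (d + 1) / ν * M.meshSize ^ 2 := by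
      calc M.meshSize ^ d * D = M.meshSize * (M.meshSize ^ (d - 1) * D) := by
            rw [← mul_assoc, ← pow_succ', Nat.sub_add_cancel hd]
        _ ≤ M.meshSize * (κ ^ (d + 1) / ν * M.meshSize) := by gcongr
        _ = _ := by ring
    calc D * T = 4 * traceConst d * κ ^ 3 * √κ * (M.meshSize ^ d * D) *
          √(M.meshSize ^ d) * m := by
          rw [hT]
          ring
      _ ≤ 4 * traceConst d * κ ^ 3 * √κ * (κ ^ (d + 1) / ν * M.meshSize ^ 2) *
          √(M.meshSize ^ d) * m := by gcongr
      _ = _ := by ring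
  have hD1' := (inv_pos.2 hD1).le
  have hD2' := (inv_pos.2 hD2).le
  have f1 := hend _ _ _ hD1' (Real.sqrt_nonneg (∫ x in M.cell e.1, ‖H x‖ ^ 2)) hb1 rfl
  have f2 := hend _ _ _ hD2' (Real.sqrt_nonneg (∫ x in M.cell e.2, ‖H x‖ ^ 2)) hb2 rfl
  have key := abs_traceTerm_le hti (norm_normal_le (M := M) e.1 e.2) hD1' hD2' hT1 hT2
    (z := M.lump q e.1 - M.lump q e.2)
  simp only
  rw [weight_eq hne]
  refine key.trans ((mul_le_mul_of_nonneg_left (add_le_add f1 f2) (by positivity)).trans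
    (le_of_eq ?_))
  ring

end Triangulation

end

end RhieChow

end

/-! ### The three estimates with a common constant -/

theorem mainTheorem9 (d : ℕ) (hd : d = 2 ∨ d = 3) (ν κ : ℝ) (hν : 0 < ν) (hκ : 0 < κ) :
    ∃ C : ℝ, 0 < C ∧
      ∀ (Ω : Set (RhieChow.Pt d)), interior (closure Ω) = Ω →
      ∀ (M : RhieChow.Triangulation d Ω), M.IsDelaunay → M.BoxesInside → M.IsRegular κ →
      ∀ τ : Fin M.N → Fin M.N → Finset (Fin M.N), M.IsLocalChoice τ →
        (∀ (p : RhieChow.Pt d → ℝ) (g t : RhieChow.Pt d → RhieChow.Pt d)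
            (H : RhieChow.Pt d → RhieChow.Pt d →L[ℝ] RhieChow.Pt d),
          RhieChow.IsH2Loc Ω p g H →
          (∀ T ∈ M.elems, MemLp H 2 (volume.restrict (M.simplex T))) →
          (∀ e ∈ M.faces, RhieChow.IsTrace Ω (M.face e.1 e.2) g H t) →
          ∀ q : RhieChow.Pt d → ℝ, M.IsP1 q →
            |M.sB ν g t (M.lump q)| ≤
              C * M.meshSize ^ (3 / 2 : ℝ) * M.brokenSeminorm H * M.starSeminorm τ q) ∧
        (∀ p q : RhieChow.Pt d → ℝ, M.IsP1 p → M.IsP1 q →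
            |M.sBDiscrete ν p (M.lump q)| ≤
              C * M.meshSize ^ (1 / 2 : ℝ) * RhieChow.h1Seminorm Ω p * M.starSeminorm τ q) ∧
        (∀ p q : RhieChow.Pt d → ℝ, M.IsP1 p → M.IsP1 q →
            |M.sTilde ν p (M.lump q)| ≤
              C * M.meshSize ^ (1 / 2 : ℝ) * RhieChow.h1Seminorm Ω p * M.starSeminorm τ q) := by
  have hd1 : 1 ≤ d := by omega
  have hcf : 0 < (RhieChow.coneFactor d).toReal :=
    ENNReal.toReal_pos (RhieChow.coneFactor_ne_zero d) (RhieChow.coneFactor_ne_top d)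
  have hB := RhieChow.Triangulation.ballVol_pos d
  have hN : 0 ≤ RhieChow.Triangulation.maxNeighbours d κ := by
    unfold RhieChow.Triangulation.maxNeighbours
    positivity
  have hT : 0 ≤ RhieChow.Triangulation.traceConst d := by
    unfold RhieChow.Triangulation.traceConst
    positivity
  obtain ⟨c, hc⟩ : ∃ c, c = RhieChow.Triangulation.maxNeighbours d κ *
      (RhieChow.Triangulation.ballVol d / (RhieChow.coneFactor d).toReal) *
      √((κ ^ 2) ^ d / RhieChow.Triangulation.ballVol d) := ⟨_, rfl⟩
  have hc0 : 0 ≤ c := by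
    rw [hc]
    positivity
  -- Both discrete forms obey the same bound, with `c` the constant of the box gradient: `√κ` for
  -- the exact integral and the `c` above for Gauss-Green.
  obtain ⟨K, hK⟩ : ∃ K : ℝ → ℝ, K = fun c => (κ ^ (d + 2) / ν * (c + κ ^ 3 *
      √((κ ^ 2) ^ d / RhieChow.Triangulation.ballVol d))) *
      √(4 * RhieChow.Triangulation.maxNeighbours d κ * κ ^ (d + 4)) * √(d + 2) := ⟨_, rfl⟩
  have hK0 : ∀ c, 0 ≤ c → 0 ≤ K c := by
    intro c hc
    rw [hK]
    positivity
  obtain ⟨C₁, hC₁⟩ : ∃ C₁ : ℝ, C₁ = 2 * RhieChow.Triangulation.traceConst d * κ ^ 3 * √κ *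
    (κ ^ (d + 1) / ν) * √(4 * RhieChow.Triangulation.maxNeighbours d κ * κ ^ (d + 4)) := ⟨_, rfl⟩
  have hC₁0 : 0 ≤ C₁ := by
    rw [hC₁]
    positivity
  have hK1 := hK0 _ (Real.sqrt_nonneg κ)
  have hK2 := hK0 c hc0
  -- The sum dominates the three constants, and the summand 1 makes it positive.
  refine ⟨C₁ + K √κ + K c + 1, by positivity, ?_⟩
  intro Ω hΩ M hdel hbox hreg τ hτ
  have hΩo : IsOpen Ω := hΩ ▸ isOpen_interior
  have hh := fun r : ℝ => Real.rpow_nonneg M.meshSize_nonneg r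
  have hs := fun q => Real.sqrt_nonneg (∑ e ∈ M.faces, M.diam (τ e.1 e.2) ^ 3 * M.dij e.1 e.2 *
    ∫ x in M.face e.1 e.2, |M.edgeDeriv q e.1 e.2 x| ^ 2 ∂μHE[d - 1])
  have hmono : ∀ {A C x y z : ℝ}, A ≤ C → 0 ≤ x → 0 ≤ y → 0 ≤ z →
      A * x * y * z ≤ C * x * y * z := fun h hx hy hz =>
    mul_le_mul_of_nonneg_right (mul_le_mul_of_nonneg_right
      (mul_le_mul_of_nonneg_right h hx) hy) hz
  refine ⟨fun p g t H hp hH htr q hq => ?_, fun p q hp hq => ?_, fun p q hp hq => ?_⟩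
  · refine (RhieChow.Triangulation.abs_sB_le hd1 hν hκ hΩ hdel hbox hreg hτ hp hH htr hq).trans ?_
    rw [← hC₁]
    exact hmono (by linarith) (hh _) (Real.sqrt_nonneg _) (hs q)
  · rw [RhieChow.Triangulation.sBDiscrete_eq hΩo hdel ν hp]
    refine (RhieChow.Triangulation.abs_discreteForm_le hd1 hν hκ hΩ hdel hbox hreg hτ hp hq
      (G := fun i => ∫ y in M.cell i, gradient p y) (Real.sqrt_nonneg κ) fun i hi =>
      RhieChow.Triangulation.norm_integral_gradient_le hκ hbox hreg hp hi).trans ?_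
    refine le_trans (le_of_eq ?_) (hmono (by linarith : K √κ ≤ _) (hh _) (Real.sqrt_nonneg _) (hs q))
    rw [hK]
  · rw [RhieChow.Triangulation.sTilde_eq]
    refine (RhieChow.Triangulation.abs_discreteForm_le hd1 hν hκ hΩ hdel hbox hreg hτ hp hq
      (G := fun i => M.cellVol i • M.gaussGreen p i) hc0 fun i hi => hc ▸
      RhieChow.Triangulation.norm_gaussGreen_le hκ hd1 hΩo hdel hbox hreg hp hi).trans ?_
    refine le_trans (le_of_eq ?_) (hmono (by linarith : K c ≤ _) (hh _) (Real.sqrt_nonneg _) (hs q))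
    rw [hK]
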